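/- Let $d\ge 1$, let $\Omega\subset\mathbb{R}^d$ be a bounded (not necessarily convex) polygonal or polyhedral domain, and let $\mathbb{M}$ be a (measurable) field of symmetric $d\times d$ matrices on $\Omega$, independent of time, with $\underline{m}I\le\mathbb{M}(x)\le\overline{m}I$ for all $x\in\Omega$, where $\underline m,\overline m>0$. Let $p\ge 1$ with $4p>d$, and let $\hat K$ be an equilateral reference simplex with $|\hat K|=1$. *Functional.* Consider simplicial meshes $\mathcal{T}_h$ of $\Omega$ with $N$ elements, vertices $x_1,\dots,x_{N_v}$ and fixed connectivity. For an element $K$ let $F_K'$ be the Jacobian matrix of the affine map $\hat K\to K$, $|K|$ the volume, $\mathbb{M}_K$ the average of $\mathbb{M}$ over $K$, and $a_{K,\mathbb{M}}$ the minimum altitude of $K$ in the metric $\mathbb{M}_K$. Put $$I_h(\mathcal{T}_h)=\sum_{K\in\mathcal{T}_h}|K|\det(\mathbb{M}_K)^{\frac12}\left\|(F_K')^{-1}\mathbb{M}_K^{-1}(F_K')^{-T}-\Big(\frac{\sigma}{N}\Big)^{-\frac2d}I\right\|_F^{2p},$$ where either $\sigma=\sigma_h(\mathcal{T}_h)=\sum_{K}|K|\det(\mathbb{M}_K)^{1/2}$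 or $\sigma$ is a fixed positive constant. A mesh is nonsingular if its elements are nondegenerate, have disjoint interiors and cover $\overline\Omega$ exactly. *Trajectory.* Let $\mathcal{T}_h(t)$, $0\le t<T\le\infty$, be a trajectory of the semi-discrete moving mesh equation $$\frac{dx_i}{dt}=-\frac{P_i}{\tau}\,\Pi_i\left(\frac{\partial I_h}{\partial x_i}\right)^T,\qquad i=1,\dots,N_v,$$ with $\tau>0$, $P_i>0$, starting from a nonsingular mesh $\mathcal{T}_h(0)$ of $\Omega$. Here $\Pi_i$ is the orthogonal projection onto a subspace $V_i$ that is parallel to all boundary facets of $\mathcal{T}_h(0)$ containing $x_i$, a boundary facet being one that belongs to a single element. Thus $\Pi_i$ is the identity for a free interior vertex, boundary vertices only slide along the boundary, and corners are fixed. The vertices are assumed to move continuously. The equation is assumed at those times $t\in[0,T)$ at which no element is degenerate; $I_h$ is then assumed to be differentiable with respect to vertex displacements in the spaces $V_i$. *Conclusion.* The mesh $\mathcal{T}_h(t)$ is nonsingular for all $t\in[0,T)$, and $\sigma_h(\mathcal{T}_h(t))\ge\underline m^{d/2}|\Omega|$. If moreover $\overline m\ge1$ (which can always be achieved by enlarging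 the upper bound $\overline m$) and $(d,N)\ne(1,1)$, then for all $t\in[0,T)$ and all $K\in\mathcal{T}_h(t)$ $$a_{K,\mathbb{M}}\ge C_1\,\overline m^{-\frac{d}{2(4p-d)}}N^{-\frac{4p}{d(4p-d)}},\qquad |K|\ge C_2\,\overline m^{-\frac{d^2}{2(4p-d)}-\frac d2}N^{-\frac{4p}{4p-d}},$$ $$C_1=\left(\frac{2^{6p}\,(d!)^{\frac{4p}{d}}\,\alpha}{d^{4p}(d+1)^{4p-\frac{2p}{d}}\big(\beta|\Omega|+I_h(\mathcal{T}_h(0))\big)}\right)^{\frac1{4p-d}},\qquad C_2=\frac{C_1^d}{d!},$$ $$\alpha=\frac{2^{1-2p}\,\underline m^{d/2}}{\overline m^{2p}d^{2p}},\qquad \beta=\underline m^{d/2}(\gamma^2d)^p,\qquad \gamma=\Big(\frac{\sigma}{N}\Big)^{-\frac2d},$$ where $\sigma$ in $\gamma$ is its value at $\mathcal{T}_h(t)$. By the lower bound on $\sigma_h$, the constants $C_1,C_2$ are bounded below by positive constants independent of $t$. -/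

import Mathlib

open MeasureTheory

namespace MovingMesh

noncomputable section

/-- Points of `ℝᵈ` with the Euclidean norm. -/
abbrev Pt (d : ℕ) : Type := EuclideanSpace ℝ (Fin d)

/-- The positions of `Nv` mesh vertices. -/
abbrev Config (d Nv : ℕ) : Type := Fin Nv → Pt d

/-- The connectivity of a simplicial mesh with `N` elements and `Nv` vertices: `conn k j` is the
global index of the `j`-th vertex of the `k`-th element. -/
abbrev Connectivity (d N Nv : ℕ) : Type := Fin N → Fin (d + 1) → Fin Nv

/-- A bounded, not necessarily convex, polygonal or polyhedral domain: a bounded, nonempty,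
connected open set whose boundary lies in a finite union of proper affine subspaces. -/
structure IsPolyhedralDomain {d : ℕ} (Ω : Set (Pt d)) : Prop where
  isOpen : IsOpen Ω
  isBounded : Bornology.IsBounded Ω
  isConnected : IsConnected Ω
  flat_boundary : ∃ H : Finset (AffineSubspace ℝ (Pt d)),
    (∀ h ∈ H, h ≠ ⊤) ∧ frontier Ω ⊆ ⋃ h ∈ H, (h : Set (Pt d))

/-- A symmetric metric tensor field with `mlo I ≤ M(y) ≤ mhi I` on `Ω` (symmetry is part of
`Matrix.PosSemidef`), with measurable entries. -/
structure IsMetricTensor {d : ℕ} (Ω : Set (Pt d)) (mlo mhi : ℝ)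
    (M : Pt d → Matrix (Fin d) (Fin d) ℝ) : Prop where
  measurable : ∀ i j, AEMeasurable (fun y => M y i j) (volume.restrict Ω)
  lower : ∀ y ∈ Ω, (M y - mlo • (1 : Matrix (Fin d) (Fin d) ℝ)).PosSemidef
  upper : ∀ y ∈ Ω, (mhi • (1 : Matrix (Fin d) (Fin d) ℝ) - M y).PosSemidef

/-! ### Simplices -/

/-- The closed simplex with vertices `v`. -/
def simplex {d : ℕ} (v : Fin (d + 1) → Pt d) : Set (Pt d) := convexHull ℝ (Set.range v)

/-- The volume `|K|` of the simplex with vertices `v`. -/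
def simplexVolume {d : ℕ} (v : Fin (d + 1) → Pt d) : ℝ := volume.real (simplex v)

/-- The edge matrix `[v₁ - v₀, …, v_d - v₀]`. -/
def edgeMatrix {d : ℕ} (v : Fin (d + 1) → Pt d) : Matrix (Fin d) (Fin d) ℝ :=
  Matrix.of fun i j => v j.succ i - v 0 i

/-- An equilateral reference simplex of volume one. -/
structure IsReferenceElement {d : ℕ} (ξ : Fin (d + 1) → Pt d) : Prop where
  equilateral : ∃ ℓ : ℝ, ∀ i j, i ≠ j → dist (ξ i) (ξ j) = ℓ
  unitary : simplexVolume ξ = 1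

/-- The Jacobian matrix `F_K'` of the affine map taking the vertices `ξ` of the reference element
to the vertices `v` of `K`. -/
def jacobian {d : ℕ} (ξ v : Fin (d + 1) → Pt d) : Matrix (Fin d) (Fin d) ℝ :=
  edgeMatrix v * (edgeMatrix ξ)⁻¹

/-- The (entrywise) average `M_K` of `M` over the simplex with vertices `v`. -/
def avgMetric {d : ℕ} (M : Pt d → Matrix (Fin d) (Fin d) ℝ) (v : Fin (d + 1) → Pt d) :
    Matrix (Fin d) (Fin d) ℝ :=
  Matrix.of fun i j => ⨍ y in simplex v, M y i j

/-- The length `√(uᵀ A u)` of `u` in the constant metric `A`. -/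
def metricLength {d : ℕ} (A : Matrix (Fin d) (Fin d) ℝ) (u : Pt d) : ℝ :=
  Real.sqrt (∑ i, ∑ j, u i * A i j * u j)

/-- The altitude from the `j`-th vertex in the metric `A`: the distance, measured in `A`, from that
vertex to the affine hull of the other vertices. -/
def altitude {d : ℕ} (A : Matrix (Fin d) (Fin d) ℝ) (v : Fin (d + 1) → Pt d) (j : Fin (d + 1)) :
    ℝ :=
  sInf ((fun z => metricLength A (v j - z)) ''
    (affineSpan ℝ (v '' {l | l ≠ j}) : Set (Pt d)))

/-- The minimum altitude in the metric `A`. -/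
def minAltitude {d : ℕ} (A : Matrix (Fin d) (Fin d) ℝ) (v : Fin (d + 1) → Pt d) : ℝ :=
  ⨅ j, altitude A v j

/-! ### Meshes -/

/-- The vertices of the `k`-th element. -/
def elem {d N Nv : ℕ} (conn : Connectivity d N Nv) (x : Config d Nv) (k : Fin N) :
    Fin (d + 1) → Pt d :=
  fun j => x (conn k j)

/-- No element is degenerate. -/
def Nondegenerate {d N Nv : ℕ} (conn : Connectivity d N Nv) (x : Config d Nv) : Prop :=
  ∀ k, AffineIndependent ℝ (elem conn x k)

/-- The elements form a nonsingular mesh of `Ω`: they are nondegenerate, do not overlap and cover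
`Ω` exactly. -/
structure IsNonsingularMesh {d N Nv : ℕ} (Ω : Set (Pt d)) (conn : Connectivity d N Nv)
    (x : Config d Nv) : Prop where
  nondegenerate : Nondegenerate conn x
  disjoint : ∀ k l, k ≠ l →
    Disjoint (interior (simplex (elem conn x k))) (interior (simplex (elem conn x l)))
  cover : ⋃ k, simplex (elem conn x k) = closure Ω

/-- The global indices of the vertices of the facet of the `k`-th element opposite to its `j`-th
vertex. -/
def facet {d N Nv : ℕ} (conn : Connectivity d N Nv) (k : Fin N) (j : Fin (d + 1)) :
    Set (Fin Nv) :=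
  conn k '' {l | l ≠ j}

/-- A boundary facet: a facet that is not shared with another element. -/
def IsBoundaryFacet {d N Nv : ℕ} (conn : Connectivity d N Nv) (k : Fin N) (j : Fin (d + 1)) :
    Prop :=
  ∀ k' j', k' ≠ k → facet conn k' j' ≠ facet conn k j

/-- The directions in which the `i`-th vertex of the mesh `x` can slide along the boundary: those
parallel to all boundary facets that contain it. This is everything for an interior vertex, the
tangent hyperplane for a vertex in a flat part of the boundary, and `{0}` for a corner. -/
def slideSpace {d N Nv : ℕ} (conn : Connectivity d N Nv) (x : Config d Nv) (i : Fin Nv) :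
    Submodule ℝ (Pt d) :=
  ⨅ (k : Fin N) (j : Fin (d + 1)) (_ : IsBoundaryFacet conn k j) (_ : i ∈ facet conn k j),
    vectorSpan ℝ (x '' facet conn k j)

/-! ### The functional -/

/-- The Frobenius norm. -/
def frobNorm {d : ℕ} (A : Matrix (Fin d) (Fin d) ℝ) : ℝ :=
  Real.sqrt (∑ i, ∑ j, A i j ^ 2)

/-- `σ_h = ∑_K |K| det(M_K)^{1/2}`. -/
def sigmaH {d N Nv : ℕ} (M : Pt d → Matrix (Fin d) (Fin d) ℝ) (conn : Connectivity d N Nv)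
    (x : Config d Nv) : ℝ :=
  ∑ k, simplexVolume (elem conn x k) * Real.sqrt (avgMetric M (elem conn x k)).det

/-- The meshing functional
`∑_K |K| det(M_K)^{1/2} ‖(F_K')⁻¹ M_K⁻¹ (F_K')⁻ᵀ - (σ/N)^{-2/d} I‖_F^{2p}`,
with the value `σ` of `σ_h` as an argument. -/
def energy {d N Nv : ℕ} (M : Pt d → Matrix (Fin d) (Fin d) ℝ) (ξ : Fin (d + 1) → Pt d) (p : ℝ)
    (conn : Connectivity d N Nv) (σ : ℝ) (x : Config d Nv) : ℝ :=
  ∑ k, simplexVolume (elem conn x k) * Real.sqrt (avgMetric M (elem conn x k)).det *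
    frobNorm ((jacobian ξ (elem conn x k))⁻¹ * (avgMetric M (elem conn x k))⁻¹ *
        ((jacobian ξ (elem conn x k))⁻¹).transpose -
      ((σ / N) ^ (-(2 : ℝ) / d)) • (1 : Matrix (Fin d) (Fin d) ℝ)) ^ (2 * p)

/-! ### The moving mesh equation -/

/-- `x`, on the time interval `[0, T)`, is a trajectory of the moving mesh equation
`dxᵢ/dt = -(Pᵢ/τ) (∂I/∂xᵢ)ᵀ`, where the velocity of the `i`-th vertex is projected orthogonally to
the space `V i` (all of `ℝᵈ` for a vertex that moves freely, a space of directions along the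
boundary for a boundary vertex, `{0}` for a fixed vertex).

The vertices move continuously, and the equation holds at every time at which the mesh has no
degenerate element, so that the functional is defined there; nondegeneracy itself is not required.
The functional need only be differentiable with respect to the admissible motions of the vertices;
`L` is its derivative, and `v` is the orthogonal projection of `-(Pᵢ/τ) (∂I/∂xᵢ)ᵀ` to `V i`. The
time derivative is one-sided at `t = 0`. -/
structure IsTrajectory {d N Nv : ℕ} (conn : Connectivity d N Nv) (I : Config d Nv → ℝ)
    (V : Fin Nv → Submodule ℝ (Pt d)) (P : Fin Nv → ℝ → ℝ) (τ : ℝ) (T : EReal)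
    (x : ℝ → Config d Nv) : Prop where
  continuousOn : ContinuousOn x {t | 0 ≤ t ∧ (t : EReal) < T}
  equation : ∀ t : ℝ, 0 ≤ t → (t : EReal) < T → Nondegenerate conn (x t) →
    ∃ L : Config d Nv →L[ℝ] ℝ,
      HasFDerivWithinAt I L {y | ∀ i, y i - x t i ∈ V i} (x t) ∧
      ∀ i, ∃ v ∈ V i, HasDerivWithinAt (fun s => x s i) v (Set.Ici 0) t ∧
        ∀ w ∈ V i, inner ℝ v w = -(P i t / τ) * L (Pi.single i w)

/-! ### The constants -/

/-- `α = 2^{1-2p} mlo^{d/2} / (mhi^{2p} d^{2p})`. -/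
def alpha (d : ℕ) (p mlo mhi : ℝ) : ℝ :=
  2 ^ (1 - 2 * p) * mlo ^ ((d : ℝ) / 2) / (mhi ^ (2 * p) * (d : ℝ) ^ (2 * p))

/-- `β = mlo^{d/2} (γ² d)^p` with `γ = (σ/N)^{-2/d}`. -/
def beta (d N : ℕ) (p mlo σ : ℝ) : ℝ :=
  mlo ^ ((d : ℝ) / 2) * (((σ / N) ^ (-(2 : ℝ) / d)) ^ 2 * d) ^ p

/-- The constant `C₁`, in terms of `α`, `β`, `|Ω|` and the initial energy. -/
def C1 (d : ℕ) (p α β volΩ I₀ : ℝ) : ℝ :=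
  (2 ^ (6 * p) * (d.factorial : ℝ) ^ (4 * p / d) * α /
    ((d : ℝ) ^ (4 * p) * ((d : ℝ) + 1) ^ (4 * p - 2 * p / d) * (β * volΩ + I₀))) ^
      (1 / (4 * p - d))

/-- The constant `C₂ = C₁ᵈ / d!`. -/
def C2 (d : ℕ) (p α β volΩ I₀ : ℝ) : ℝ :=
  C1 d p α β volΩ I₀ ^ d / (d.factorial : ℝ)

end

end MovingMesh

namespace MovingMesh

noncomputable section

/-! ### Homogeneous coordinates of simplices -/

/-! Two facts hold as long as no element has degenerated: the energy does not increase, and the mesh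
remains a tiling of the domain. Together they bound all element volumes below by a constant
independent of time, so by continuity there is no first degenerate time.

Tiling. Conservation of the total volume alone would not exclude overlaps compensated by gaps, so
the whole measure `meshMeasure`, the sum of Lebesgue measure restricted to the elements, is shown to
be conserved. The test functions are `(1 - ⟨ω, y⟩)^{-(d+1)}` for small `ω`. This function is the
Jacobian of the projective map `projMap ω`, so its integral over a simplex is the volume of another
simplex, the one spanned by the projected vertices (`setIntegral_simplex_den`). Projective maps
preserve hyperplanes, so the projected mesh also moves with its boundary vertices sliding in fixed
hyperplanes. The total signed volume of such a mesh is constant: its rate of change is a sum over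
facets, in which the contributions of neighbours cancel and boundary facets contribute nothing
(`sum_volume_rate_eq_zero`, `total_signed_volume_const`). Expanding in powers of `ω` gives all
moments of the functions `⟨ω, ·⟩`, hence the characteristic function, hence the measure
(`measure_eq_of_integral_den_eq`). Finally, a nondegenerate mesh whose measure is Lebesgue measure
on the closed domain is nonsingular (`isNonsingularMesh_of_meshMeasure_eq`).

Lower bounds. The velocity is a projected negative gradient, so the energy decreases
(`IsTrajectory.energy_le`). On a nonsingular mesh the volumes sum to `|Ω|` and the averaged metrics
inherit the bounds of `M`, so the energy controls `|K| ‖S_K‖^{2p}` for every element, where `S_K` is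
the `shapeMatrix` (`coercivity`). The trace of `S_K` is a multiple of the sum of the squared dual
lengths of the gradients of the barycentric coordinates. Let `Y` be the largest of these and `ρ =
Y^{-1/2}`. Every altitude is at least `ρ`, the volume is at least a multiple of `ρ^d`, and `‖S_K‖`
is at least a multiple of `ρ^{-2}`. Hence `ρ^{d-4p}` is bounded, and as `4p > d` this bounds `ρ`
below (`element_lower_bound`). What remains is to check that the stated constants do not exceed
those obtained in this way (`constant_comparison`). -/

/-- The homogeneous coordinates `(1, y)` of a point. -/
def hom {d : ℕ} (y : Pt d) : Fin (d + 1) → ℝ := Fin.cons 1 y.ofLp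

/-- The matrix whose rows are the homogeneous coordinates of the vertices. -/
def hmat {d : ℕ} (v : Fin (d + 1) → Pt d) : Matrix (Fin (d + 1)) (Fin (d + 1)) ℝ :=
  Matrix.of fun j => hom (v j)

@[simp] lemma hom_zero {d : ℕ} (y : Pt d) : hom y 0 = 1 := rfl

@[simp] lemma hom_succ {d : ℕ} (y : Pt d) (i : Fin d) : hom y i.succ = y i := rfl

@[simp] lemma hmat_apply {d : ℕ} (v : Fin (d + 1) → Pt d) (j : Fin (d + 1)) :
    hmat v j = hom (v j) := rfl

lemma det_hmat {d : ℕ} (v : Fin (d + 1) → Pt d) : (hmat v).det = (edgeMatrix v).det := by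
  have h : (hmat v).det = (Matrix.of (Fin.cons (hom (v 0))
      (fun j : Fin d => hom (v j.succ) - hom (v 0)) : Fin (d + 1) → Fin (d + 1) → ℝ)).det := by
    refine Matrix.det_eq_of_forall_row_eq_smul_add_const (Fin.cons 0 fun _ => 1) 0 rfl ?_
    intro i j
    refine Fin.cases ?_ (fun i => ?_) i
    · simp
    · simp
  rw [h, Matrix.det_succ_column_zero, Fin.sum_univ_succ]
  simp only [Fin.val_zero, pow_zero, one_mul, Matrix.of_apply, Fin.cons_zero, hom_zero,
    Fin.cons_succ, Pi.sub_apply, sub_self, mul_zero, zero_mul, Finset.sum_const_zero, add_zero]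
  rw [← Matrix.det_transpose]
  congr 1

lemma vecMul_hmat_eq_zero_iff {d : ℕ} (v : Fin (d + 1) → Pt d) (w : Fin (d + 1) → ℝ) :
    Matrix.vecMul w (hmat v) = 0 ↔ ∑ j, w j = 0 ∧ ∑ j, w j • v j = 0 := by
  constructor
  · intro h
    constructor
    · simpa [Matrix.vecMul, dotProduct] using congrFun h 0
    · ext i
      simpa [Matrix.vecMul, dotProduct] using congrFun h i.succ
  · rintro ⟨h0, h1⟩
    ext i
    refine Fin.cases ?_ (fun i => ?_) i
    · simpa [Matrix.vecMul, dotProduct] using h0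
    · have := congrArg (fun y : Pt d => y i) h1
      simpa [Matrix.vecMul, dotProduct] using this

lemma affineIndependent_iff_det_hmat {d : ℕ} (v : Fin (d + 1) → Pt d) :
    AffineIndependent ℝ v ↔ (hmat v).det ≠ 0 := by
  rw [Ne, ← Matrix.exists_vecMul_eq_zero_iff, affineIndependent_iff_of_fintype]
  constructor
  · rintro h ⟨w, hw, hw0⟩
    obtain ⟨h0, h1⟩ := (vecMul_hmat_eq_zero_iff v w).1 hw0
    refine hw (funext fun i => h w h0 ?_ i)
    rw [Finset.weightedVSub_eq_linear_combination _ h0]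
    exact h1
  · intro h w h0 h1 i
    by_contra hi
    refine h ⟨w, fun hw => hi (by simp [hw]), (vecMul_hmat_eq_zero_iff v w).2 ⟨h0, ?_⟩⟩
    rwa [Finset.weightedVSub_eq_linear_combination _ h0] at h1

/-- `N_j(u)`, the determinant of the homogeneous coordinates with the `j`-th vertex replaced by
`u`; it is the facet functional of the facet opposite to the `j`-th vertex. -/
def facetForm {d : ℕ} (v : Fin (d + 1) → Pt d) (u : Fin (d + 1) → ℝ) (j : Fin (d + 1)) : ℝ :=
  (hmat v).transpose.cramer u j

lemma facetForm_eq_det {d : ℕ} (v : Fin (d + 1) → Pt d) (u : Fin (d + 1) → ℝ)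
    (j : Fin (d + 1)) : facetForm v u j = ((hmat v).updateRow j u).det :=
  Matrix.cramer_transpose_apply _ _ _

/-- Cramer's rule: up to the factor `det`, the facet functionals are the coefficients of `u` with
respect to the rows of `hmat v`. -/
lemma sum_facetForm_smul {d : ℕ} (v : Fin (d + 1) → Pt d) (u : Fin (d + 1) → ℝ) :
    ∑ j, facetForm v u j • hom (v j) = (hmat v).det • u := by
  have h := Matrix.mulVec_cramer (hmat v).transpose u
  rw [Matrix.det_transpose] at h
  rw [← h]
  ext i
  simp [Matrix.mulVec, dotProduct, facetForm, Matrix.transpose_apply, mul_comm]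

lemma sum_facetForm {d : ℕ} (v : Fin (d + 1) → Pt d) (u : Fin (d + 1) → ℝ) :
    ∑ j, facetForm v u j = (hmat v).det * u 0 := by
  simpa using congrFun (sum_facetForm_smul v u) 0

lemma facetForm_self {d : ℕ} (v : Fin (d + 1) → Pt d) (j : Fin (d + 1)) :
    facetForm v (hom (v j)) j = (hmat v).det := by
  rw [facetForm_eq_det, ← hmat_apply v j, Matrix.updateRow_eq_self]

lemma facetForm_of_ne {d : ℕ} (v : Fin (d + 1) → Pt d) {i j : Fin (d + 1)} (h : i ≠ j) :
    facetForm v (hom (v i)) j = 0 := by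
  rw [facetForm_eq_det]
  exact Matrix.det_updateRow_eq_zero h

/-- A nondegenerate simplex as an affine basis. -/
def simplexBasis {d : ℕ} (v : Fin (d + 1) → Pt d) (h : AffineIndependent ℝ v) :
    AffineBasis (Fin (d + 1)) ℝ (Pt d) :=
  ⟨v, h, by rw [h.affineSpan_eq_top_iff_card_eq_finrank_add_one]; simp⟩

/-- The functional is linear in homogeneous coordinates, and its values at the vertices are `det` at
the `j`-th and zero at the others. -/
lemma facetForm_hom {d : ℕ} (v : Fin (d + 1) → Pt d) (h : AffineIndependent ℝ v) (y : Pt d)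
    (j : Fin (d + 1)) :
    facetForm v (hom y) j = (hmat v).det * (simplexBasis v h).coord j y := by
  have hy : hom y = ∑ i, (simplexBasis v h).coord i y • hom (v i) := by
    ext l
    refine Fin.cases ?_ (fun l => ?_) l
    · simp
    · have := congrArg (fun z : Pt d => z l)
        ((simplexBasis v h).linear_combination_coord_eq_self y)
      simp only [WithLp.ofLp_sum, WithLp.ofLp_smul, Finset.sum_apply, Pi.smul_apply] at this
      simp only [hom_succ, Finset.sum_apply, Pi.smul_apply]
      exact this.symm
  rw [hy]
  simp only [facetForm, map_sum, map_smul, Finset.sum_apply, Pi.smul_apply, smul_eq_mul]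
  rw [Finset.sum_eq_single j]
  · rw [← facetForm_self v j, facetForm, mul_comm]
  · intro i _ hi
    have := facetForm_of_ne v hi
    rw [facetForm] at this
    rw [this, mul_zero]
  · simp

/-- Positivity of all barycentric coordinates; the factor `det` makes the criterion independent of
the orientation. -/
lemma mem_interior_simplex {d : ℕ} {v : Fin (d + 1) → Pt d} (h : AffineIndependent ℝ v)
    (y : Pt d) :
    y ∈ interior (simplex v) ↔ ∀ j, 0 < (hmat v).det * facetForm v (hom y) j := by
  have h1 := (simplexBasis v h).interior_convexHull
  have h2 : interior (simplex v) = {x | ∀ i, 0 < (simplexBasis v h).coord i x} := h1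
  have hdet := (affineIndependent_iff_det_hmat v).1 h
  rw [h2]
  refine forall_congr' fun j => ?_
  rw [facetForm_hom v h, ← mul_assoc]
  exact (mul_pos_iff_of_pos_left (mul_self_pos.2 hdet)).symm

/-! ### The volume of a simplex -/

/-- The corner simplex `{u ≥ 0, ∑ u ≤ 1}`. -/
def corner (d : ℕ) : Set (Fin d → ℝ) := {u | (∀ i, 0 ≤ u i) ∧ ∑ i, u i ≤ 1}

lemma measurableSet_corner (d : ℕ) : MeasurableSet (corner d) := by
  refine IsClosed.measurableSet ?_
  rw [corner, Set.ofPred_and, Set.ofPred_forall]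
  refine (isClosed_iInter fun i => isClosed_le continuous_const (continuous_apply i)).inter
    (isClosed_le (by fun_prop) continuous_const)

-- The slice of the corner simplex at height `s` is the lower-dimensional corner simplex scaled by
-- `1 - s`.
open scoped Pointwise in
lemma volume_corner_slice (d : ℕ) (s : ℝ) :
    volume {u : Fin d → ℝ | Fin.cons s u ∈ corner (d + 1)} =
      (Set.Icc (0 : ℝ) 1).indicator (fun s => ENNReal.ofReal ((1 - s) ^ d) * volume (corner d))
        s := by
  have hmem : ∀ u : Fin d → ℝ, (Fin.cons s u : Fin (d + 1) → ℝ) ∈ corner (d + 1) ↔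
      (0 ≤ s ∧ ∀ i, 0 ≤ u i) ∧ s + ∑ i, u i ≤ 1 := by
    intro u
    simp [corner, Fin.forall_fin_succ, Fin.sum_univ_succ]
  by_cases hs : s ∈ Set.Icc (0 : ℝ) 1
  · rw [Set.indicator_of_mem hs]
    -- At `s = 1` the scaling factor vanishes. The slice is then a single point, which is null for
    -- `d > 0`; for `d = 0` it has full measure, in agreement with `0 ^ 0 = 1`.
    rcases hs.2.eq_or_lt with h1 | h1
    · rcases Nat.eq_zero_or_pos d with rfl | hd
      · have : {u : Fin 0 → ℝ | (Fin.cons s u : Fin 1 → ℝ) ∈ corner 1} = corner 0 := by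
          ext u
          have := hmem u
          simp only [Set.mem_ofPred_eq]
          rw [this]
          simp [corner, hs.1, hs.2]
        rw [this]
        simp
      · subst h1
        rw [sub_self, zero_pow hd.ne', ENNReal.ofReal_zero, zero_mul]
        refine measure_mono_null (t := {0}) ?_ ?_
        · intro u hu
          obtain ⟨⟨_, h2⟩, h3⟩ := (hmem u).1 hu
          have h4 : ∑ i, u i = 0 := le_antisymm (by linarith) (Finset.sum_nonneg fun i _ => h2 i)
          rw [Finset.sum_eq_zero_iff_of_nonneg fun i _ => h2 i] at h4
          exact funext fun i => h4 i (Finset.mem_univ i)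
        · have : Nonempty (Fin d) := ⟨⟨0, hd⟩⟩
          exact measure_singleton 0
    · have hpos : 0 < 1 - s := by linarith
      have : {u : Fin d → ℝ | (Fin.cons s u : Fin (d + 1) → ℝ) ∈ corner (d + 1)} =
          (1 - s) • corner d := by
        ext u
        rw [Set.mem_smul_set_iff_inv_smul_mem₀ hpos.ne']
        change (Fin.cons s u : Fin (d + 1) → ℝ) ∈ corner (d + 1) ↔ _
        rw [hmem]
        simp only [corner, Set.mem_ofPred_eq, Pi.smul_apply, smul_eq_mul, ← Finset.mul_sum]
        refine and_congr ?_ ?_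
        · simp only [hs.1, true_and]
          refine forall_congr' fun i => ?_
          exact (mul_nonneg_iff_of_pos_left (inv_pos.2 hpos)).symm
        · rw [inv_mul_le_iff₀ hpos, mul_one]
          constructor <;> intro <;> linarith
      rw [this, Measure.addHaar_smul, Module.finrank_fin_fun, abs_of_nonneg (by positivity)]
  · rw [Set.indicator_of_notMem hs]
    have : {u : Fin d → ℝ | (Fin.cons s u : Fin (d + 1) → ℝ) ∈ corner (d + 1)} = ∅ := by
      ext u
      simp only [Set.mem_ofPred_eq, hmem, Set.mem_empty_iff_false, iff_false]
      rintro ⟨⟨h1, h2⟩, h3⟩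
      have : 0 ≤ ∑ i, u i := Finset.sum_nonneg fun i _ => h2 i
      exact hs ⟨h1, by linarith⟩
    rw [this, measure_empty]

/-- Fubini over the slices: the integral of `(1 - s)^d` over `[0, 1]` contributes the factor `1 / (d
+ 1)`. -/
lemma volume_corner (d : ℕ) : volume (corner d) = ENNReal.ofReal (1 / (d.factorial : ℝ)) := by
  induction d with
  | zero =>
    have : corner 0 = Set.univ := by ext u; simp [corner]
    rw [this, volume_pi, Measure.pi_univ]
    simp
  | succ d ih =>
    have hmp := (volume_preserving_piFinSuccAbove (fun _ : Fin (d + 1) => ℝ) 0).symm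
    rw [← hmp.measure_preimage (measurableSet_corner (d + 1)).nullMeasurableSet]
    rw [Measure.volume_eq_prod, Measure.prod_apply
      (hmp.measurable (measurableSet_corner (d + 1)))]
    have : ∀ s : ℝ, (Prod.mk s ⁻¹'
        ((MeasurableEquiv.piFinSuccAbove (fun _ : Fin (d + 1) => ℝ) 0).symm ⁻¹' corner (d + 1))) =
        {u : Fin d → ℝ | Fin.cons s u ∈ corner (d + 1)} := by
      intro s
      ext u
      simp [MeasurableEquiv.piFinSuccAbove, Fin.insertNthEquiv]
    simp only [this, volume_corner_slice]
    rw [lintegral_indicator measurableSet_Icc, lintegral_mul_const _ (by fun_prop), ih,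
      ← ofReal_integral_eq_lintegral_ofReal, ← ENNReal.ofReal_mul]
    · congr 1
      rw [integral_Icc_eq_integral_Ioc, ← intervalIntegral.integral_of_le zero_le_one,
        intervalIntegral.integral_comp_sub_left (fun s => s ^ d) 1]
      simp [Nat.factorial_succ]
      field_simp
    · refine setIntegral_nonneg measurableSet_Icc fun s hs => ?_
      have : 0 ≤ 1 - s := by linarith [hs.2]
      positivity
    · exact (Continuous.integrableOn_Icc (by fun_prop))
    · refine (ae_restrict_iff' measurableSet_Icc).2 (Filter.Eventually.of_forall fun s hs => ?_)
      have : 0 ≤ 1 - s := by linarith [hs.2]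
      exact pow_nonneg this d

lemma simplex_eq_image {d : ℕ} (v : Fin (d + 1) → Pt d) :
    simplex v = (fun y => v 0 + y) '' (Matrix.toEuclideanLin (edgeMatrix v) ''
      (WithLp.ofLp ⁻¹' corner d)) := by
  have key : ∀ u : Pt d, v 0 + Matrix.toEuclideanLin (edgeMatrix v) u =
      (1 - ∑ i, u i) • v 0 + ∑ i : Fin d, u i • v i.succ := by
    intro u
    ext l
    simp only [edgeMatrix, PiLp.add_apply, Matrix.ofLp_toLpLin, Matrix.toLin'_apply, Matrix.mulVec,
      dotProduct, Matrix.of_apply, WithLp.ofLp_sum, WithLp.ofLp_smul, PiLp.smul_apply,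
      smul_eq_mul, Finset.sum_apply, Pi.smul_apply, sub_mul, one_mul, Finset.sum_sub_distrib,
      Finset.sum_mul]
    simp only [mul_comm]
    ring
  rw [simplex, convexHull_range_eq_exists_affineCombination]
  ext y
  constructor
  · rintro ⟨s, w, hw0, hw1, rfl⟩
    set w' : Fin (d + 1) → ℝ := fun i => if i ∈ s then w i else 0 with hw'
    have hw'0 : ∀ i, 0 ≤ w' i := fun i => by
      by_cases h : i ∈ s <;> simp [hw', h, hw0]
    have hw'1 : ∑ i, w' i = 1 := by simp [hw', hw1]
    refine ⟨_, ⟨WithLp.toLp 2 fun i => w' i.succ, ⟨fun i => hw'0 _, ?_⟩, rfl⟩, ?_⟩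
    · rw [Fin.sum_univ_succ] at hw'1
      have := hw'0 0
      simp only
      linarith
    · change v 0 + _ = _
      rw [key]
      rw [Finset.affineCombination_eq_linear_combination _ _ _ hw1]
      have h1 : ∑ i ∈ s, w i • v i = ∑ i, w' i • v i := by
        simp [hw', ite_smul]
      rw [h1, Fin.sum_univ_succ]
      congr 2
      rw [Fin.sum_univ_succ] at hw'1
      simp only
      linarith
  · rintro ⟨_, ⟨u, ⟨hu0, hu1⟩, rfl⟩, rfl⟩
    refine ⟨Finset.univ, Fin.cons (1 - ∑ i, u i) u.ofLp, ?_, ?_, ?_⟩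
    · intro i _
      refine Fin.cases ?_ (fun i => ?_) i
      · simpa using hu1
      · simpa using hu0 i
    · simp [Fin.sum_univ_succ]
    · rw [Finset.affineCombination_eq_linear_combination _ _ _ (by simp [Fin.sum_univ_succ])]
      change _ = v 0 + _
      rw [key, Fin.sum_univ_succ]
      simp

lemma volume_simplex {d : ℕ} (v : Fin (d + 1) → Pt d) :
    volume (simplex v) = ENNReal.ofReal (|(hmat v).det| / (d.factorial : ℝ)) := by
  rw [simplex_eq_image, Set.image_add_left, measure_preimage_add,
    Measure.addHaar_image_linearMap,
    (PiLp.volume_preserving_ofLp (Fin d)).measure_preimage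
      (measurableSet_corner d).nullMeasurableSet,
    volume_corner, ← ENNReal.ofReal_mul (abs_nonneg _), det_hmat, mul_one_div]
  congr 3
  rw [Matrix.toEuclideanLin_eq_toLin_orthonormal, LinearMap.det_toLin]

lemma simplexVolume_eq {d : ℕ} (v : Fin (d + 1) → Pt d) :
    simplexVolume v = |(hmat v).det| / (d.factorial : ℝ) := by
  rw [simplexVolume, Measure.real, volume_simplex, ENNReal.toReal_ofReal (by positivity)]

/-! ### Conservation of the total signed volume of a moving mesh -/

/-- The homogeneous coordinates `(0, u)` of a direction. -/
def homDir {d : ℕ} (u : Pt d) : Fin (d + 1) → ℝ := Fin.cons 0 u.ofLp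

@[simp] lemma homDir_zero {d : ℕ} (y : Pt d) : homDir y 0 = 0 := rfl

@[simp] lemma homDir_succ {d : ℕ} (y : Pt d) (i : Fin d) : homDir y i.succ = y i := rfl

lemma hasDerivWithinAt_hom {d : ℕ} {y : ℝ → Pt d} {y' : Pt d} {S : Set ℝ} {t : ℝ}
    (h : HasDerivWithinAt y y' S t) :
    HasDerivWithinAt (fun s => hom (y s)) (homDir y') S t := by
  rw [hasDerivWithinAt_pi]
  intro i
  refine Fin.cases ?_ (fun i => ?_) i
  · simpa using hasDerivWithinAt_const t S (1 : ℝ)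
  · exact (EuclideanSpace.proj (𝕜 := ℝ) i).hasFDerivAt.comp_hasDerivWithinAt t h

/-- The determinant as a continuous multilinear map of the rows. -/
def detMultilinear (n : ℕ) : ContinuousMultilinearMap ℝ (fun _ : Fin n => Fin n → ℝ) ℝ where
  toMultilinearMap := (Matrix.detRowAlternating (n := Fin n) (R := ℝ)).toMultilinearMap
  cont := (continuous_id.matrix_det : Continuous fun A : Matrix (Fin n) (Fin n) ℝ => A.det)

/-- The product rule for the rows: differentiating the `j`-th row replaces it by `homDir (v' j)`,
which is the determinant that defines the `j`-th facet functional. -/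
lemma hasDerivWithinAt_det_hmat {d : ℕ} {v : ℝ → Fin (d + 1) → Pt d} {v' : Fin (d + 1) → Pt d}
    {S : Set ℝ} {t : ℝ} (h : ∀ j, HasDerivWithinAt (fun s => v s j) (v' j) S t) :
    HasDerivWithinAt (fun s => (hmat (v s)).det) (∑ j, facetForm (v t) (homDir (v' j)) j) S t := by
  have h1 := HasFDerivWithinAt.multilinear_comp (f := detMultilinear (d + 1))
    (g := fun j s => hom (v s j)) fun j => (hasDerivWithinAt_hom (h j)).hasFDerivWithinAt
  have h2 := h1.hasDerivWithinAt
  refine h2.congr_deriv ?_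
  simp only [_root_.sum_apply, ContinuousLinearMap.comp_apply]
  refine Finset.sum_congr rfl fun j _ => ?_
  rw [facetForm_eq_det]
  simp [detMultilinear, Matrix.updateRow, hmat]
  rfl

lemma facetForm_sum {d : ℕ} {ι : Type*} (v : Fin (d + 1) → Pt d) (s : Finset ι)
    (u : ι → Fin (d + 1) → ℝ) (j : Fin (d + 1)) :
    facetForm v (∑ i ∈ s, u i) j = ∑ i ∈ s, facetForm v (u i) j := by
  simp [facetForm]

lemma facetForm_add {d : ℕ} (v : Fin (d + 1) → Pt d) (u u' : Fin (d + 1) → ℝ)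
    (j : Fin (d + 1)) : facetForm v (u + u') j = facetForm v u j + facetForm v u' j := by
  simp [facetForm]

lemma facetForm_smul {d : ℕ} (v : Fin (d + 1) → Pt d) (c : ℝ) (u : Fin (d + 1) → ℝ)
    (j : Fin (d + 1)) : facetForm v (c • u) j = c * facetForm v u j := by
  simp [facetForm]

/-- The rate of change of the volume as a sum over the facets. -/
lemma sum_facetForm_homDir {d : ℕ} (v v' : Fin (d + 1) → Pt d) :
    ∑ j, facetForm v (homDir (v' j)) j =
      -∑ j, facetForm v (∑ l ∈ Finset.univ.erase j, homDir (v' l)) j := by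
  -- Translation invariance: moving all vertices by the same vector does not change the volume. This
  -- trades the velocity of vertex `j` for the velocities on the opposite facet, so that each term
  -- is attached to a facet.
  have h0 : ∑ j, facetForm v (∑ l, homDir (v' l)) j = 0 := by
    rw [sum_facetForm]
    simp
  have h1 : ∀ j, facetForm v (∑ l, homDir (v' l)) j = facetForm v (homDir (v' j)) j +
      facetForm v (∑ l ∈ Finset.univ.erase j, homDir (v' l)) j := by
    intro j
    rw [← facetForm_add, Finset.add_sum_erase _ (fun l => homDir (v' l)) (Finset.mem_univ j)]
  simp only [h1, Finset.sum_add_distrib] at h0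
  linarith

lemma Nondegenerate.injective {d N Nv : ℕ} {conn : Connectivity d N Nv} {x : Config d Nv}
    (h : Nondegenerate conn x) (k : Fin N) : Function.Injective (conn k) :=
  Function.Injective.of_comp (f := x) (h k).injective

open Classical in
lemma sum_erase_eq_sum_facet {d N Nv : ℕ} {conn : Connectivity d N Nv} {k : Fin N}
    (hinj : Function.Injective (conn k)) (j : Fin (d + 1)) {A : Type*} [AddCommMonoid A]
    (g : Fin Nv → A) :
    ∑ l ∈ Finset.univ.erase j, g (conn k l) = ∑ i ∈ (facet conn k j).toFinset, g i := by
  rw [← Finset.sum_image (f := g) (g := conn k) (hinj.injOn)]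
  congr 1
  ext i
  rw [Set.mem_toFinset]
  simp [facet]

lemma facet_injective {d N Nv : ℕ} {conn : Connectivity d N Nv} {k : Fin N}
    (hinj : Function.Injective (conn k)) : Function.Injective (facet conn k) := by
  intro j j' h
  by_contra hne
  have : conn k j ∈ facet conn k j' := ⟨j, hne, rfl⟩
  rw [← h] at this
  obtain ⟨l, hl, hlj⟩ := this
  exact hl (hinj hlj)

/-- Facet functionals of two elements with a common facet agree up to a sign that depends only on
the connectivity. -/
lemma exists_facetForm_eq {d N Nv : ℕ} {conn : Connectivity d N Nv}
    (hinj : ∀ k, Function.Injective (conn k)) {k k' : Fin N} {j j' : Fin (d + 1)}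
    (h : facet conn k' j' = facet conn k j) :
    ∃ ε : ℝ, (ε = 1 ∨ ε = -1) ∧ ∀ (x : Config d Nv) (u : Fin (d + 1) → ℝ),
      facetForm (elem conn x k) u j = ε * facetForm (elem conn x k') u j' := by
  have h1 : ∀ l : Fin (d + 1), l ≠ j → ∃ l' : Fin (d + 1), l' ≠ j' ∧ conn k' l' = conn k l := by
    intro l hl
    have : conn k l ∈ facet conn k' j' := h ▸ ⟨l, hl, rfl⟩
    exact this
  choose f hf hf' using h1
  -- The relabelling that matches the common facet and pairs the two opposite vertices. It comes
  -- from the connectivity alone, so its sign serves for all vertex positions.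
  let π : Fin (d + 1) → Fin (d + 1) := fun l => if hl : l = j then j' else f l hl
  have hπj : π j = j' := by simp [π]
  have hπ : ∀ l (hl : l ≠ j), π l = f l hl := fun l hl => by simp [π, hl]
  have hπinj : Function.Injective π := by
    intro a b hab
    by_cases ha : a = j <;> by_cases hb : b = j
    · rw [ha, hb]
    · rw [ha, hπj, hπ b hb] at hab
      exact absurd hab.symm (hf b hb)
    · rw [hb, hπj, hπ a ha] at hab
      exact absurd hab (hf a ha)
    · rw [hπ a ha, hπ b hb] at hab
      have := hf' a ha
      rw [hab, hf' b hb] at this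
      exact (hinj k this).symm
  let e : Equiv.Perm (Fin (d + 1)) := Equiv.ofBijective π (Finite.injective_iff_bijective.1 hπinj)
  refine ⟨((Equiv.Perm.sign e : ℤ) : ℝ), ?_, fun x u => ?_⟩
  · rcases Int.units_eq_one_or (Equiv.Perm.sign e) with h | h <;> simp [h]
  rw [facetForm_eq_det, facetForm_eq_det, ← Matrix.det_permute]
  congr 1
  ext l i
  by_cases hl : l = j
  · subst hl
    simp [e, hπj]
  · have h2 : π l ≠ j' := by rw [hπ l hl]; exact hf l hl
    have h3 : conn k' (π l) = conn k l := by rw [hπ l hl]; exact hf' l hl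
    simp [Matrix.updateRow_apply, hl, e, h2, elem, h3]

/-- The centroid of the facet opposite to the `j`-th vertex. -/
def facetCentroid {d : ℕ} (v : Fin (d + 1) → Pt d) (j : Fin (d + 1)) : Pt d :=
  (d : ℝ)⁻¹ • ∑ l ∈ Finset.univ.erase j, v l

lemma hom_facetCentroid {d : ℕ} (hd : 1 ≤ d) (v : Fin (d + 1) → Pt d) (j : Fin (d + 1)) :
    hom (facetCentroid v j) = (d : ℝ)⁻¹ • ∑ l ∈ Finset.univ.erase j, hom (v l) := by
  have : (d : ℝ) ≠ 0 := by positivity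
  ext i
  refine Fin.cases ?_ (fun i => ?_) i
  · simp [this]
  · simp [facetCentroid]

lemma facetForm_facetCentroid_self {d : ℕ} (hd : 1 ≤ d) (v : Fin (d + 1) → Pt d)
    (j : Fin (d + 1)) : facetForm v (hom (facetCentroid v j)) j = 0 := by
  rw [hom_facetCentroid hd, facetForm_smul, facetForm_sum, Finset.sum_eq_zero, mul_zero]
  exact fun l hl => facetForm_of_ne v (Finset.ne_of_mem_erase hl)

lemma facetForm_facetCentroid {d : ℕ} (hd : 1 ≤ d) (v : Fin (d + 1) → Pt d)
    {i j : Fin (d + 1)} (h : i ≠ j) :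
    facetForm v (hom (facetCentroid v j)) i = (d : ℝ)⁻¹ * (hmat v).det := by
  rw [hom_facetCentroid hd, facetForm_smul, facetForm_sum, Finset.sum_eq_single i,
    facetForm_self]
  · exact fun l _ hl => facetForm_of_ne v hl
  · intro hi
    exact absurd (Finset.mem_erase.2 ⟨h, Finset.mem_univ i⟩) hi

lemma hom_lineMap {d : ℕ} (y z : Pt d) (δ : ℝ) :
    hom (y + δ • (z - y)) = hom y + δ • (hom z - hom y) := by
  ext i
  refine Fin.cases ?_ (fun i => ?_) i <;> simp

lemma facetForm_lineMap {d : ℕ} (v : Fin (d + 1) → Pt d) (y z : Pt d) (δ : ℝ)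
    (j : Fin (d + 1)) :
    facetForm v (hom (y + δ • (z - y))) j =
      facetForm v (hom y) j + δ * (facetForm v (hom z) j - facetForm v (hom y) j) := by
  rw [hom_lineMap, facetForm_add, facetForm_smul]
  congr 2
  simp [facetForm]

/-- Points on the segment from the centroid of a facet to a point on the inner side of that facet
start out in the interior of the simplex. -/
lemma eventually_mem_interior_simplex {d : ℕ} (hd : 1 ≤ d) {v : Fin (d + 1) → Pt d}
    (h : AffineIndependent ℝ v) (j : Fin (d + 1)) (z : Pt d)
    (hz : 0 < (hmat v).det * facetForm v (hom z) j) :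
    ∀ᶠ δ in nhdsWithin (0 : ℝ) (Set.Ioi 0),
      facetCentroid v j + δ • (z - facetCentroid v j) ∈ interior (simplex v) := by
  have hdet := (affineIndependent_iff_det_hmat v).1 h
  simp only [mem_interior_simplex h, Filter.eventually_all]
  -- The functional of the facet itself vanishes at the centroid and grows towards `z`; the others
  -- are positive at the centroid and stay so by continuity.
  intro i
  by_cases hi : i = j
  · subst hi
    filter_upwards [self_mem_nhdsWithin] with δ hδ
    rw [facetForm_lineMap, facetForm_facetCentroid_self hd]
    have : 0 < δ * ((hmat v).det * facetForm v (hom z) i) := mul_pos hδ hz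
    linarith
  · have hc : ContinuousAt (fun δ : ℝ => (hmat v).det *
        facetForm v (hom (facetCentroid v j + δ • (z - facetCentroid v j))) i) 0 := by
      simp only [facetForm_lineMap]
      fun_prop
    refine (hc.eventually (lt_mem_nhds ?_)).filter_mono nhdsWithin_le_nhds
    simp only [zero_smul, add_zero]
    rw [facetForm_facetCentroid hd v hi]
    have := mul_self_pos.2 hdet
    have hd' : (0 : ℝ) < (d : ℝ)⁻¹ := by positivity
    nlinarith

lemma facetCentroid_elem_eq {d N Nv : ℕ} {conn : Connectivity d N Nv}
    (hinj : ∀ k, Function.Injective (conn k)) {k k' : Fin N} {j j' : Fin (d + 1)}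
    (h : facet conn k' j' = facet conn k j) (x : Config d Nv) :
    facetCentroid (elem conn x k') j' = facetCentroid (elem conn x k) j := by
  classical
  simp only [facetCentroid, elem]
  rw [sum_erase_eq_sum_facet (hinj k'), sum_erase_eq_sum_facet (hinj k)]
  simp only [h]

/-- Elements of a nonsingular mesh with a common facet lie on opposite sides of it. -/
lemma IsNonsingularMesh.sign_mul_facetForm_add {d N Nv : ℕ} (hd : 1 ≤ d) {Ω : Set (Pt d)}
    {conn : Connectivity d N Nv} {x : Config d Nv} (hx : IsNonsingularMesh Ω conn x)
    {k k' : Fin N} {j j' : Fin (d + 1)} (hk : k' ≠ k) (h : facet conn k' j' = facet conn k j)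
    (y : Config d Nv) (u : Fin (d + 1) → ℝ) :
    SignType.sign (hmat (elem conn x k)).det * facetForm (elem conn y k) u j +
      SignType.sign (hmat (elem conn x k')).det * facetForm (elem conn y k') u j' = 0 := by
  have hinj := hx.nondegenerate.injective
  obtain ⟨ε, hε1, hε⟩ := exists_facetForm_eq hinj h
  have hD := (affineIndependent_iff_det_hmat _).1 (hx.nondegenerate k)
  have hD' := (affineIndependent_iff_det_hmat _).1 (hx.nondegenerate k')
  have h1 := hε x (hom (elem conn x k j))
  rw [facetForm_self] at h1
  -- If the `j`-th vertex of element `k` were on the inner side of the facet for `k'`, points just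
  -- off the common centroid towards it would be interior to both elements.
  have hneg : (hmat (elem conn x k')).det * facetForm (elem conn x k') (hom (elem conn x k j)) j' <
      0 := by
    by_contra! hge
    have hne : facetForm (elem conn x k') (hom (elem conn x k j)) j' ≠ 0 := by
      intro h0
      rw [h0, mul_zero] at h1
      exact hD h1
    have hpos := lt_of_le_of_ne hge (mul_ne_zero hD' hne).symm
    have e1 := eventually_mem_interior_simplex hd (hx.nondegenerate k') j' _ hpos
    have e2 := eventually_mem_interior_simplex hd (hx.nondegenerate k) j (elem conn x k j)
      (by rw [facetForm_self]; exact mul_self_pos.2 hD)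
    rw [facetCentroid_elem_eq hinj h] at e1
    obtain ⟨δ, hδ1, hδ2⟩ := (e1.and e2).exists
    exact Set.disjoint_left.1 (hx.disjoint k' k hk) hδ1 hδ2
  -- The sign found at `x` determines `ε`, and with it the identity at every other configuration
  -- `y`.
  rw [hε y u]
  generalize facetForm (elem conn y k') u j' = F
  generalize facetForm (elem conn x k') (hom (elem conn x k j)) j' = X at h1 hneg
  rw [h1]
  rcases mul_neg_iff.1 hneg with ⟨ha, hb⟩ | ⟨ha, hb⟩ <;> rcases hε1 with rfl | rfl <;>
    simp [sign_pos, sign_neg, ha, hb]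

/-- The connectivity is not assumed to limit a facet to two elements, so cancellation is needed for
any number `n ≠ 1` of them. Summing `a i + a j` over ordered pairs of distinct indices gives `2 (n -
1)` times the sum of `a`. -/
lemma sum_eq_zero_of_pairwise_add {ι : Type*} (s : Finset ι) (a : ι → ℝ)
    (hcard : s.card = 1 → ∀ i ∈ s, a i = 0)
    (hpair : ∀ i ∈ s, ∀ j ∈ s, i ≠ j → a i + a j = 0) : ∑ i ∈ s, a i = 0 := by
  classical
  by_cases h1 : s.card = 1
  · exact Finset.sum_eq_zero (hcard h1)
  rcases s.eq_empty_or_nonempty with rfl | hne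
  · simp
  have h2 : ∑ i ∈ s, ∑ j ∈ s.erase i, (a i + a j) = 0 := by
    refine Finset.sum_eq_zero fun i hi => Finset.sum_eq_zero fun j hj => ?_
    exact hpair i hi j (Finset.mem_of_mem_erase hj) (Finset.ne_of_mem_erase hj).symm
  have h3 : ∀ i ∈ s, ∑ j ∈ s.erase i, (a i + a j) = ((s.card : ℝ) - 2) * a i + ∑ j ∈ s, a j := by
    intro i hi
    rw [Finset.sum_add_distrib, Finset.sum_const, ← Finset.add_sum_erase s a hi,
      Finset.card_erase_of_mem hi, nsmul_eq_mul, Nat.cast_sub hne.card_pos]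
    push_cast
    ring
  rw [Finset.sum_congr rfl h3, Finset.sum_add_distrib, ← Finset.mul_sum, Finset.sum_const,
    nsmul_eq_mul] at h2
  have h4 : (s.card : ℝ) ≠ 1 := by exact_mod_cast h1
  have h5 : (2 * ((s.card : ℝ) - 1)) * ∑ i ∈ s, a i = 0 := by linarith
  exact (mul_eq_zero.1 h5).resolve_left (mul_ne_zero two_ne_zero (sub_ne_zero.2 h4))

/-- The total signed volume is stationary if contributions of shared facets cancel and boundary
facets move within their hyperplanes. -/
lemma sum_volume_rate_eq_zero {d N Nv : ℕ} {conn : Connectivity d N Nv}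
    (hinj : ∀ k, Function.Injective (conn k)) (s : Fin N → ℝ) (y y' : Config d Nv)
    (hshared : ∀ k k' j j', k' ≠ k → facet conn k' j' = facet conn k j → ∀ u,
      s k * facetForm (elem conn y k) u j + s k' * facetForm (elem conn y k') u j' = 0)
    (hbdry : ∀ k j, IsBoundaryFacet conn k j → ∀ i ∈ facet conn k j,
      facetForm (elem conn y k) (homDir (y' i)) j = 0) :
    ∑ k, s k * ∑ j, facetForm (elem conn y k) (homDir (elem conn y' k j)) j = 0 := by
  classical
  simp only [sum_facetForm_homDir, elem, mul_neg, Finset.sum_neg_distrib, neg_eq_zero]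
  have h1 : ∀ k j, ∑ l ∈ Finset.univ.erase j, homDir (y' (conn k l)) =
      ∑ i ∈ (facet conn k j).toFinset, homDir (y' i) := fun k j =>
    sum_erase_eq_sum_facet (hinj k) j fun i => homDir (y' i)
  simp only [h1, Finset.mul_sum]
  rw [← Fintype.sum_prod_type' (f := fun k j => s k * facetForm (elem conn y k)
    (∑ i ∈ (facet conn k j).toFinset, homDir (y' i)) j)]
  -- Element-facet pairs are grouped by the vertex set of the facet; a group with a single member is
  -- a boundary facet.
  rw [← Finset.sum_fiberwise Finset.univ (fun q : Fin N × Fin (d + 1) => facet conn q.1 q.2)]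
  refine Finset.sum_eq_zero fun S _ => sum_eq_zero_of_pairwise_add _ _ ?_ ?_
  · rintro hcard ⟨k, j⟩ hkj
    obtain ⟨q, hq⟩ := Finset.card_eq_one.1 hcard
    have hb : IsBoundaryFacet conn k j := by
      intro k' j' hk' hf
      have h2 := Finset.mem_singleton.1 (hq ▸ hkj)
      have h3 : (k', j') ∈ Finset.univ.filter
          (fun q : Fin N × Fin (d + 1) => facet conn q.1 q.2 = S) := by
        simp only [Finset.mem_filter, Finset.mem_univ, true_and] at hkj ⊢
        rw [hf, hkj]
      have h4 := Finset.mem_singleton.1 (hq ▸ h3)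
      exact hk' (congrArg Prod.fst (h4.trans h2.symm))
    simp only [facetForm_sum]
    rw [Finset.sum_eq_zero, mul_zero]
    exact fun i hi => hbdry k j hb i (Set.mem_toFinset.1 hi)
  · rintro ⟨k, j⟩ hkj ⟨k', j'⟩ hkj' hne
    simp only [Finset.mem_filter, Finset.mem_univ, true_and] at hkj hkj'
    have hk : k' ≠ k := by
      rintro rfl
      exact hne (by rw [facet_injective (hinj k') (hkj.trans hkj'.symm)])
    simp only [hkj, hkj']
    exact hshared k k' j j' hk (hkj'.trans hkj.symm) _

/-- A nonzero `c` annihilates every row of the matrix with `u` in place of the `j`-th vertex, so its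
determinant is zero. Here `c` is an equation of the hyperplane of the facet. -/
lemma facetForm_eq_zero_of_covector {d : ℕ} {v : Fin (d + 1) → Pt d} {j : Fin (d + 1)}
    {u c : Fin (d + 1) → ℝ} (hc : c ≠ 0) (hv : ∀ l, l ≠ j → hom (v l) ⬝ᵥ c = 0)
    (hu : u ⬝ᵥ c = 0) : facetForm v u j = 0 := by
  rw [facetForm_eq_det, ← Matrix.exists_mulVec_eq_zero_iff]
  refine ⟨c, hc, funext fun l => ?_⟩
  by_cases hl : l = j
  · subst hl
    simpa [Matrix.mulVec] using hu
  · simpa [Matrix.mulVec, Matrix.updateRow_ne hl] using hv l hl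

/-- A moving mesh whose boundary facets stay in fixed hyperplanes keeps its total signed
volume. -/
theorem total_signed_volume_const {d N Nv : ℕ} {conn : Connectivity d N Nv}
    (hinj : ∀ k, Function.Injective (conn k)) (s : Fin N → ℝ) {t : ℝ} (ht : 0 ≤ t)
    {w w' : ℝ → Config d Nv}
    (hw : ∀ r ∈ Set.Icc 0 t, ∀ i,
      HasDerivWithinAt (fun q => w q i) (w' r i) (Set.Icc 0 t) r)
    (hshared : ∀ k k' j j', k' ≠ k → facet conn k' j' = facet conn k j → ∀ y u,
      s k * facetForm (elem conn y k) u j + s k' * facetForm (elem conn y k') u j' = 0)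
    (hbdry : ∀ k j, IsBoundaryFacet conn k j → ∃ c : Fin (d + 1) → ℝ, c ≠ 0 ∧
      ∀ r ∈ Set.Icc 0 t, ∀ i ∈ facet conn k j, hom (w r i) ⬝ᵥ c = 0) :
    ∑ k, s k * (hmat (elem conn (w t) k)).det = ∑ k, s k * (hmat (elem conn (w 0) k)).det := by
  rcases ht.eq_or_lt with rfl | ht'
  · rfl
  have hder : ∀ r ∈ Set.Icc 0 t, HasDerivWithinAt
      (fun q => ∑ k, s k * (hmat (elem conn (w q) k)).det) 0 (Set.Icc 0 t) r := by
    intro r hr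
    have h1 : HasDerivWithinAt (fun q => ∑ k, s k * (hmat (elem conn (w q) k)).det)
        (∑ k, s k * ∑ j, facetForm (elem conn (w r) k) (homDir (elem conn (w' r) k j)) j)
        (Set.Icc 0 t) r := by
      refine HasDerivWithinAt.fun_sum fun k _ => HasDerivWithinAt.const_mul _ ?_
      exact hasDerivWithinAt_det_hmat fun j => hw r hr (conn k j)
    rwa [sum_volume_rate_eq_zero hinj s (w r) (w' r)
      (fun k k' j j' hk hf u => hshared k k' j j' hk hf _ u)] at h1
    intro k j hkj i hi
    obtain ⟨c, hc, hcw⟩ := hbdry k j hkj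
    refine facetForm_eq_zero_of_covector hc (fun l hl => hcw r hr _ ⟨l, hl, rfl⟩) ?_
    -- Differentiating the equation of the fixed hyperplane shows that the velocity is tangent to
    -- it.
    have h2 : HasDerivWithinAt (fun q => hom (w q i) ⬝ᵥ c) (homDir (w' r i) ⬝ᵥ c)
        (Set.Icc 0 t) r := by
      have h3 := hasDerivWithinAt_pi.1 (hasDerivWithinAt_hom (hw r hr i))
      exact HasDerivWithinAt.fun_sum fun l _ => (h3 l).mul_const (c l)
    have h4 : HasDerivWithinAt (fun q => hom (w q i) ⬝ᵥ c) 0 (Set.Icc 0 t) r :=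
      (hasDerivWithinAt_const r _ (0 : ℝ)).congr (fun q hq => hcw q hq i hi) (hcw r hr i hi)
    exact (uniqueDiffOn_Icc ht' r hr).eq_deriv _ h2 h4
  exact constant_of_derivWithin_zero (fun r hr => (hder r hr).differentiableWithinAt)
    (fun r hr => (hder r ⟨hr.1, hr.2.le⟩).derivWithin
      (uniqueDiffOn_Icc ht' r ⟨hr.1, hr.2.le⟩)) t ⟨ht, le_rfl⟩

/-! ### Projective maps -/

/-- The denominator `1 - ⟨ω, y⟩` of a projective map. -/
def den {d : ℕ} (ω y : Pt d) : ℝ := 1 - inner ℝ ω y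

/-- The projective map `y ↦ y / (1 - ⟨ω, y⟩)`. -/
def projMap {d : ℕ} (ω y : Pt d) : Pt d := (den ω y)⁻¹ • y

lemma inner_eq_sum {d : ℕ} (ω y : Pt d) : inner ℝ ω y = ∑ i, ω i * y i := by
  simp [PiLp.inner_apply, mul_comm]

/-- This makes `projMap (-ω)` the inverse of `projMap ω`. -/
lemma den_neg_projMap {d : ℕ} {ω y : Pt d} (h : den ω y ≠ 0) :
    den (-ω) (projMap ω y) = (den ω y)⁻¹ := by
  have h1 : inner ℝ ω y = 1 - den ω y := by simp [den]
  rw [den, projMap, inner_neg_left, inner_smul_right, h1]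
  field_simp
  ring

lemma projMap_neg_projMap {d : ℕ} {ω y : Pt d} (h : den ω y ≠ 0) :
    projMap (-ω) (projMap ω y) = y := by
  rw [projMap, den_neg_projMap h, inv_inv, projMap, smul_smul, mul_inv_cancel₀ h, one_smul]

/-- A projective map is linear in homogeneous coordinates up to a scalar; the matrix is
unitriangular, hence of determinant one. -/
lemma hom_projMap {d : ℕ} {ω y : Pt d} (h : den ω y ≠ 0) :
    hom (projMap ω y) = (den ω y)⁻¹ • Matrix.vecMul (hom y)
      (Matrix.of (Fin.cons (Fin.cons 1 0) fun i => Fin.cons (-ω i) (Pi.single i 1))) := by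
  ext l
  refine Fin.cases ?_ (fun l => ?_) l
  · have h1 : den ω y = 1 + ∑ i, y i * -ω i := by
      rw [den, inner_eq_sum, sub_eq_add_neg, ← Finset.sum_neg_distrib]
      congr 1
      exact Finset.sum_congr rfl fun i _ => by ring
    simp only [hom_zero, Pi.smul_apply, Matrix.vecMul, dotProduct, Fin.sum_univ_succ,
      Matrix.of_apply, Fin.cons_zero, Fin.cons_succ, hom_succ, one_mul, smul_eq_mul, ← h1]
    exact (inv_mul_cancel₀ h).symm
  · simp [Matrix.vecMul, dotProduct, Fin.sum_univ_succ, projMap, Pi.single_apply]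

lemma det_hmat_projMap {d : ℕ} {ω : Pt d} {v : Fin (d + 1) → Pt d}
    (h : ∀ j, den ω (v j) ≠ 0) :
    (hmat fun j => projMap ω (v j)).det = (∏ j, (den ω (v j))⁻¹) * (hmat v).det := by
  set C : Matrix (Fin (d + 1)) (Fin (d + 1)) ℝ :=
    Matrix.of (Fin.cons (Fin.cons 1 0) fun i => Fin.cons (-ω i) (Pi.single i 1)) with hC
  have h1 : (hmat fun j => projMap ω (v j)) =
      Matrix.diagonal (fun j => (den ω (v j))⁻¹) * (hmat v * C) := by
    ext j l
    rw [Matrix.diagonal_mul, hmat_apply, hom_projMap (h j)]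
    rfl
  have h2 : C.det = 1 := by
    rw [Matrix.det_succ_row_zero, Fin.sum_univ_succ]
    simp only [hC, Matrix.of_apply, Fin.cons_zero, Fin.cons_succ, Pi.zero_apply, mul_zero,
      zero_mul, Finset.sum_const_zero, add_zero, Fin.val_zero, pow_zero, one_mul]
    convert Matrix.det_one (n := Fin d) (R := ℝ) using 2
    ext i l
    simp [Matrix.one_apply, Pi.single_apply, eq_comm]
  rw [h1, Matrix.det_mul, Matrix.det_mul, Matrix.det_diagonal, h2, mul_one]

lemma mem_simplex_iff {d : ℕ} (v : Fin (d + 1) → Pt d) (y : Pt d) :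
    y ∈ simplex v ↔ ∃ c : Fin (d + 1) → ℝ, (∀ j, 0 ≤ c j) ∧ ∑ j, c j = 1 ∧ ∑ j, c j • v j = y := by
  constructor
  · intro hy
    rw [simplex, convexHull_range_eq_exists_affineCombination] at hy
    obtain ⟨s, w, hw0, hw1, rfl⟩ := hy
    refine ⟨fun i => if i ∈ s then w i else 0, fun i => ?_, by simp [hw1], ?_⟩
    · by_cases h : i ∈ s <;> simp [h, hw0]
    · rw [Finset.affineCombination_eq_linear_combination _ _ _ hw1]
      simp [ite_smul]
  · rintro ⟨c, h0, h1, rfl⟩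
    exact (convex_convexHull ℝ _).sum_mem (fun j _ => h0 j) h1
      fun j _ => subset_convexHull ℝ _ ⟨j, rfl⟩

lemma den_sum {d : ℕ} {ι : Type*} (s : Finset ι) (ω : Pt d) (c : ι → ℝ) (v : ι → Pt d)
    (hc : ∑ j ∈ s, c j = 1) : den ω (∑ j ∈ s, c j • v j) = ∑ j ∈ s, c j * den ω (v j) := by
  simp only [den, mul_sub, mul_one, Finset.sum_sub_distrib, hc, inner_sum, inner_smul_right]

lemma den_pos_of_mem_simplex {d : ℕ} {ω : Pt d} {v : Fin (d + 1) → Pt d}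
    (h : ∀ j, 0 < den ω (v j)) {y : Pt d} (hy : y ∈ simplex v) : 0 < den ω y := by
  obtain ⟨c, h0, h1, rfl⟩ := (mem_simplex_iff v y).1 hy
  rw [den_sum _ _ _ _ h1]
  obtain ⟨j, _, hj⟩ : ∃ j ∈ Finset.univ, c j ≠ 0 := by
    refine Finset.exists_ne_zero_of_sum_ne_zero ?_
    rw [h1]
    exact one_ne_zero
  exact Finset.sum_pos' (fun j _ => mul_nonneg (h0 j) (h j).le)
    ⟨j, Finset.mem_univ j, mul_pos (lt_of_le_of_ne (h0 j) hj.symm) (h j)⟩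

/-- The convex weights are multiplied by the denominators at the vertices and renormalized by the
denominator at `y`. -/
lemma projMap_mem_simplex {d : ℕ} {ω : Pt d} {v : Fin (d + 1) → Pt d}
    (h : ∀ j, 0 < den ω (v j)) {y : Pt d} (hy : y ∈ simplex v) :
    projMap ω y ∈ simplex fun j => projMap ω (v j) := by
  have hpos := den_pos_of_mem_simplex h hy
  obtain ⟨c, h0, h1, hcy⟩ := (mem_simplex_iff v y).1 hy
  have hden : den ω y = ∑ j, c j * den ω (v j) := by rw [← hcy, den_sum _ _ _ _ h1]
  refine (mem_simplex_iff _ _).2 ⟨fun j => (den ω y)⁻¹ * (c j * den ω (v j)), fun j => ?_, ?_, ?_⟩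
  · exact mul_nonneg (inv_nonneg.2 hpos.le) (mul_nonneg (h0 j) (h j).le)
  · rw [← Finset.mul_sum, ← hden, inv_mul_cancel₀ hpos.ne']
  · rw [projMap, ← hcy, Finset.smul_sum, hcy]
    refine Finset.sum_congr rfl fun j _ => ?_
    rw [projMap, smul_smul, smul_smul, mul_assoc, mul_assoc, mul_inv_cancel₀ (h j).ne', mul_one]

lemma image_projMap_simplex {d : ℕ} {ω : Pt d} {v : Fin (d + 1) → Pt d}
    (h : ∀ j, 0 < den ω (v j)) :
    projMap ω '' simplex v = simplex fun j => projMap ω (v j) := by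
  apply Set.Subset.antisymm
  · rintro _ ⟨y, hy, rfl⟩
    exact projMap_mem_simplex h hy
  · intro z hz
    have h' : ∀ j, 0 < den (-ω) (projMap ω (v j)) := fun j => by
      rw [den_neg_projMap (h j).ne']
      exact inv_pos.2 (h j)
    have hz' := den_pos_of_mem_simplex h' hz
    refine ⟨projMap (-ω) z, ?_, ?_⟩
    · have := projMap_mem_simplex h' hz
      simpa only [projMap_neg_projMap (h _).ne'] using this
    · simpa using projMap_neg_projMap hz'.ne'

/-- The derivative of a projective map. -/
def projMapDeriv {d : ℕ} (ω y : Pt d) : Pt d →L[ℝ] Pt d :=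
  (den ω y)⁻¹ • (ContinuousLinearMap.id ℝ (Pt d) +
    ((den ω y)⁻¹ • innerSL ℝ ω).smulRight y)

lemma hasFDerivAt_projMap {d : ℕ} {ω y : Pt d} (h : den ω y ≠ 0) :
    HasFDerivAt (projMap ω) (projMapDeriv ω y) y := by
  have h1 : HasFDerivAt (den ω) (-innerSL ℝ ω) y := by
    exact ((innerSL ℝ ω).hasFDerivAt (x := y)).const_sub 1
  have h2 := (hasDerivAt_inv h).comp_hasFDerivAt y h1
  refine (h2.smul (hasFDerivAt_id y)).congr_fderiv ?_
  ext u : 1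
  simp only [projMapDeriv, add_apply, smul_apply,
    ContinuousLinearMap.smulRight_apply, ContinuousLinearMap.id_apply, neg_apply, smul_add,
    smul_smul, smul_eq_mul, Function.comp_apply, id_eq]
  congr 2
  field_simp

/-- The derivative is `den⁻¹` times a transvection of determinant `1 + (1 - den) / den = den⁻¹`. -/
lemma det_projMapDeriv {d : ℕ} {ω y : Pt d} (h : den ω y ≠ 0) :
    (projMapDeriv ω y).det = ((den ω y) ^ (d + 1))⁻¹ := by
  have h1 : ((projMapDeriv ω y : Pt d →L[ℝ] Pt d) : Pt d →ₗ[ℝ] Pt d) = (den ω y)⁻¹ •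
      LinearMap.transvection ((den ω y)⁻¹ • (innerSL ℝ ω : Pt d →L[ℝ] ℝ).toLinearMap) y := by
    ext u : 1
    simp [projMapDeriv, LinearMap.transvection.apply]
  have h2 : (innerSL ℝ ω) y = 1 - den ω y := by simp [den]
  rw [ContinuousLinearMap.det, h1, LinearMap.det_smul, LinearMap.transvection.det]
  simp only [finrank_euclideanSpace, Fintype.card_fin, LinearMap.smul_apply,
    ContinuousLinearMap.coe_coe, h2, smul_eq_mul]
  rw [pow_succ, mul_inv, inv_pow]
  congr 1
  field_simp
  ring

lemma injOn_projMap {d : ℕ} (ω : Pt d) {s : Set (Pt d)} (h : ∀ y ∈ s, den ω y ≠ 0) :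
    Set.InjOn (projMap ω) s := fun y hy z hz hyz => by
  rw [← projMap_neg_projMap (h y hy), hyz, projMap_neg_projMap (h z hz)]

lemma isCompact_simplex {d : ℕ} (v : Fin (d + 1) → Pt d) : IsCompact (simplex v) :=
  (Set.finite_range v).isCompact_convexHull ℝ

/-- Change of variables. It turns the integral of a test function into a simplex volume, to which
conservation of signed volume applies. -/
lemma setIntegral_simplex_den {d : ℕ} {ω : Pt d} {v : Fin (d + 1) → Pt d}
    (h : ∀ j, 0 < den ω (v j)) :
    ∫ y in simplex v, ((den ω y) ^ (d + 1))⁻¹ = simplexVolume fun j => projMap ω (v j) := by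
  have hpos : ∀ y ∈ simplex v, 0 < den ω y := fun y hy => den_pos_of_mem_simplex h hy
  have h1 := integral_image_eq_integral_abs_det_fderiv_smul volume
    (isCompact_simplex v).isClosed.measurableSet
    (fun y hy => (hasFDerivAt_projMap (hpos y hy).ne').hasFDerivWithinAt)
    (injOn_projMap ω fun y hy => (hpos y hy).ne') fun _ => (1 : ℝ)
  rw [image_projMap_simplex h] at h1
  rw [simplexVolume, ← setIntegral_one_eq_measureReal, h1]
  refine setIntegral_congr_fun (isCompact_simplex v).isClosed.measurableSet fun y hy => ?_
  have := hpos y hy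
  simp only [det_projMapDeriv this.ne', smul_eq_mul, mul_one]
  rw [abs_of_pos (by positivity)]

/-! ### Moving meshes whose boundary vertices slide along the boundary -/

/-- The `j`-th column of the inverse of `hmat v` is an equation of the hyperplane through the other
vertices. -/
lemma exists_facet_covector {d : ℕ} {v : Fin (d + 1) → Pt d} (h : AffineIndependent ℝ v)
    (j : Fin (d + 1)) :
    ∃ c : Fin (d + 1) → ℝ, c ≠ 0 ∧ ∀ l, l ≠ j → hom (v l) ⬝ᵥ c = 0 := by
  have hdet := (affineIndependent_iff_det_hmat v).1 h
  have h1 : (hmat v).mulVec ((hmat v)⁻¹.mulVec (Pi.single j 1)) = Pi.single j 1 := by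
    rw [Matrix.mulVec_mulVec, Matrix.mul_nonsing_inv _ (isUnit_iff_ne_zero.2 hdet),
      Matrix.one_mulVec]
  refine ⟨(hmat v)⁻¹.mulVec (Pi.single j 1), fun h0 => ?_, fun l hl => ?_⟩
  · rw [h0, Matrix.mulVec_zero] at h1
    simpa using congrFun h1 j
  · have := congrFun h1 l
    simpa [Matrix.mulVec, Pi.single_apply, hl] using this

lemma homDir_dotProduct_eq_zero {d : ℕ} {s : Set (Pt d)} {c : Fin (d + 1) → ℝ}
    (h : ∀ y ∈ s, hom y ⬝ᵥ c = 0) {u : Pt d} (hu : u ∈ vectorSpan ℝ s) : homDir u ⬝ᵥ c = 0 := by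
  rw [vectorSpan] at hu
  induction hu using Submodule.span_induction with
  | mem u hu =>
    obtain ⟨y, hy, z, hz, rfl⟩ := hu
    have : homDir (y -ᵥ z) = hom y - hom z := by
      ext i
      refine Fin.cases ?_ (fun i => ?_) i <;> simp
    simp only [this, sub_dotProduct, h y hy, h z hz, sub_zero]
  | zero =>
    have : homDir (0 : Pt d) = 0 := by
      ext i
      refine Fin.cases ?_ (fun i => ?_) i <;> simp
    rw [this, zero_dotProduct]
  | add a b _ _ ha hb =>
    have : homDir (a + b) = homDir a + homDir b := by
      ext i
      refine Fin.cases ?_ (fun i => ?_) i <;> simp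
    rw [this, add_dotProduct, ha, hb, add_zero]
  | smul r a _ ha =>
    have : homDir (r • a) = r • homDir a := by
      ext i
      refine Fin.cases ?_ (fun i => ?_) i <;> simp
    rw [this, smul_dotProduct, ha, smul_zero]

/-- A covector for a hyperplane is carried by a projective map to a covector for its image. -/
lemma exists_projMap_covector {d : ℕ} (ω : Pt d) {c : Fin (d + 1) → ℝ} (hc : c ≠ 0) :
    ∃ c' : Fin (d + 1) → ℝ, c' ≠ 0 ∧
      ∀ y, den ω y ≠ 0 → hom y ⬝ᵥ c = 0 → hom (projMap ω y) ⬝ᵥ c' = 0 := by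
  -- The image of `c` under the inverse of the unitriangular matrix in `hom_projMap`.
  refine ⟨Fin.cons (c 0) fun i => c i.succ + ω i * c 0, fun h => hc ?_, fun y hy hyc => ?_⟩
  · have h0 : c 0 = 0 := by simpa using congrFun h 0
    ext i
    refine Fin.cases h0 (fun i => ?_) i
    simpa [h0] using congrFun h i.succ
  · simp only [dotProduct, Fin.sum_univ_succ, hom_zero, hom_succ, one_mul, Fin.cons_zero,
      Fin.cons_succ] at hyc ⊢
    have h1 : ∑ i, (projMap ω y) i * (c i.succ + ω i * c 0) =
        (den ω y)⁻¹ * (∑ i, y i * c i.succ + (∑ i, ω i * y i) * c 0) := by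
      rw [Finset.sum_mul, ← Finset.sum_add_distrib, Finset.mul_sum]
      refine Finset.sum_congr rfl fun i _ => ?_
      simp only [projMap, PiLp.smul_apply, smul_eq_mul]
      ring
    have h2 : den ω y = 1 - ∑ i, ω i * y i := by rw [den, inner_eq_sum]
    have h3 : ∑ i, ω i * y i = 1 - den ω y := by linarith
    rw [h1, h3, show ∑ i, y i * c i.succ = -c 0 by linarith]
    field_simp
    ring

lemma continuous_det_hmat_elem {d N Nv : ℕ} (conn : Connectivity d N Nv) (k : Fin N) :
    Continuous fun y : Config d Nv => (hmat (elem conn y k)).det := by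
  refine Continuous.matrix_det (continuous_matrix fun j i => ?_)
  refine Fin.cases ?_ (fun i => ?_) i
  · simp only [hmat_apply, hom_zero]
    exact continuous_const
  · simp only [hmat_apply, hom_succ, elem]
    fun_prop

/-- The determinant is continuous in time and never zero on an interval, so the orientations of the
initial mesh persist. -/
lemma sign_det_const {d N Nv : ℕ} {conn : Connectivity d N Nv} {t : ℝ} {x : ℝ → Config d Nv}
    (hx : ContinuousOn x (Set.Icc 0 t)) (hnd : ∀ r ∈ Set.Icc 0 t, Nondegenerate conn (x r))
    (k : Fin N) {r : ℝ} (hr : r ∈ Set.Icc 0 t) :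
    SignType.sign (hmat (elem conn (x r) k)).det = SignType.sign (hmat (elem conn (x 0) k)).det := by
  have hc : ContinuousOn (fun q => (hmat (elem conn (x q) k)).det) (Set.Icc 0 t) :=
    (continuous_det_hmat_elem conn k).comp_continuousOn hx
  refine isPreconnected_Icc.constant (f := fun q => SignType.sign (hmat (elem conn (x q) k)).det)
    ?_ hr ⟨le_rfl, hr.1.trans hr.2⟩
  intro q hq
  exact ContinuousAt.comp_continuousWithinAt (f := fun q => (hmat (elem conn (x q) k)).det)
    (continuousAt_sign_of_ne_zero ((affineIndependent_iff_det_hmat _).1 (hnd q hq k))) (hc q hq)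

lemma hasDerivWithinAt_projMap {d : ℕ} {ω : Pt d} {y : ℝ → Pt d} {y' : Pt d} {S : Set ℝ} {r : ℝ}
    (h : HasDerivWithinAt y y' S r) (hden : den ω (y r) ≠ 0) :
    HasDerivWithinAt (fun q => projMap ω (y q)) (projMapDeriv ω (y r) y') S r :=
  (hasFDerivAt_projMap hden).comp_hasDerivWithinAt r h

/-- Each integral is a projected volume, and equals a determinant times its initial sign over `d!`,
since neither the motion nor the projection (positive denominators) changes orientations. The
projected boundary vertices stay in the projected hyperplanes, so `total_signed_volume_const`
applies. -/
theorem sum_integral_den_const {d N Nv : ℕ} (hd : 1 ≤ d) {Ω : Set (Pt d)}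
    {conn : Connectivity d N Nv} {t : ℝ} (ht : 0 ≤ t) {x x' : ℝ → Config d Nv}
    (h₀ : IsNonsingularMesh Ω conn (x 0))
    (hx : ∀ r ∈ Set.Icc 0 t, ∀ i,
      HasDerivWithinAt (fun q => x q i) (x' r i) (Set.Icc 0 t) r)
    (hnd : ∀ r ∈ Set.Icc 0 t, Nondegenerate conn (x r))
    (hslide : ∀ r ∈ Set.Icc 0 t, ∀ i, x r i - x 0 i ∈ slideSpace conn (x 0) i)
    {ω : Pt d} (hω : ∀ r ∈ Set.Icc 0 t, ∀ i, 0 < den ω (x r i)) :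
    ∑ k, ∫ y in simplex (elem conn (x t) k), ((den ω y) ^ (d + 1))⁻¹ =
      ∑ k, ∫ y in simplex (elem conn (x 0) k), ((den ω y) ^ (d + 1))⁻¹ := by
  have hcont : ContinuousOn x (Set.Icc 0 t) :=
    continuousOn_pi.2 fun i r hr => (hx r hr i).continuousWithinAt
  set s : Fin N → ℝ := fun k => SignType.sign (hmat (elem conn (x 0) k)).det with hs
  have key := total_signed_volume_const h₀.nondegenerate.injective s ht
    (w := fun q i => projMap ω (x q i)) (w' := fun q i => projMapDeriv ω (x q i) (x' q i))
    (fun r hr i => hasDerivWithinAt_projMap (hx r hr i) (hω r hr i).ne')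
    (fun k k' j j' hk hf y u => h₀.sign_mul_facetForm_add hd hk hf y u) ?_
  · have habs : ∀ r ∈ Set.Icc 0 t, ∀ k,
        ∫ y in simplex (elem conn (x r) k), ((den ω y) ^ (d + 1))⁻¹ =
        (s k * (hmat (elem conn (fun i => projMap ω (x r i)) k)).det) / (d.factorial : ℝ) := by
      intro r hr k
      have hden : ∀ j, 0 < den ω (elem conn (x r) k j) := fun j => hω r hr (conn k j)
      rw [setIntegral_simplex_den hden, simplexVolume_eq]
      change _ = s k * (hmat fun j => projMap ω (elem conn (x r) k j)).det / _
      rw [← sign_mul_self]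
      congr 3
      rw [← sign_det_const hcont hnd k hr, det_hmat_projMap fun j => (hden j).ne',
        sign_mul, sign_pos (Finset.prod_pos fun j _ => inv_pos.2 (hden j)), one_mul]
    simp only [habs t ⟨ht, le_rfl⟩, habs 0 ⟨le_rfl, ht⟩, ← Finset.sum_div]
    rw [key]
  · intro k j hkj
    obtain ⟨c, hc, hcv⟩ := exists_facet_covector (h₀.nondegenerate k) j
    obtain ⟨c', hc', hcc'⟩ := exists_projMap_covector ω hc
    refine ⟨c', hc', fun r hr i hi => hcc' _ (hω r hr i).ne' ?_⟩
    have h1 : ∀ y ∈ x 0 '' facet conn k j, hom y ⬝ᵥ c = 0 := by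
      rintro _ ⟨_, ⟨l, hl, rfl⟩, rfl⟩
      exact hcv l hl
    have h2 : x r i - x 0 i ∈ vectorSpan ℝ (x 0 '' facet conn k j) := by
      have := hslide r hr i
      simp only [slideSpace, Submodule.mem_iInf] at this
      exact this k j hkj hi
    have h3 : hom (x r i) = hom (x 0 i) + homDir (x r i - x 0 i) := by
      ext l
      refine Fin.cases ?_ (fun l => ?_) l <;> simp
    rw [h3, add_dotProduct, homDir_dotProduct_eq_zero h1 h2, h1 _ ⟨i, hi, rfl⟩, add_zero]

/-! ### Compactly supported measures are determined by the integrals of `(1 - ⟨ω, y⟩)^{-(d+1)}` -/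

/-- Termwise integration of an absolutely dominated power series. It serves over `ℝ` for the
negative binomial series and over `ℂ` for the exponential series. -/
lemma hasSum_integral_pow {α 𝕜 : Type*} [RCLike 𝕜] [MeasurableSpace α] {μ : Measure α}
    [IsFiniteMeasure μ] {f : α → ℝ} (hf : AEStronglyMeasurable f μ) {ρ : ℝ}
    (hρ : ∀ᵐ a ∂μ, |f a| ≤ ρ) {c : ℕ → 𝕜} (hc : Summable fun n => ‖c n‖ * ρ ^ n) :
    HasSum (fun n => c n * ((∫ a, f a ^ n ∂μ : ℝ) : 𝕜))
      (∫ a, ∑' n, c n * ((f a : 𝕜)) ^ n ∂μ) := by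
  have hbound : ∀ n : ℕ, ∀ᵐ a ∂μ, ‖c n * (f a : 𝕜) ^ n‖ ≤ ‖c n‖ * ρ ^ n := by
    intro n
    filter_upwards [hρ] with a ha
    rw [norm_mul, norm_pow, RCLike.norm_ofReal]
    gcongr
  have hmeas : ∀ n : ℕ, AEStronglyMeasurable (fun a => c n * (f a : 𝕜) ^ n) μ := fun n =>
    ((RCLike.continuous_ofReal.comp_aestronglyMeasurable hf).pow n).const_mul (c n)
  have hInt : ∀ n : ℕ, Integrable (fun a => c n * (f a : 𝕜) ^ n) μ := fun n =>
    Integrable.of_bound (hmeas n) _ (hbound n)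
  have h1 := hasSum_integral_of_summable_integral_norm hInt ?_
  · have h2 : ∀ n, ∫ a, c n * (f a : 𝕜) ^ n ∂μ = c n * ((∫ a, f a ^ n ∂μ : ℝ) : 𝕜) := by
      intro n
      rw [integral_const_mul, ← integral_ofReal]
      simp
    simpa only [h2] using h1
  · refine Summable.of_nonneg_of_le (fun n => integral_nonneg fun a => norm_nonneg _) (fun n => ?_)
      (hc.mul_right (μ.real Set.univ))
    have := integral_mono_ae (hInt n).norm (integrable_const (‖c n‖ * ρ ^ n)) (hbound n)
    simpa [mul_comm] using this

/-- The negative binomial series, convergent for `|z| |ρ| < 1`. Its coefficients are moments times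
nonzero binomial coefficients, so the function near zero determines the moments. -/
lemma hasFPowerSeriesAt_integral_inv {α : Type*} [MeasurableSpace α] {μ : Measure α}
    [IsFiniteMeasure μ] (d : ℕ) {f : α → ℝ} (hf : AEStronglyMeasurable f μ) {ρ : ℝ}
    (hρ : ∀ᵐ a ∂μ, |f a| ≤ ρ) :
    HasFPowerSeriesAt (fun z => ∫ a, ((1 - z * f a) ^ (d + 1))⁻¹ ∂μ)
      (FormalMultilinearSeries.ofScalars ℝ
        fun n => ((n + d).choose d : ℝ) * ∫ a, f a ^ n ∂μ) 0 := by
  have hsmall : ∀ᶠ z in nhds (0 : ℝ), |z| * |ρ| < 1 := by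
    have : ContinuousAt (fun z : ℝ => |z| * |ρ|) 0 := by fun_prop
    exact this.eventually (gt_mem_nhds (by simp))
  rw [hasFPowerSeriesAt_iff]
  filter_upwards [hsmall] with z hz
  have hρ' : ∀ᵐ a ∂μ, |f a| ≤ |ρ| := hρ.mono fun a ha => ha.trans (le_abs_self ρ)
  have hsum : Summable fun n : ℕ => ‖((n + d).choose d : ℝ) * z ^ n‖ * |ρ| ^ n := by
    have h1 := (hasSum_choose_mul_geometric_of_norm_lt_one (𝕜 := ℝ) d (r := |z| * |ρ|)
      (by rw [Real.norm_eq_abs, abs_of_nonneg (by positivity)]; exact hz)).summable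
    refine h1.congr fun n => ?_
    rw [norm_mul, norm_pow, Real.norm_natCast, Real.norm_eq_abs, mul_pow]
    ring
  have h2 := hasSum_integral_pow (𝕜 := ℝ) hf hρ' hsum
  have h3 : ∫ a, ∑' n, ((n + d).choose d : ℝ) * z ^ n * ((f a : ℝ)) ^ n ∂μ =
      ∫ a, ((1 - z * f a) ^ (d + 1))⁻¹ ∂μ := by
    refine integral_congr_ae ?_
    filter_upwards [hρ'] with a ha
    have h3 : ‖z * f a‖ < 1 := by
      rw [norm_mul, Real.norm_eq_abs, Real.norm_eq_abs]
      exact lt_of_le_of_lt (mul_le_mul_of_nonneg_left ha (abs_nonneg z)) hz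
    have h4 := (hasSum_choose_mul_geometric_of_norm_lt_one d h3).tsum_eq
    rw [← one_div, ← h4]
    refine tsum_congr fun n => ?_
    ring
  simp only [RCLike.ofReal_real_eq_id, id_eq] at h2
  rw [h3] at h2
  simp only [zero_add, FormalMultilinearSeries.coeff_ofScalars, smul_eq_mul]
  have h4 : ∀ n : ℕ, ((n + d).choose d : ℝ) * z ^ n * ∫ a, f a ^ n ∂μ =
      z ^ n * (((n + d).choose d : ℝ) * ∫ a, f a ^ n ∂μ) := fun n => by ring
  simpa only [h4] using h2

/-- Moments of a bounded function are determined by the integrals of `(1 - z f)^{-(d+1)}` for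
small `z`. -/
lemma integral_pow_eq_of_integral_inv {α β : Type*} [MeasurableSpace α] [MeasurableSpace β]
    {μ : Measure α} {ν : Measure β} [IsFiniteMeasure μ] [IsFiniteMeasure ν] (d : ℕ)
    {f : α → ℝ} {g : β → ℝ} (hf : AEStronglyMeasurable f μ) (hg : AEStronglyMeasurable g ν)
    {ρ : ℝ} (hfρ : ∀ᵐ a ∂μ, |f a| ≤ ρ) (hgρ : ∀ᵐ a ∂ν, |g a| ≤ ρ)
    (h : ∀ᶠ z in nhds (0 : ℝ), ∫ a, ((1 - z * f a) ^ (d + 1))⁻¹ ∂μ =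
      ∫ a, ((1 - z * g a) ^ (d + 1))⁻¹ ∂ν) (n : ℕ) :
    ∫ a, f a ^ n ∂μ = ∫ a, g a ^ n ∂ν := by
  have h1 := (hasFPowerSeriesAt_integral_inv d hf hfρ).eq_formalMultilinearSeries_of_eventually
    (hasFPowerSeriesAt_integral_inv d hg hgρ) h
  have h2 := congrArg (fun p => FormalMultilinearSeries.coeff p n) h1
  simp only [FormalMultilinearSeries.coeff_ofScalars] at h2
  have h3 : ((n + d).choose d : ℝ) ≠ 0 := by
    exact_mod_cast (Nat.choose_pos (Nat.le_add_left d n)).ne'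
  exact mul_left_cancel₀ h3 h2

/-- Replacing `ω` by `z • ω` with `z` small gives equality of all moments of `⟨ω, ·⟩`, for every
`ω`. For bounded support the exponential series expresses the characteristic function through these
moments. -/
theorem measure_eq_of_integral_den_eq {d : ℕ} {μ ν : Measure (Pt d)} [IsFiniteMeasure μ]
    [IsFiniteMeasure ν] {R : ℝ} (hμ : ∀ᵐ y ∂μ, ‖y‖ ≤ R) (hν : ∀ᵐ y ∂ν, ‖y‖ ≤ R)
    (h : ∀ ω : Pt d, ‖ω‖ * R < 1 →
      ∫ y, ((den ω y) ^ (d + 1))⁻¹ ∂μ = ∫ y, ((den ω y) ^ (d + 1))⁻¹ ∂ν) : μ = ν := by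
  have hbd : ∀ (m : Measure (Pt d)), (∀ᵐ y ∂m, ‖y‖ ≤ R) → ∀ ω : Pt d,
      ∀ᵐ y ∂m, |(inner ℝ ω y : ℝ)| ≤ ‖ω‖ * R := fun m hm ω => by
    filter_upwards [hm] with y hy
    exact (abs_real_inner_le_norm ω y).trans (mul_le_mul_of_nonneg_left hy (norm_nonneg ω))
  have hmeas : ∀ (m : Measure (Pt d)) (ω : Pt d),
      AEStronglyMeasurable (fun y : Pt d => (inner ℝ ω y : ℝ)) m := fun m ω =>
    (continuous_const.inner continuous_id).aestronglyMeasurable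
  have hmom : ∀ (ω : Pt d) (n : ℕ), ∫ y, (inner ℝ ω y : ℝ) ^ n ∂μ = ∫ y, (inner ℝ ω y : ℝ) ^ n ∂ν := by
    intro ω n
    refine integral_pow_eq_of_integral_inv d (hmeas μ ω) (hmeas ν ω) (hbd μ hμ ω) (hbd ν hν ω)
      ?_ n
    have : ContinuousAt (fun z : ℝ => ‖z • ω‖ * R) 0 := by fun_prop
    have hlt : ∀ᶠ z : ℝ in nhds 0, ‖z • ω‖ * R < 1 := this.eventually (gt_mem_nhds (by simp))
    filter_upwards [hlt] with z hz
    simpa only [den, inner_smul_left, conj_trivial] using h (z • ω) hz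
  refine Measure.ext_of_charFun (funext fun ω => ?_)
  have key : ∀ (m : Measure (Pt d)) [IsFiniteMeasure m], (∀ᵐ y ∂m, ‖y‖ ≤ R) →
      HasSum (fun n : ℕ => (Complex.I ^ n / (n.factorial : ℂ)) *
        ((∫ y, (inner ℝ ω y : ℝ) ^ n ∂m : ℝ) : ℂ)) (charFun m ω) := by
    intro m _ hm
    have hsum : Summable fun n : ℕ => ‖(Complex.I ^ n / (n.factorial : ℂ))‖ * (‖ω‖ * R) ^ n := by
      refine (Real.summable_pow_div_factorial (‖ω‖ * R)).congr fun n => ?_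
      simp
      ring
    have h1 := hasSum_integral_pow (𝕜 := ℂ) (hmeas m ω) (hbd m hm ω) hsum
    refine (congrArg (HasSum _) ?_).mp h1
    rw [charFun_apply]
    refine integral_congr_ae (Filter.Eventually.of_forall fun y => ?_)
    simp only [RCLike.ofReal_eq_complex_ofReal]
    symm
    rw [real_inner_comm, Complex.exp_eq_exp_ℂ,
      ← (NormedSpace.expSeries_div_hasSum_exp ((inner ℝ ω y : ℂ) * Complex.I)).tsum_eq]
    refine tsum_congr fun n => ?_
    rw [mul_pow]
    ring
  have h2 := key ν hν
  simp only [← hmom] at h2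
  exact (key μ hμ).unique h2

/-! ### Nonsingularity is a property of the sum of the volumes restricted to the elements -/

/-- The sum of the volume measures restricted to the elements. -/
def meshMeasure {d N Nv : ℕ} (conn : Connectivity d N Nv) (x : Config d Nv) : Measure (Pt d) :=
  ∑ k, volume.restrict (simplex (elem conn x k))

instance {d N Nv : ℕ} (conn : Connectivity d N Nv) (x : Config d Nv) :
    IsFiniteMeasure (meshMeasure conn x) := by
  have : ∀ k, IsFiniteMeasure (volume.restrict (simplex (elem conn x k))) := fun k =>
    ⟨by rw [Measure.restrict_apply_univ]; exact (isCompact_simplex _).measure_lt_top⟩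
  unfold meshMeasure
  infer_instance

lemma meshMeasure_apply {d N Nv : ℕ} (conn : Connectivity d N Nv) (x : Config d Nv)
    {A : Set (Pt d)} (hA : MeasurableSet A) :
    meshMeasure conn x A = ∑ k, volume (A ∩ simplex (elem conn x k)) := by
  simp [meshMeasure, Measure.restrict_apply hA]

lemma convex_simplex {d : ℕ} (v : Fin (d + 1) → Pt d) : Convex ℝ (simplex v) :=
  convex_convexHull ℝ _

/-- Distinct elements meet only in their frontiers, which are null because the elements are convex.
-/
lemma IsNonsingularMesh.meshMeasure_eq {d N Nv : ℕ} {Ω : Set (Pt d)}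
    {conn : Connectivity d N Nv} {x : Config d Nv} (h : IsNonsingularMesh Ω conn x) :
    meshMeasure conn x = volume.restrict (closure Ω) := by
  rw [← h.cover, Measure.restrict_iUnion_ae, Measure.sum_fintype, meshMeasure]
  · intro k l hkl
    refine measure_mono_null (t := frontier (simplex (elem conn x k)) ∪
      frontier (simplex (elem conn x l))) ?_ ?_
    · rintro y ⟨hy, hy'⟩
      by_contra hn
      rw [Set.mem_union, not_or] at hn
      have h1 : y ∈ interior (simplex (elem conn x k)) := by
        by_contra h1
        exact hn.1 ⟨subset_closure hy, h1⟩
      have h2 : y ∈ interior (simplex (elem conn x l)) := by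
        by_contra h2
        exact hn.2 ⟨subset_closure hy', h2⟩
      exact Set.disjoint_left.1 (h.disjoint k l hkl) h1 h2
    · exact measure_union_null ((convex_simplex _).addHaar_frontier volume)
        ((convex_simplex _).addHaar_frontier volume)
  · exact fun k => (isCompact_simplex _).isClosed.measurableSet.nullMeasurableSet

lemma interior_simplex_nonempty {d : ℕ} {v : Fin (d + 1) → Pt d} (h : AffineIndependent ℝ v) :
    (interior (simplex v)).Nonempty :=
  ⟨_, (simplexBasis v h).centroid_mem_interior_convexHull⟩

/-- Each possible defect is an open set: an overlap of two interiors, an interior minus `closure Ω`,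
or `Ω` minus all elements. Equality of the measures makes it null, and a null open set is empty. -/
lemma isNonsingularMesh_of_meshMeasure_eq {d N Nv : ℕ} {Ω : Set (Pt d)} (hΩ : IsOpen Ω)
    {conn : Connectivity d N Nv} {x : Config d Nv} (hx : Nondegenerate conn x)
    (h : meshMeasure conn x = volume.restrict (closure Ω)) : IsNonsingularMesh Ω conn x := by
  have happ : ∀ A : Set (Pt d), MeasurableSet A →
      ∑ k, volume (A ∩ simplex (elem conn x k)) = volume (A ∩ closure Ω) := by
    intro A hA
    rw [← meshMeasure_apply conn x hA, h, Measure.restrict_apply hA]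
  refine ⟨hx, fun k l hkl => ?_, Set.Subset.antisymm (Set.iUnion_subset fun k => ?_) ?_⟩
  · rw [Set.disjoint_iff_inter_eq_empty]
    have hopen : IsOpen (interior (simplex (elem conn x k)) ∩ interior (simplex (elem conn x l))) :=
      isOpen_interior.inter isOpen_interior
    set U := interior (simplex (elem conn x k)) ∩ interior (simplex (elem conn x l)) with hU
    rw [← hopen.measure_eq_zero_iff volume]
    have h1 := happ U hopen.measurableSet
    have hk : U ∩ simplex (elem conn x k) = U :=
      Set.inter_eq_left.2 (Set.inter_subset_left.trans interior_subset)
    have hl : U ∩ simplex (elem conn x l) = U :=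
      Set.inter_eq_left.2 (Set.inter_subset_right.trans interior_subset)
    have hfin : volume U ≠ ⊤ := by
      refine ne_top_of_le_ne_top (isCompact_simplex (elem conn x k)).measure_lt_top.ne
        (measure_mono ?_)
      exact Set.inter_subset_left.trans interior_subset
    -- The mesh measure counts the overlap at least twice, Lebesgue measure at most once.
    have h2 : volume U + volume U ≤ volume U := by
      calc volume U + volume U
          = ∑ m ∈ {k, l}, volume (U ∩ simplex (elem conn x m)) := by
            rw [Finset.sum_pair hkl, hk, hl]
        _ ≤ ∑ m, volume (U ∩ simplex (elem conn x m)) :=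
            Finset.sum_le_sum_of_subset (Finset.subset_univ _)
        _ = volume (U ∩ closure Ω) := h1
        _ ≤ volume U := measure_mono Set.inter_subset_left
    by_contra hne
    exact absurd h2 (not_le.2 (ENNReal.lt_add_right hfin hne))
  · have hopen : IsOpen (interior (simplex (elem conn x k)) \ closure Ω) :=
      isOpen_interior.sdiff isClosed_closure
    set A := interior (simplex (elem conn x k)) \ closure Ω with hA
    have h1 := happ A hopen.measurableSet
    have h2 : A ∩ closure Ω = ∅ := by
      rw [hA]
      exact Set.sdiff_inter_self
    rw [h2, measure_empty, Finset.sum_eq_zero_iff_of_nonneg (fun _ _ => zero_le)] at h1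
    have h3 := h1 k (Finset.mem_univ k)
    rw [Set.inter_eq_left.2 (Set.sdiff_subset.trans interior_subset),
      hopen.measure_eq_zero_iff volume, Set.sdiff_eq_empty] at h3
    calc simplex (elem conn x k) ⊆ closure (simplex (elem conn x k)) := subset_closure
      _ = closure (interior (simplex (elem conn x k))) :=
          ((convex_simplex _).closure_interior_eq_closure_of_nonempty_interior
            (interior_simplex_nonempty (hx k))).symm
      _ ⊆ closure Ω := closure_minimal h3 isClosed_closure
  · have hcl : IsClosed (⋃ k, simplex (elem conn x k)) :=
      isClosed_iUnion_of_finite fun k => (isCompact_simplex _).isClosed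
    refine closure_minimal ?_ hcl
    have hopen : IsOpen (Ω \ ⋃ k, simplex (elem conn x k)) := hΩ.sdiff hcl
    have h1 := happ _ hopen.measurableSet
    rw [Finset.sum_eq_zero, Set.inter_eq_left.2 (Set.sdiff_subset.trans subset_closure)] at h1
    · rw [← Set.sdiff_eq_empty, ← hopen.measure_eq_zero_iff volume, ← h1]
    · intro k _
      rw [show (Ω \ ⋃ k, simplex (elem conn x k)) ∩ simplex (elem conn x k) = ∅ from ?_,
        measure_empty]
      ext y
      simp only [Set.mem_inter_iff, Set.mem_sdiff, Set.mem_iUnion, not_exists,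
        Set.mem_empty_iff_false, iff_false]
      exact fun hy => hy.1.2 k hy.2

lemma ae_meshMeasure_norm_le {d N Nv : ℕ} {conn : Connectivity d N Nv} {x : Config d Nv} {R : ℝ}
    (h : ∀ i, ‖x i‖ ≤ R) : ∀ᵐ y ∂(meshMeasure conn x), ‖y‖ ≤ R := by
  have hsub : ∀ k, simplex (elem conn x k) ⊆ Metric.closedBall 0 R := by
    intro k
    refine convexHull_min ?_ (convex_closedBall 0 R)
    rintro _ ⟨j, rfl⟩
    simpa [elem] using h (conn k j)
  have : meshMeasure conn x (Metric.closedBall 0 R)ᶜ = 0 := by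
    rw [meshMeasure_apply _ _ Metric.isClosed_closedBall.measurableSet.compl]
    refine Finset.sum_eq_zero fun k _ => ?_
    rw [show (Metric.closedBall (0 : Pt d) R)ᶜ ∩ simplex (elem conn x k) = ∅ from ?_,
      measure_empty]
    rw [Set.inter_comm, ← Set.sdiff_eq, Set.sdiff_eq_empty]
    exact hsub k
  rw [ae_iff]
  convert this using 2
  ext y
  simp

lemma integral_meshMeasure {d N Nv : ℕ} (conn : Connectivity d N Nv) {x : Config d Nv}
    {f : Pt d → ℝ} (hf : ∀ k, IntegrableOn f (simplex (elem conn x k))) :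
    ∫ y, f y ∂(meshMeasure conn x) = ∑ k, ∫ y in simplex (elem conn x k), f y := by
  rw [meshMeasure, integral_finsetSum_measure fun k _ => hf k]

/-- A mesh that moves without degenerating, with boundary vertices sliding along the boundary,
stays a nonsingular mesh of the same domain. -/
theorem IsNonsingularMesh.of_motion {d N Nv : ℕ} (hd : 1 ≤ d) {Ω : Set (Pt d)} (hΩ : IsOpen Ω)
    {conn : Connectivity d N Nv} {t : ℝ} (ht : 0 ≤ t) {x x' : ℝ → Config d Nv}
    (h₀ : IsNonsingularMesh Ω conn (x 0))
    (hx : ∀ r ∈ Set.Icc 0 t, ∀ i,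
      HasDerivWithinAt (fun q => x q i) (x' r i) (Set.Icc 0 t) r)
    (hnd : ∀ r ∈ Set.Icc 0 t, Nondegenerate conn (x r))
    (hslide : ∀ r ∈ Set.Icc 0 t, ∀ i, x r i - x 0 i ∈ slideSpace conn (x 0) i) :
    IsNonsingularMesh Ω conn (x t) := by
  have hcont : ContinuousOn x (Set.Icc 0 t) :=
    continuousOn_pi.2 fun i r hr => (hx r hr i).continuousWithinAt
  obtain ⟨R, hR⟩ := (isCompact_Icc.image_of_continuousOn hcont).isBounded.exists_norm_le
  have hRi : ∀ r ∈ Set.Icc 0 t, ∀ i, ‖x r i‖ ≤ R := fun r hr i =>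
    (norm_le_pi_norm (x r) i).trans (hR _ ⟨r, hr, rfl⟩)
  have ht' : t ∈ Set.Icc 0 t := ⟨ht, le_rfl⟩
  have h0' : (0 : ℝ) ∈ Set.Icc 0 t := ⟨le_rfl, ht⟩
  refine isNonsingularMesh_of_meshMeasure_eq hΩ (hnd t ht') ?_
  rw [← h₀.meshMeasure_eq]
  refine measure_eq_of_integral_den_eq (ae_meshMeasure_norm_le (hRi t ht'))
    (ae_meshMeasure_norm_le (hRi 0 h0')) fun ω hω => ?_
  -- All vertices stay in the ball of radius `R` up to time `t`, and `‖ω‖ * R < 1`.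
  have hden : ∀ r ∈ Set.Icc 0 t, ∀ i, 0 < den ω (x r i) := by
    intro r hr i
    have h1 := (abs_real_inner_le_norm ω (x r i)).trans
      (mul_le_mul_of_nonneg_left (hRi r hr i) (norm_nonneg ω))
    have h2 := le_abs_self (inner ℝ ω (x r i) : ℝ)
    rw [den]
    linarith
  have hInt : ∀ r ∈ Set.Icc 0 t, ∀ k,
      IntegrableOn (fun y => ((den ω y) ^ (d + 1))⁻¹) (simplex (elem conn (x r) k)) := by
    intro r hr k
    refine ContinuousOn.integrableOn_compact (isCompact_simplex _) (ContinuousOn.inv₀ ?_ ?_)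
    · exact Continuous.continuousOn (by unfold den; fun_prop)
    · intro y hy
      exact pow_ne_zero _ (den_pos_of_mem_simplex (fun j => hden r hr (conn k j)) hy).ne'
  rw [integral_meshMeasure conn (hInt t ht'), integral_meshMeasure conn (hInt 0 h0')]
  exact sum_integral_den_const hd ht h₀ hx hnd hslide hden

/-! ### Energy decay along trajectories -/

/-- The inner product of the curve with any vector orthogonal to `V` has zero derivative. -/
lemma sub_mem_of_hasDerivWithinAt_mem {d : ℕ} {t : ℝ} {y y' : ℝ → Pt d}
    {V : Submodule ℝ (Pt d)}
    (hy : ∀ r ∈ Set.Icc 0 t, HasDerivWithinAt y (y' r) (Set.Icc 0 t) r)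
    (hV : ∀ r ∈ Set.Icc 0 t, y' r ∈ V) {r : ℝ} (hr : r ∈ Set.Icc 0 t) : y r - y 0 ∈ V := by
  rw [← V.orthogonal_orthogonal, Submodule.mem_orthogonal]
  intro w hw
  rcases (hr.1.trans hr.2).eq_or_lt with h0 | h0
  · have : r = 0 := le_antisymm (h0 ▸ hr.2) hr.1
    simp [this]
  have hder : ∀ q ∈ Set.Icc 0 t,
      HasDerivWithinAt (fun s => (inner ℝ w (y s) : ℝ)) 0 (Set.Icc 0 t) q := by
    intro q hq
    have h1 := (innerSL ℝ w).hasFDerivAt.comp_hasDerivWithinAt q (hy q hq)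
    have h2 : (innerSL ℝ w) (y' q) = 0 := by
      rw [innerSL_apply_apply, real_inner_comm]
      exact (Submodule.mem_orthogonal V w).1 hw _ (hV q hq)
    rw [h2] at h1
    exact h1
  have h3 := constant_of_derivWithin_zero (fun q hq => (hder q hq).differentiableWithinAt)
    (fun q hq => (hder q ⟨hq.1, hq.2.le⟩).derivWithin
      (uniqueDiffOn_Icc h0 q ⟨hq.1, hq.2.le⟩)) r hr
  rw [inner_sub_right, h3, sub_self]

section Trajectory

variable {d N Nv : ℕ} {conn : Connectivity d N Nv} {I : Config d Nv → ℝ}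
  {V : Fin Nv → Submodule ℝ (Pt d)} {P : Fin Nv → ℝ → ℝ} {τ : ℝ} {T : EReal}
  {x : ℝ → Config d Nv}

/-- Testing the projected equation with the velocity itself gives the dissipation identity `|v|² =
-(P/τ) L v` of each vertex. -/
lemma IsTrajectory.exists_velocity (hx : IsTrajectory conn I V P τ T x) {t : ℝ}
    (htT : (t : EReal) < T) (hnd : ∀ r ∈ Set.Icc 0 t, Nondegenerate conn (x r)) :
    ∃ (x' : ℝ → Config d Nv) (L : ℝ → Config d Nv →L[ℝ] ℝ), ∀ r ∈ Set.Icc 0 t,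
      HasFDerivWithinAt I (L r) {y | ∀ i, y i - x r i ∈ V i} (x r) ∧
      ∀ i, x' r i ∈ V i ∧ HasDerivWithinAt (fun s => x s i) (x' r i) (Set.Icc 0 t) r ∧
        inner ℝ (x' r i) (x' r i) = -(P i r / τ) * L r (Pi.single i (x' r i)) := by
  have h : ∀ r : ℝ, ∃ (v : Config d Nv) (L : Config d Nv →L[ℝ] ℝ), r ∈ Set.Icc 0 t →
      HasFDerivWithinAt I L {y | ∀ i, y i - x r i ∈ V i} (x r) ∧
      ∀ i, v i ∈ V i ∧ HasDerivWithinAt (fun s => x s i) (v i) (Set.Icc 0 t) r ∧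
        inner ℝ (v i) (v i) = -(P i r / τ) * L (Pi.single i (v i)) := by
    intro r
    by_cases hr : r ∈ Set.Icc 0 t
    · have hrT : (r : EReal) < T := lt_of_le_of_lt (EReal.coe_le_coe_iff.2 hr.2) htT
      obtain ⟨L, hL, hv⟩ := hx.equation r hr.1 hrT (hnd r hr)
      choose v hv1 hv2 hv3 using hv
      exact ⟨v, L, fun _ => ⟨hL, fun i => ⟨hv1 i, (hv2 i).mono fun s hs => hs.1,
        hv3 i _ (hv1 i)⟩⟩⟩
    · exact ⟨0, 0, fun h => absurd h hr⟩
  choose x' L hx'L using h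
  exact ⟨x', L, hx'L⟩

/-- While the mesh does not degenerate, the energy does not increase. -/
lemma IsTrajectory.energy_le (hx : IsTrajectory conn I V P τ T x) (hτ : 0 < τ)
    (hP : ∀ i t, 0 < P i t) {t : ℝ} (ht : 0 ≤ t) (htT : (t : EReal) < T)
    (hnd : ∀ r ∈ Set.Icc 0 t, Nondegenerate conn (x r)) : I (x t) ≤ I (x 0) := by
  obtain ⟨x', L, h⟩ := hx.exists_velocity htT hnd
  -- The functional is differentiable only along admissible displacements, so the chain rule
  -- requires the whole curve to stay in the translate of the admissible spaces.
  have hmem : ∀ r ∈ Set.Icc 0 t, ∀ i, x r i - x 0 i ∈ V i := fun r hr i =>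
    sub_mem_of_hasDerivWithinAt_mem (y := fun s => x s i) (y' := fun s => x' s i)
      (fun q hq => ((h q hq).2 i).2.1) (fun q hq => ((h q hq).2 i).1) hr
  have hder : ∀ r ∈ Set.Icc 0 t,
      HasDerivWithinAt (fun s => I (x s)) (L r (x' r)) (Set.Icc 0 t) r := by
    intro r hr
    refine (h r hr).1.comp_hasDerivWithinAt r
      (hasDerivWithinAt_pi.2 fun i => ((h r hr).2 i).2.1) ?_
    intro q hq i
    have := (V i).sub_mem (hmem q hq i) (hmem r hr i)
    simpa using this
  have hneg : ∀ r ∈ Set.Icc 0 t, L r (x' r) ≤ 0 := by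
    intro r hr
    have hsum : L r (x' r) = ∑ i, L r (Pi.single i (x' r i)) := by
      rw [← map_sum, Finset.univ_sum_single]
    rw [hsum]
    refine Finset.sum_nonpos fun i _ => ?_
    have h1 := ((h r hr).2 i).2.2
    have h2 : 0 ≤ (inner ℝ (x' r i) (x' r i) : ℝ) := real_inner_self_nonneg
    have h3 : 0 < P i r / τ := div_pos (hP i r) hτ
    by_contra! h4
    have := mul_pos h3 h4
    linarith
  have hanti : AntitoneOn (fun s => I (x s)) (Set.Icc 0 t) := by
    refine antitoneOn_of_deriv_nonpos (convex_Icc 0 t)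
      (fun r hr => (hder r hr).continuousWithinAt) ?_ ?_
    · intro r hr
      rw [interior_Icc] at hr
      exact ((hder r ⟨hr.1.le, hr.2.le⟩).hasDerivAt
        (Icc_mem_nhds hr.1 hr.2)).differentiableAt.differentiableWithinAt
    · intro r hr
      rw [interior_Icc] at hr
      rw [((hder r ⟨hr.1.le, hr.2.le⟩).hasDerivAt (Icc_mem_nhds hr.1 hr.2)).deriv]
      exact hneg r ⟨hr.1.le, hr.2.le⟩
  exact hanti ⟨le_rfl, ht⟩ ⟨ht, le_rfl⟩ ht

/-- While the mesh does not degenerate, it stays a nonsingular mesh of the domain. -/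
lemma IsTrajectory.isNonsingularMesh (hx : IsTrajectory conn I V P τ T x) (hd : 1 ≤ d)
    {Ω : Set (Pt d)} (hΩ : IsOpen Ω) (h₀ : IsNonsingularMesh Ω conn (x 0))
    (hV : ∀ i, V i ≤ slideSpace conn (x 0) i) {t : ℝ} (ht : 0 ≤ t) (htT : (t : EReal) < T)
    (hnd : ∀ r ∈ Set.Icc 0 t, Nondegenerate conn (x r)) : IsNonsingularMesh Ω conn (x t) := by
  obtain ⟨x', L, h⟩ := hx.exists_velocity htT hnd
  refine IsNonsingularMesh.of_motion hd hΩ ht h₀ (fun r hr i => ((h r hr).2 i).2.1) hnd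
    fun r hr i => hV i ?_
  exact sub_mem_of_hasDerivWithinAt_mem (y := fun s => x s i) (y' := fun s => x' s i)
      (fun q hq => ((h q hq).2 i).2.1) (fun q hq => ((h q hq).2 i).1) hr

end Trajectory

/-! ### Averages of the metric tensor -/

lemma quad_single_add {d : ℕ} {A : Matrix (Fin d) (Fin d) ℝ} (hA : A.IsHermitian) (i j : Fin d)
    (s : ℝ) :
    (Pi.single i 1 + s • Pi.single j 1 : Fin d → ℝ) ⬝ᵥ
      A.mulVec (Pi.single i 1 + s • Pi.single j 1) = A i i + 2 * s * A i j + s ^ 2 * A j j := by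
  have : A j i = A i j := by simpa using hA.apply i j
  simp only [Matrix.mulVec_add, Matrix.mulVec_smul, add_dotProduct, dotProduct_add, smul_dotProduct,
    dotProduct_smul, Matrix.mulVec_single_one, single_one_dotProduct, Matrix.col_apply, this,
    smul_eq_mul]
  ring

lemma sum_quad_eq {d : ℕ} (A : Matrix (Fin d) (Fin d) ℝ) (u : Fin d → ℝ) :
    u ⬝ᵥ A.mulVec u = ∑ i, ∑ j, u i * A i j * u j := by
  simp only [dotProduct, Matrix.mulVec, Finset.mul_sum, mul_assoc]

lemma quad_le_of_posSemidef {d : ℕ} {A : Matrix (Fin d) (Fin d) ℝ} {m : ℝ}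
    (h : (m • (1 : Matrix (Fin d) (Fin d) ℝ) - A).PosSemidef) (u : Fin d → ℝ) :
    u ⬝ᵥ A.mulVec u ≤ m * (u ⬝ᵥ u) := by
  have := h.dotProduct_mulVec_nonneg u
  simp only [star_trivial, Matrix.sub_mulVec, Matrix.smul_mulVec, Matrix.one_mulVec,
    dotProduct_sub, dotProduct_smul, smul_eq_mul] at this
  linarith

lemma le_quad_of_posSemidef {d : ℕ} {A : Matrix (Fin d) (Fin d) ℝ} {m : ℝ}
    (h : (A - m • (1 : Matrix (Fin d) (Fin d) ℝ)).PosSemidef) (u : Fin d → ℝ) :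
    m * (u ⬝ᵥ u) ≤ u ⬝ᵥ A.mulVec u := by
  have := h.dotProduct_mulVec_nonneg u
  simp only [star_trivial, Matrix.sub_mulVec, Matrix.smul_mulVec, Matrix.one_mulVec,
    dotProduct_sub, dotProduct_smul, smul_eq_mul] at this
  linarith

lemma isHermitian_of_sub_smul_one {d : ℕ} {A : Matrix (Fin d) (Fin d) ℝ} {m : ℝ}
    (h : (A - m • (1 : Matrix (Fin d) (Fin d) ℝ)).PosSemidef) : A.IsHermitian := by
  have h1 : (m • (1 : Matrix (Fin d) (Fin d) ℝ)).IsHermitian := by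
    simp [Matrix.IsHermitian]
  have := h.isHermitian.add h1
  simpa using this

/-- The two-sided bound `mlo I ≤ A ≤ mhi I`. -/
structure Between {d : ℕ} (mlo mhi : ℝ) (A : Matrix (Fin d) (Fin d) ℝ) : Prop where
  lower : (A - mlo • (1 : Matrix (Fin d) (Fin d) ℝ)).PosSemidef
  upper : (mhi • (1 : Matrix (Fin d) (Fin d) ℝ) - A).PosSemidef

/-- Nonnegativity of the quadratic form at `e_i ± e_j` bounds an entry by the mean of two diagonal
entries. This makes the entries of the metric integrable. -/
lemma Between.abs_apply_le {d : ℕ} {mlo mhi : ℝ} (hmlo : 0 ≤ mlo)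
    {A : Matrix (Fin d) (Fin d) ℝ} (h : Between mlo mhi A) (i j : Fin d) : |A i j| ≤ mhi := by
  have hH := isHermitian_of_sub_smul_one h.lower
  have hnn : ∀ u : Fin d → ℝ, 0 ≤ u ⬝ᵥ A.mulVec u := fun u =>
    (mul_nonneg hmlo (dotProduct_self_star_nonneg u)).trans (le_quad_of_posSemidef h.lower u)
  have hdiag : ∀ l, A l l ≤ mhi := fun l => by
    have := quad_le_of_posSemidef h.upper (Pi.single l 1)
    simpa using this
  have h1 := hnn (Pi.single i 1 + (1 : ℝ) • Pi.single j 1)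
  have h2 := hnn (Pi.single i 1 + (-1 : ℝ) • Pi.single j 1)
  rw [quad_single_add hH] at h1 h2
  have := hdiag i
  have := hdiag j
  rw [abs_le]
  constructor <;> nlinarith

/-- The quadratic form of the average is the average of the quadratic forms. -/
lemma between_integral {α : Type*} [MeasurableSpace α] {μ : Measure α} [IsProbabilityMeasure μ]
    {d : ℕ} {mlo mhi : ℝ} (hmlo : 0 ≤ mlo) {M : α → Matrix (Fin d) (Fin d) ℝ}
    (hmeas : ∀ i j, AEMeasurable (fun a => M a i j) μ) (h : ∀ᵐ a ∂μ, Between mlo mhi (M a)) :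
    Between mlo mhi (Matrix.of fun i j => ∫ a, M a i j ∂μ) := by
  have hInt : ∀ i j, Integrable (fun a => M a i j) μ := fun i j =>
    Integrable.of_bound (hmeas i j).aestronglyMeasurable mhi
      (h.mono fun a ha => ha.abs_apply_le hmlo i j)
  set A : Matrix (Fin d) (Fin d) ℝ := Matrix.of fun i j => ∫ a, M a i j ∂μ with hA
  have hInt2 : ∀ (u : Fin d → ℝ) i j, Integrable (fun a => u i * M a i j * u j) μ := fun u i j =>
    ((hInt i j).const_mul _).mul_const _
  have hquad : ∀ u : Fin d → ℝ, u ⬝ᵥ A.mulVec u = ∫ a, u ⬝ᵥ (M a).mulVec u ∂μ := by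
    intro u
    simp only [sum_quad_eq]
    rw [integral_finsetSum _ fun i _ => integrable_finsetSum _ fun j _ => hInt2 u i j]
    refine Finset.sum_congr rfl fun i _ => ?_
    rw [integral_finsetSum _ fun j _ => hInt2 u i j]
    refine Finset.sum_congr rfl fun j _ => ?_
    rw [integral_mul_const, integral_const_mul, hA, Matrix.of_apply]
  have hquadint : ∀ u : Fin d → ℝ, Integrable (fun a => u ⬝ᵥ (M a).mulVec u) μ := by
    intro u
    simp only [sum_quad_eq]
    exact integrable_finsetSum _ fun i _ => integrable_finsetSum _ fun j _ => hInt2 u i j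
  have hherm : A.IsHermitian := by
    ext i j
    simp only [Matrix.conjTranspose_apply, star_trivial, hA, Matrix.of_apply]
    refine integral_congr_ae (h.mono fun a ha => ?_)
    simpa using (isHermitian_of_sub_smul_one ha.lower).apply i j
  have hone : ∀ m : ℝ, (m • (1 : Matrix (Fin d) (Fin d) ℝ)).IsHermitian := fun m => by
    simp [Matrix.IsHermitian]
  constructor
  · refine Matrix.PosSemidef.of_dotProduct_mulVec_nonneg (hherm.sub (hone mlo)) fun u => ?_
    have h1 : mlo * (u ⬝ᵥ u) ≤ u ⬝ᵥ A.mulVec u := by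
      rw [hquad]
      have := integral_mono_ae (integrable_const (mlo * (u ⬝ᵥ u))) (hquadint u)
        (h.mono fun a ha => le_quad_of_posSemidef ha.lower u)
      simpa using this
    simp only [star_trivial, Matrix.sub_mulVec, Matrix.smul_mulVec, Matrix.one_mulVec,
      dotProduct_sub, dotProduct_smul, smul_eq_mul]
    linarith
  · refine Matrix.PosSemidef.of_dotProduct_mulVec_nonneg ((hone mhi).sub hherm) fun u => ?_
    have h1 : u ⬝ᵥ A.mulVec u ≤ mhi * (u ⬝ᵥ u) := by
      rw [hquad]
      have := integral_mono_ae (hquadint u) (integrable_const (mhi * (u ⬝ᵥ u)))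
        (h.mono fun a ha => quad_le_of_posSemidef ha.upper u)
      simpa using this
    simp only [star_trivial, Matrix.sub_mulVec, Matrix.smul_mulVec, Matrix.one_mulVec,
      dotProduct_sub, dotProduct_smul, smul_eq_mul]
    linarith

lemma IsPolyhedralDomain.volume_frontier {d : ℕ} {Ω : Set (Pt d)} (h : IsPolyhedralDomain Ω) :
    volume (frontier Ω) = 0 := by
  obtain ⟨H, hH, hsub⟩ := h.flat_boundary
  refine measure_mono_null hsub ?_
  refine (measure_biUnion_null_iff H.countable_toSet).2 ?_
  exact fun s hs => Measure.addHaar_affineSubspace volume s (hH s hs)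

lemma IsPolyhedralDomain.closure_ae_eq {d : ℕ} {Ω : Set (Pt d)} (h : IsPolyhedralDomain Ω) :
    closure Ω =ᵐ[volume] Ω := by
  refine Filter.EventuallyLE.antisymm ?_ (LE.le.eventuallyLE subset_closure)
  rw [ae_le_set]
  have : closure Ω \ Ω = frontier Ω := by rw [frontier, h.isOpen.interior_eq]
  rw [this]
  exact h.volume_frontier

/-- The metric is controlled on `Ω` only, while elements reach into its closure; the difference is
null because the boundary is flat. -/
lemma avgMetric_between {d : ℕ} {Ω : Set (Pt d)} (hΩ : IsPolyhedralDomain Ω) {mlo mhi : ℝ}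
    (hmlo : 0 ≤ mlo) {M : Pt d → Matrix (Fin d) (Fin d) ℝ} (hM : IsMetricTensor Ω mlo mhi M)
    {v : Fin (d + 1) → Pt d} (hv : AffineIndependent ℝ v) (hsub : simplex v ⊆ closure Ω) :
    Between mlo mhi (avgMetric M v) := by
  have hle : volume.restrict (simplex v) ≤ volume.restrict Ω := by
    rw [← Measure.restrict_congr_set hΩ.closure_ae_eq]
    exact Measure.restrict_mono_set volume hsub
  have hpos : volume (simplex v) ≠ 0 := by
    have := (isOpen_interior.measure_pos volume (interior_simplex_nonempty hv))
    exact (lt_of_lt_of_le this (measure_mono interior_subset)).ne'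
  have hfin : volume (simplex v) ≠ ⊤ := (isCompact_simplex v).measure_lt_top.ne
  set μ : Measure (Pt d) := (volume (simplex v))⁻¹ • volume.restrict (simplex v) with hμ
  have hprob : IsProbabilityMeasure μ := ⟨by
    simp [hμ, ENNReal.inv_mul_cancel hpos hfin]⟩
  have h1 : avgMetric M v = Matrix.of fun i j => ∫ y, M y i j ∂μ := by
    ext i j
    simp [avgMetric, average, hμ]
  rw [h1]
  refine between_integral hmlo (fun i j => ?_) ?_
  · exact ((hM.measurable i j).mono_measure hle).smul_measure _
  · refine Measure.ae_smul_measure ?_ _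
    refine ae_mono hle ?_
    exact (ae_restrict_iff' hΩ.isOpen.measurableSet).2
      (Filter.Eventually.of_forall fun y hy => ⟨hM.lower y hy, hM.upper y hy⟩)

/-! ### Determinants and traces -/

lemma dotProduct_eigenvector_self {d : ℕ} {A : Matrix (Fin d) (Fin d) ℝ} (hA : A.IsHermitian)
    (i : Fin d) :
    (hA.eigenvectorBasis i).ofLp ⬝ᵥ (hA.eigenvectorBasis i).ofLp = 1 := by
  have h1 : inner ℝ (hA.eigenvectorBasis i) (hA.eigenvectorBasis i) = (1 : ℝ) := by
    rw [real_inner_self_eq_norm_sq, hA.eigenvectorBasis.norm_eq_one]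
    simp
  rw [inner_eq_sum] at h1
  exact h1

lemma eigenvalues_eq_quad {d : ℕ} {A : Matrix (Fin d) (Fin d) ℝ} (hA : A.IsHermitian)
    (i : Fin d) : hA.eigenvalues i =
      (hA.eigenvectorBasis i).ofLp ⬝ᵥ A.mulVec (hA.eigenvectorBasis i).ofLp := by
  rw [hA.eigenvalues_eq i]
  simp

lemma Between.pow_le_det {d : ℕ} {mlo mhi : ℝ} (hmlo : 0 ≤ mlo)
    {A : Matrix (Fin d) (Fin d) ℝ} (h : Between mlo mhi A) : mlo ^ d ≤ A.det := by
  have hA := isHermitian_of_sub_smul_one h.lower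
  rw [hA.det_eq_prod_eigenvalues]
  calc mlo ^ d = ∏ _i : Fin d, mlo := by simp
    _ ≤ ∏ i, (hA.eigenvalues i : ℝ) := Finset.prod_le_prod (fun _ _ => hmlo) fun i _ => by
        have := le_quad_of_posSemidef h.lower (hA.eigenvectorBasis i).ofLp
        rw [dotProduct_eigenvector_self, mul_one, ← eigenvalues_eq_quad] at this
        exact this

lemma Between.det_le_pow {d : ℕ} {mlo mhi : ℝ} (hmlo : 0 ≤ mlo)
    {A : Matrix (Fin d) (Fin d) ℝ} (h : Between mlo mhi A) : A.det ≤ mhi ^ d := by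
  have hA := isHermitian_of_sub_smul_one h.lower
  rw [hA.det_eq_prod_eigenvalues]
  calc ∏ i, (hA.eigenvalues i : ℝ) ≤ ∏ _i : Fin d, mhi :=
        Finset.prod_le_prod (fun i _ => by
          have := le_quad_of_posSemidef h.lower (hA.eigenvectorBasis i).ofLp
          rw [dotProduct_eigenvector_self, mul_one, ← eigenvalues_eq_quad] at this
          exact hmlo.trans this) fun i _ => by
          have := quad_le_of_posSemidef h.upper (hA.eigenvectorBasis i).ofLp
          rw [dotProduct_eigenvector_self, mul_one, ← eigenvalues_eq_quad] at this
          exact this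
    _ = mhi ^ d := by simp

lemma Between.posDef {d : ℕ} {mlo mhi : ℝ} (hmlo : 0 < mlo)
    {A : Matrix (Fin d) (Fin d) ℝ} (h : Between mlo mhi A) : A.PosDef := by
  have h1 : A.PosSemidef := by
    refine Matrix.PosSemidef.of_dotProduct_mulVec_nonneg (isHermitian_of_sub_smul_one h.lower)
      fun u => ?_
    exact (mul_nonneg hmlo.le (dotProduct_self_star_nonneg u)).trans
      (le_quad_of_posSemidef h.lower u)
  exact h1.posDef_iff_det_ne_zero.2
    (lt_of_lt_of_le (pow_pos hmlo d) (h.pow_le_det hmlo.le)).ne'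

/-- The inequality of arithmetic and geometric means for the eigenvalues. -/
lemma det_le_pow_of_trace_le {d : ℕ} (hd : 1 ≤ d) {G : Matrix (Fin d) (Fin d) ℝ}
    (hG : G.PosSemidef) {Y : ℝ} (h : G.trace ≤ d * Y) : G.det ≤ Y ^ d := by
  have hd' : (d : ℝ) ≠ 0 := by positivity
  have hnn := hG.eigenvalues_nonneg
  have h1 := Real.geom_mean_le_arith_mean_weighted Finset.univ (fun _ : Fin d => (d : ℝ)⁻¹)
    hG.isHermitian.eigenvalues (fun _ _ => by positivity) (by simp [hd']) fun i _ => hnn i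
  rw [hG.isHermitian.det_eq_prod_eigenvalues]
  rw [hG.isHermitian.trace_eq_sum_eigenvalues] at h
  simp only [RCLike.ofReal_real_eq_id, id_eq] at h ⊢
  rw [← Finset.mul_sum] at h1
  have h2 : (d : ℝ)⁻¹ * ∑ i, hG.isHermitian.eigenvalues i ≤ Y := by
    rw [inv_mul_le_iff₀ (by positivity)]
    exact h
  calc ∏ i, hG.isHermitian.eigenvalues i
      = (∏ i, hG.isHermitian.eigenvalues i ^ (d : ℝ)⁻¹) ^ d := by
        rw [← Finset.prod_pow]
        refine Finset.prod_congr rfl fun i _ => ?_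
        rw [← Real.rpow_natCast, ← Real.rpow_mul (hnn i), inv_mul_cancel₀ hd', Real.rpow_one]
    _ ≤ Y ^ d := pow_le_pow_left₀ (Finset.prod_nonneg fun i _ => Real.rpow_nonneg (hnn i) _)
        (h1.trans h2) d

lemma trace_sq_le_frobNorm_sq {d : ℕ} (S : Matrix (Fin d) (Fin d) ℝ) :
    S.trace ^ 2 ≤ d * frobNorm S ^ 2 := by
  have h0 : frobNorm S ^ 2 = ∑ i, ∑ j, S i j ^ 2 :=
    Real.sq_sqrt (Finset.sum_nonneg fun i _ => Finset.sum_nonneg fun j _ => sq_nonneg (S i j))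
  rw [h0]
  have h1 := sq_sum_le_card_mul_sum_sq (s := Finset.univ) (f := fun i => S i i)
  rw [Finset.card_univ, Fintype.card_fin] at h1
  refine h1.trans (mul_le_mul_of_nonneg_left (Finset.sum_le_sum fun i _ => ?_) (by positivity))
  exact Finset.single_le_sum (f := fun j => S i j ^ 2) (fun j _ => sq_nonneg _) (Finset.mem_univ i)

lemma frobNorm_eq_norm {d : ℕ} (S : Matrix (Fin d) (Fin d) ℝ) :
    frobNorm S = ‖(WithLp.toLp 2 fun q : Fin d × Fin d => S q.1 q.2)‖ := by
  rw [frobNorm, EuclideanSpace.norm_eq, Fintype.sum_prod_type]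
  simp

lemma frobNorm_nonneg {d : ℕ} (S : Matrix (Fin d) (Fin d) ℝ) : 0 ≤ frobNorm S :=
  Real.sqrt_nonneg _

lemma frobNorm_le_add {d : ℕ} (S R : Matrix (Fin d) (Fin d) ℝ) :
    frobNorm S ≤ frobNorm (S - R) + frobNorm R := by
  simp only [frobNorm_eq_norm]
  refine le_trans (le_of_eq ?_) (norm_add_le _ _)
  congr 1
  ext q
  simp

lemma frobNorm_smul_one {d : ℕ} (γ : ℝ) :
    frobNorm (γ • (1 : Matrix (Fin d) (Fin d) ℝ)) = Real.sqrt (γ ^ 2 * d) := by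
  rw [frobNorm]
  congr 1
  simp [Matrix.one_apply, mul_comm]

/-! ### The reference element -/

lemma edgeMatrix_gram {d : ℕ} {ξ : Fin (d + 1) → Pt d} {ℓ : ℝ}
    (h : ∀ i j, i ≠ j → dist (ξ i) (ξ j) = ℓ) :
    (edgeMatrix ξ).transpose * edgeMatrix ξ =
      (ℓ ^ 2 / 2) • (1 + Matrix.of fun _ _ : Fin d => (1 : ℝ)) := by
  ext i j
  have h1 : ((edgeMatrix ξ).transpose * edgeMatrix ξ) i j =
      inner ℝ (ξ i.succ - ξ 0) (ξ j.succ - ξ 0) := by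
    rw [inner_eq_sum, Matrix.mul_apply]
    rfl
  have hi : ‖ξ i.succ - ξ 0‖ = ℓ := by rw [← dist_eq_norm]; exact h _ _ (Fin.succ_ne_zero i)
  have hj : ‖ξ j.succ - ξ 0‖ = ℓ := by rw [← dist_eq_norm]; exact h _ _ (Fin.succ_ne_zero j)
  rw [h1]
  by_cases hij : i = j
  · subst hij
    rw [real_inner_self_eq_norm_sq, hi]
    simp
    ring
  · have hk : ‖ξ i.succ - ξ j.succ‖ = ℓ := by
      rw [← dist_eq_norm]
      exact h _ _ fun h' => hij (Fin.succ_injective d h')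
    have h2 := norm_sub_sq_real (ξ i.succ - ξ 0) (ξ j.succ - ξ 0)
    rw [sub_sub_sub_cancel_right, hi, hj, hk] at h2
    simp [hij]
    linarith

lemma det_one_add_ones (d : ℕ) :
    (1 + Matrix.of fun _ _ : Fin d => (1 : ℝ)).det = d + 1 := by
  have h1 : (Matrix.of fun _ _ : Fin d => (1 : ℝ)) =
      Matrix.replicateCol Unit (fun _ => (1 : ℝ)) *
        Matrix.replicateRow Unit (fun _ => (1 : ℝ)) := by
    ext i j
    simp [Matrix.mul_apply]
  rw [h1, Matrix.det_one_add_replicateCol_mul_replicateRow]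
  simp [dotProduct, add_comm]

/-- The Gram matrix of the reference element is `h (I + 𝟙𝟙ᵀ)` with `hᵈ (d + 1) = (d!)²`. -/
lemma IsReferenceElement.gram {d : ℕ} {ξ : Fin (d + 1) → Pt d} (hξ : IsReferenceElement ξ) :
    ∃ h : ℝ, 0 ≤ h ∧ h ^ d * (d + 1) = (d.factorial : ℝ) ^ 2 ∧
      (edgeMatrix ξ).transpose * edgeMatrix ξ =
        h • (1 + Matrix.of fun _ _ : Fin d => (1 : ℝ)) := by
  obtain ⟨ℓ, hℓ⟩ := hξ.equilateral
  refine ⟨ℓ ^ 2 / 2, by positivity, ?_, edgeMatrix_gram hℓ⟩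
  have h1 := congrArg Matrix.det (edgeMatrix_gram hℓ)
  rw [Matrix.det_mul, Matrix.det_transpose, Matrix.det_smul, det_one_add_ones,
    Fintype.card_fin] at h1
  have h2 := hξ.unitary
  have h3 : (d.factorial : ℝ) ≠ 0 := by positivity
  rw [simplexVolume_eq, det_hmat, div_eq_iff h3, one_mul] at h2
  rw [← h1, ← h2, sq_abs, sq]

lemma IsReferenceElement.det_ne_zero {d : ℕ} {ξ : Fin (d + 1) → Pt d}
    (hξ : IsReferenceElement ξ) : (edgeMatrix ξ).det ≠ 0 := by
  intro h
  have h2 := hξ.unitary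
  rw [simplexVolume_eq, det_hmat, h] at h2
  simp at h2

/-! ### Element estimates -/

/-- The matrix `E⁻¹ A⁻¹ E⁻ᵀ` of inner products, in the dual metric, of the gradients of the
barycentric coordinates. -/
def gradGram {d : ℕ} (A : Matrix (Fin d) (Fin d) ℝ) (v : Fin (d + 1) → Pt d) :
    Matrix (Fin d) (Fin d) ℝ :=
  (edgeMatrix v)⁻¹ * A⁻¹ * (edgeMatrix v)⁻¹.transpose

/-- Coefficients of the gradient of the `j`-th barycentric coordinate. -/
def gradCoeff {d : ℕ} (j : Fin (d + 1)) : Fin d → ℝ :=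
  (Fin.cons (fun _ => -1) fun i => Pi.single i 1 : Fin (d + 1) → Fin d → ℝ) j

/-- The squared length, in the dual metric, of the gradient of the `j`-th barycentric
coordinate. -/
def gradSq {d : ℕ} (A : Matrix (Fin d) (Fin d) ℝ) (v : Fin (d + 1) → Pt d) (j : Fin (d + 1)) : ℝ :=
  gradCoeff j ⬝ᵥ (gradGram A v).mulVec (gradCoeff j)

lemma gradSq_succ {d : ℕ} (A : Matrix (Fin d) (Fin d) ℝ) (v : Fin (d + 1) → Pt d) (i : Fin d) :
    gradSq A v i.succ = gradGram A v i i := by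
  simp [gradSq, gradCoeff]

lemma gradSq_zero {d : ℕ} (A : Matrix (Fin d) (Fin d) ℝ) (v : Fin (d + 1) → Pt d) :
    gradSq A v 0 = ∑ i, ∑ j, gradGram A v i j := by
  simp [gradSq, gradCoeff, sum_quad_eq]

lemma posSemidef_gradGram {d : ℕ} {A : Matrix (Fin d) (Fin d) ℝ} (hA : A.PosDef)
    (v : Fin (d + 1) → Pt d) : (gradGram A v).PosSemidef := by
  have := hA.inv.posSemidef.mul_mul_conjTranspose_same (edgeMatrix v)⁻¹
  rwa [Matrix.conjTranspose_eq_transpose_of_trivial] at this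

lemma gradSq_nonneg {d : ℕ} {A : Matrix (Fin d) (Fin d) ℝ} (hA : A.PosDef)
    (v : Fin (d + 1) → Pt d) (j : Fin (d + 1)) : 0 ≤ gradSq A v j := by
  have := (posSemidef_gradGram hA v).dotProduct_mulVec_nonneg (gradCoeff j)
  simpa [gradSq] using this

lemma trace_gradGram {d : ℕ} (A : Matrix (Fin d) (Fin d) ℝ) (v : Fin (d + 1) → Pt d) :
    (gradGram A v).trace = ∑ i : Fin d, gradSq A v i.succ := by
  simp [Matrix.trace, gradSq_succ]

/-- The trace of `(F')⁻¹ A⁻¹ (F')⁻ᵀ` in terms of the gradients of the barycentric coordinates. -/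
lemma trace_jacobian {d : ℕ} {ξ v : Fin (d + 1) → Pt d} {h : ℝ}
    (hξ : (edgeMatrix ξ).det ≠ 0)
    (hgram : (edgeMatrix ξ).transpose * edgeMatrix ξ =
        h • (1 + Matrix.of fun _ _ : Fin d => (1 : ℝ)))
    (A : Matrix (Fin d) (Fin d) ℝ) :
    ((jacobian ξ v)⁻¹ * A⁻¹ * ((jacobian ξ v)⁻¹).transpose).trace = h * ∑ j, gradSq A v j := by
  have h1 : (jacobian ξ v)⁻¹ = edgeMatrix ξ * (edgeMatrix v)⁻¹ := by
    rw [jacobian, Matrix.mul_inv_rev, Matrix.nonsing_inv_nonsing_inv _ (isUnit_iff_ne_zero.2 hξ)]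
  have h2 : (jacobian ξ v)⁻¹ * A⁻¹ * ((jacobian ξ v)⁻¹).transpose =
      edgeMatrix ξ * (gradGram A v * (edgeMatrix ξ).transpose) := by
    rw [h1, Matrix.transpose_mul, gradGram]
    simp only [Matrix.mul_assoc]
  -- Cyclicity brings in the Gram matrix `h (I + 𝟙𝟙ᵀ)` of the reference element. The identity yields
  -- the gradients of the coordinates `1, …, d`; the matrix of ones yields the sum of all entries,
  -- which is the zeroth gradient squared.
  rw [h2, Matrix.trace_mul_comm, Matrix.mul_assoc, hgram, Matrix.mul_smul, Matrix.trace_smul,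
    Matrix.mul_add, Matrix.mul_one, Matrix.trace_add, trace_gradGram, Fin.sum_univ_succ,
    gradSq_zero, smul_eq_mul, add_comm]
  congr 2
  simp [Matrix.trace, Matrix.mul_apply]

/-- The barycentric coordinates of the vertices, without the zeroth one. -/
def vertexCoord {d : ℕ} (l : Fin (d + 1)) : Fin d → ℝ :=
  (Fin.cons 0 fun i => Pi.single i 1 : Fin (d + 1) → Fin d → ℝ) l

lemma edgeMatrix_inv_mulVec {d : ℕ} {v : Fin (d + 1) → Pt d} (hv : (edgeMatrix v).det ≠ 0)
    (l : Fin (d + 1)) :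
    (edgeMatrix v)⁻¹.mulVec (v l - v 0).ofLp = vertexCoord l := by
  have h1 : (edgeMatrix v).mulVec (vertexCoord l) = (v l - v 0).ofLp := by
    refine Fin.cases ?_ (fun i => ?_) l
    · simp [vertexCoord]
    · simp only [vertexCoord, Fin.cons_succ, Matrix.mulVec_single_one]
      ext m
      simp [edgeMatrix]
  rw [← h1, Matrix.mulVec_mulVec, Matrix.nonsing_inv_mul _ (isUnit_iff_ne_zero.2 hv),
    Matrix.one_mulVec]

lemma gradCoeff_dotProduct {d : ℕ} {l j : Fin (d + 1)} (h : l ≠ j) :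
    gradCoeff j ⬝ᵥ (vertexCoord j - vertexCoord l : Fin d → ℝ) = 1 := by
  induction j using Fin.cases with
  | zero =>
    induction l using Fin.cases with
    | zero => exact absurd rfl h
    | succ l => simp [gradCoeff, vertexCoord, dotProduct]
  | succ j =>
    induction l using Fin.cases with
    | zero => simp [gradCoeff, vertexCoord]
    | succ l =>
      have : j ≠ l := fun h' => h (by rw [h'])
      simp [gradCoeff, vertexCoord, this]

/-- The `j`-th barycentric coordinate is affine, equal to one at its vertex and zero on the hull of
the others; its drop between them is therefore one. -/
lemma gradCoeff_dotProduct_of_mem {d : ℕ} {v : Fin (d + 1) → Pt d}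
    (hv : (edgeMatrix v).det ≠ 0) (j : Fin (d + 1)) {z : Pt d}
    (hz : z ∈ affineSpan ℝ (v '' {l | l ≠ j})) :
    gradCoeff j ⬝ᵥ (edgeMatrix v)⁻¹.mulVec (v j - z).ofLp = 1 := by
  have hlin : ∀ z, gradCoeff j ⬝ᵥ (edgeMatrix v)⁻¹.mulVec (v j - z).ofLp =
      gradCoeff j ⬝ᵥ vertexCoord j - gradCoeff j ⬝ᵥ (edgeMatrix v)⁻¹.mulVec (z - v 0).ofLp := by
    intro z
    rw [← edgeMatrix_inv_mulVec hv j, ← dotProduct_sub, ← Matrix.mulVec_sub]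
    congr 2
    ext i
    simp
  refine affineSpan_induction hz ?_ ?_
  · rintro _ ⟨l, hl, rfl⟩
    rw [hlin, edgeMatrix_inv_mulVec hv, ← dotProduct_sub]
    exact gradCoeff_dotProduct hl
  · intro c a b w ha hb hw
    rw [hlin] at ha hb hw ⊢
    have : ((c • (a -ᵥ b) +ᵥ w) - v 0).ofLp =
        c • ((a - v 0).ofLp - (b - v 0).ofLp) + (w - v 0).ofLp := by
      ext i
      simp
      ring
    rw [this, Matrix.mulVec_add, Matrix.mulVec_smul, Matrix.mulVec_sub, dotProduct_add,
      dotProduct_smul, dotProduct_sub, smul_eq_mul,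
      show gradCoeff j ⬝ᵥ (edgeMatrix v)⁻¹.mulVec (a - v 0).ofLp =
        gradCoeff j ⬝ᵥ (edgeMatrix v)⁻¹.mulVec (b - v 0).ofLp by linarith, sub_self, mul_zero,
      zero_add]
    exact hw

/-- A Cauchy-Schwarz inequality between a metric and its dual. -/
lemma inv_le_quad {d : ℕ} {A : Matrix (Fin d) (Fin d) ℝ} (hA : A.PosDef) {g u : Fin d → ℝ}
    (hgu : g ⬝ᵥ u = 1) {Y : ℝ} (hY : 0 < Y) (hg : g ⬝ᵥ A⁻¹.mulVec g ≤ Y) :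
    Y⁻¹ ≤ u ⬝ᵥ A.mulVec u := by
  have hAw : A.mulVec (A⁻¹.mulVec g) = g := by
    rw [Matrix.mulVec_mulVec, Matrix.mul_nonsing_inv _ (isUnit_iff_ne_zero.2 hA.det_pos.ne'),
      Matrix.one_mulVec]
  -- Expanding gives `uᵀAu ≥ 2 Y⁻¹ - Y⁻² gᵀA⁻¹g`, which is at least `Y⁻¹`.
  have h1 := hA.posSemidef.dotProduct_mulVec_nonneg (u - Y⁻¹ • A⁻¹.mulVec g)
  have hsymm : A⁻¹.mulVec g ⬝ᵥ A.mulVec u = g ⬝ᵥ u := by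
    rw [Matrix.dotProduct_mulVec, ← Matrix.mulVec_transpose,
      show A.transpose = A by simpa using hA.isHermitian.eq, hAw]
  simp only [star_trivial, Matrix.mulVec_sub, Matrix.mulVec_smul, hAw, sub_dotProduct,
    dotProduct_sub, smul_dotProduct, dotProduct_smul, smul_eq_mul, hsymm] at h1
  rw [dotProduct_comm u g, hgu, dotProduct_comm (A⁻¹.mulVec g) g] at h1
  have h2 : Y⁻¹ * (Y⁻¹ * g ⬝ᵥ A⁻¹.mulVec g) ≤ Y⁻¹ := by
    calc Y⁻¹ * (Y⁻¹ * g ⬝ᵥ A⁻¹.mulVec g) ≤ Y⁻¹ * (Y⁻¹ * Y) := by gcongr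
      _ = Y⁻¹ := by rw [inv_mul_cancel₀ hY.ne', mul_one]
  linarith

/-- A function with gradient of dual length at most `√Y` needs a distance of at least `1/√Y` to drop
by one. -/
lemma inv_sqrt_le_altitude {d : ℕ} (hd : 1 ≤ d) {A : Matrix (Fin d) (Fin d) ℝ} (hA : A.PosDef)
    {v : Fin (d + 1) → Pt d} (hv : (edgeMatrix v).det ≠ 0) {Y : ℝ} (hY : 0 < Y)
    (j : Fin (d + 1)) (h : gradSq A v j ≤ Y) : (Real.sqrt Y)⁻¹ ≤ altitude A v j := by
  have : Nontrivial (Fin (d + 1)) := Fin.nontrivial_iff_two_le.2 (by omega)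
  obtain ⟨l, hl⟩ := exists_ne j
  -- The opposite facet is nonempty because `d ≥ 1`; the infimum over an empty set would be zero.
  refine le_csInf ⟨_, v l, subset_affineSpan ℝ _ ⟨l, hl, rfl⟩, rfl⟩ ?_
  rintro _ ⟨z, hz, rfl⟩
  have h1 := gradCoeff_dotProduct_of_mem hv j hz
  rw [Matrix.dotProduct_mulVec, ← Matrix.mulVec_transpose] at h1
  have h2 : (edgeMatrix v)⁻¹.transpose.mulVec (gradCoeff j) ⬝ᵥ
      A⁻¹.mulVec ((edgeMatrix v)⁻¹.transpose.mulVec (gradCoeff j)) = gradSq A v j := by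
    rw [gradSq, gradGram, ← Matrix.mulVec_mulVec, ← Matrix.mulVec_mulVec,
      Matrix.dotProduct_mulVec (gradCoeff j), ← Matrix.mulVec_transpose]
  have h3 := inv_le_quad hA h1 hY (h2.le.trans h)
  simp only [metricLength]
  rw [← Real.sqrt_inv]
  refine Real.sqrt_le_sqrt ?_
  rw [sum_quad_eq] at h3
  exact h3

/-- The Gram determinant of the gradients is the reciprocal of `det E² · det A`, and is at most
`Y^d` by its trace. Short gradients thus force a large volume. -/
lemma one_le_det_mul {d : ℕ} (hd : 1 ≤ d) {A : Matrix (Fin d) (Fin d) ℝ} (hA : A.PosDef)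
    {v : Fin (d + 1) → Pt d} (hv : (edgeMatrix v).det ≠ 0) {Y : ℝ}
    (h : ∀ j, gradSq A v j ≤ Y) : 1 ≤ (edgeMatrix v).det ^ 2 * A.det * Y ^ d := by
  have h1 : (gradGram A v).det ≤ Y ^ d := by
    refine det_le_pow_of_trace_le hd (posSemidef_gradGram hA v) ?_
    rw [trace_gradGram]
    calc ∑ i : Fin d, gradSq A v i.succ ≤ ∑ _i : Fin d, Y := Finset.sum_le_sum fun i _ => h _
      _ = d * Y := by simp
  have h2 : (edgeMatrix v).det ^ 2 * A.det * (gradGram A v).det = 1 := by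
    rw [gradGram, Matrix.det_mul, Matrix.det_mul, Matrix.det_transpose, Matrix.det_nonsing_inv,
      Matrix.det_nonsing_inv, Ring.inverse_eq_inv']
    have := hA.det_pos.ne'
    field_simp
  rw [← h2]
  exact mul_le_mul_of_nonneg_left h1 (mul_nonneg (sq_nonneg _) hA.det_pos.le)

lemma two_rpow_mul_rpow_le {a b c q : ℝ} (ha : 0 ≤ a) (hb : 0 ≤ b) (hc : 0 ≤ c) (hq : 1 ≤ q)
    (h : a ≤ b + c) : 2 ^ (1 - q) * a ^ q ≤ b ^ q + c ^ q := by
  have h1 : a ^ q ≤ 2 ^ (q - 1) * (b ^ q + c ^ q) := by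
    refine (Real.rpow_le_rpow ha h (by linarith)).trans ?_
    lift b to NNReal using hb
    lift c to NNReal using hc
    exact_mod_cast NNReal.rpow_add_le_mul_rpow_add_rpow b c hq
  have h2 : (2 : ℝ) ^ (1 - q) * 2 ^ (q - 1) = 1 := by
    rw [← Real.rpow_add two_pos]
    simp
  calc 2 ^ (1 - q) * a ^ q ≤ 2 ^ (1 - q) * (2 ^ (q - 1) * (b ^ q + c ^ q)) := by gcongr
    _ = b ^ q + c ^ q := by rw [← mul_assoc, h2, one_mul]

lemma sqrt_pow_eq_rpow {m : ℝ} (hm : 0 ≤ m) (d : ℕ) :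
    Real.sqrt (m ^ d) = m ^ ((d : ℝ) / 2) := by
  rw [Real.sqrt_eq_rpow, ← Real.rpow_natCast, ← Real.rpow_mul hm]
  congr 1
  ring

/-- The matrix whose deviation from a multiple of the identity is measured by the functional. -/
def shapeMatrix {d : ℕ} (ξ v : Fin (d + 1) → Pt d) (A : Matrix (Fin d) (Fin d) ℝ) :
    Matrix (Fin d) (Fin d) ℝ :=
  (jacobian ξ v)⁻¹ * A⁻¹ * ((jacobian ξ v)⁻¹).transpose

lemma simplexVolume_nonneg {d : ℕ} (v : Fin (d + 1) → Pt d) : 0 ≤ simplexVolume v :=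
  measureReal_nonneg

/-- Coercivity of the functional. -/
lemma coercivity {d N Nv : ℕ} {mlo mhi : ℝ} (hmlo : 0 < mlo)
    {M : Pt d → Matrix (Fin d) (Fin d) ℝ} (ξ : Fin (d + 1) → Pt d) {p : ℝ} (hp : 1 ≤ p)
    {conn : Connectivity d N Nv} {x : Config d Nv}
    (hM : ∀ k, Between mlo mhi (avgMetric M (elem conn x k))) (σ : ℝ) (k : Fin N) :
    mlo ^ ((d : ℝ) / 2) * 2 ^ (1 - 2 * p) * simplexVolume (elem conn x k) *
        frobNorm (shapeMatrix ξ (elem conn x k) (avgMetric M (elem conn x k))) ^ (2 * p) ≤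
      beta d N p mlo σ * ∑ l, simplexVolume (elem conn x l) + energy M ξ p conn σ x := by
  set γ : ℝ := (σ / N) ^ (-(2 : ℝ) / d) with hγ
  set S : Fin N → Matrix (Fin d) (Fin d) ℝ := fun l =>
    shapeMatrix ξ (elem conn x l) (avgMetric M (elem conn x l)) with hS
  have hdet : ∀ l, mlo ^ ((d : ℝ) / 2) ≤ Real.sqrt (avgMetric M (elem conn x l)).det := fun l => by
    rw [← sqrt_pow_eq_rpow hmlo.le]
    exact Real.sqrt_le_sqrt ((hM l).pow_le_det hmlo.le)
  have hone : frobNorm (γ • (1 : Matrix (Fin d) (Fin d) ℝ)) ^ (2 * p) = (γ ^ 2 * d) ^ p := by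
    rw [frobNorm_smul_one, Real.sqrt_eq_rpow, ← Real.rpow_mul (by positivity)]
    congr 1
    ring
  have hterm : ∀ l, mlo ^ ((d : ℝ) / 2) * 2 ^ (1 - 2 * p) * simplexVolume (elem conn x l) *
      frobNorm (S l) ^ (2 * p) ≤ beta d N p mlo σ * simplexVolume (elem conn x l) +
        simplexVolume (elem conn x l) * Real.sqrt (avgMetric M (elem conn x l)).det *
          frobNorm (S l - γ • (1 : Matrix (Fin d) (Fin d) ℝ)) ^ (2 * p) := by
    intro l
    have h1 := two_rpow_mul_rpow_le (q := 2 * p) (frobNorm_nonneg (S l)) (frobNorm_nonneg _)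
      (frobNorm_nonneg _) (by linarith)
      (frobNorm_le_add (S l) (γ • (1 : Matrix (Fin d) (Fin d) ℝ)))
    rw [hone] at h1
    have hv := simplexVolume_nonneg (elem conn x l)
    have hf := Real.rpow_nonneg
      (frobNorm_nonneg (S l - γ • (1 : Matrix (Fin d) (Fin d) ℝ))) (2 * p)
    have hm : 0 ≤ mlo ^ ((d : ℝ) / 2) := by positivity
    have hβ : beta d N p mlo σ = mlo ^ ((d : ℝ) / 2) * (γ ^ 2 * d) ^ p := rfl
    rw [hβ]
    calc mlo ^ ((d : ℝ) / 2) * 2 ^ (1 - 2 * p) * simplexVolume (elem conn x l) *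
          frobNorm (S l) ^ (2 * p)
        = mlo ^ ((d : ℝ) / 2) * simplexVolume (elem conn x l) *
          (2 ^ (1 - 2 * p) * frobNorm (S l) ^ (2 * p)) := by ring
      _ ≤ mlo ^ ((d : ℝ) / 2) * simplexVolume (elem conn x l) *
          (frobNorm (S l - γ • (1 : Matrix (Fin d) (Fin d) ℝ)) ^ (2 * p) + (γ ^ 2 * d) ^ p) := by
          gcongr
      _ = mlo ^ ((d : ℝ) / 2) * (γ ^ 2 * d) ^ p * simplexVolume (elem conn x l) +
          simplexVolume (elem conn x l) * mlo ^ ((d : ℝ) / 2) *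
            frobNorm (S l - γ • (1 : Matrix (Fin d) (Fin d) ℝ)) ^ (2 * p) := by ring
      _ ≤ _ := by
          gcongr
          exact hdet l
  have henergy : energy M ξ p conn σ x = ∑ l, simplexVolume (elem conn x l) *
      Real.sqrt (avgMetric M (elem conn x l)).det *
        frobNorm (S l - γ • (1 : Matrix (Fin d) (Fin d) ℝ)) ^ (2 * p) := rfl
  rw [henergy, Finset.mul_sum, ← Finset.sum_add_distrib]
  refine (Finset.single_le_sum (f := fun l => mlo ^ ((d : ℝ) / 2) * 2 ^ (1 - 2 * p) *
    simplexVolume (elem conn x l) * frobNorm (S l) ^ (2 * p)) (fun l _ => ?_)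
    (Finset.mem_univ k)).trans (Finset.sum_le_sum fun l _ => hterm l)
  have hv := simplexVolume_nonneg (elem conn x l)
  have hf := Real.rpow_nonneg (frobNorm_nonneg (S l)) (2 * p)
  positivity

/-- A multiple of each squared gradient of a barycentric coordinate that bounds the sum of all of
them from below: in one dimension both gradients have the same length. -/
def gradMult (d : ℕ) : ℝ := if d = 1 then 2 else 1

lemma gradMult_mul_le_sum {d : ℕ} {A : Matrix (Fin d) (Fin d) ℝ} (hA : A.PosDef)
    (v : Fin (d + 1) → Pt d) (j : Fin (d + 1)) :
    gradMult d * gradSq A v j ≤ ∑ l, gradSq A v l := by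
  by_cases hd : d = 1
  · subst hd
    have h1 : gradSq A v 0 = gradSq A v 1 := by
      rw [gradSq_zero, show (1 : Fin 2) = Fin.succ 0 from rfl, gradSq_succ]
      simp
    have h2 : gradSq A v j = gradSq A v 1 := by
      fin_cases j
      · exact h1
      · rfl
    rw [Fin.sum_univ_two, h1, h2, gradMult, if_pos rfl, two_mul]
  · rw [gradMult, if_neg hd, one_mul]
    exact Finset.single_le_sum (fun l _ => gradSq_nonneg hA v l) (Finset.mem_univ j)

lemma gradMult_pos (d : ℕ) : 0 < gradMult d := by
  rw [gradMult]
  split_ifs <;> norm_num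

/-- Lower bounds for the minimum altitude and the volume of an element whose contribution to the
functional is bounded. -/
theorem element_lower_bound {d : ℕ} (hd : 1 ≤ d) {mlo mhi : ℝ} (hmlo : 0 < mlo) (hmhi : 0 < mhi)
    {A : Matrix (Fin d) (Fin d) ℝ} (hA : Between mlo mhi A) {ξ v : Fin (d + 1) → Pt d} {h : ℝ}
    (hξ : (edgeMatrix ξ).det ≠ 0) (hh : 0 ≤ h)
    (hgram : (edgeMatrix ξ).transpose * edgeMatrix ξ =
        h • (1 + Matrix.of fun _ _ : Fin d => (1 : ℝ)))
    (hv : AffineIndependent ℝ v) {p Q : ℝ} (hp : 1 ≤ p)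
    (hQ : mlo ^ ((d : ℝ) / 2) * 2 ^ (1 - 2 * p) * simplexVolume v *
      frobNorm (shapeMatrix ξ v A) ^ (2 * p) ≤ Q) :
    ∃ ρ : ℝ, 0 < ρ ∧ ρ ≤ minAltitude A v ∧
      ρ ^ d / ((d.factorial : ℝ) * mhi ^ ((d : ℝ) / 2)) ≤ simplexVolume v ∧
      mlo ^ ((d : ℝ) / 2) * 2 ^ (1 - 2 * p) * (gradMult d * h / Real.sqrt d) ^ (2 * p) /
        ((d.factorial : ℝ) * mhi ^ ((d : ℝ) / 2)) ≤ Q * ρ ^ (4 * p - d) := by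
  have hpd := hA.posDef hmlo
  have hdet : (edgeMatrix v).det ≠ 0 := by
    rw [← det_hmat]
    exact (affineIndependent_iff_det_hmat v).1 hv
  -- The longest gradient belongs to the smallest altitude; its reciprocal length is the witness
  -- `ρ`.
  obtain ⟨j, hj⟩ := Finite.exists_max (gradSq A v)
  set Y := gradSq A v j with hYdef
  have hY1 := one_le_det_mul hd hpd hdet hj
  have hY0 : 0 < Y := by
    refine lt_of_le_of_ne (gradSq_nonneg hpd v j) fun h0 => ?_
    rw [← h0, zero_pow (by omega), mul_zero] at hY1
    linarith
  have hsY : 0 < Real.sqrt Y := Real.sqrt_pos.2 hY0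
  have hfac : (0 : ℝ) < d.factorial := by positivity
  have hmp : 0 < mhi ^ ((d : ℝ) / 2) := by positivity
  have hvol : (Real.sqrt Y)⁻¹ ^ d / ((d.factorial : ℝ) * mhi ^ ((d : ℝ) / 2)) ≤
      simplexVolume v := by
    rw [simplexVolume_eq, det_hmat, div_le_div_iff₀ (by positivity) hfac, inv_pow,
      inv_mul_le_iff₀ (by positivity)]
    have h1 : 1 ≤ |(edgeMatrix v).det| * Real.sqrt A.det * Real.sqrt Y ^ d := by
      have h2 := Real.one_le_sqrt.2 hY1
      have h3 : Real.sqrt (Y ^ d) = Real.sqrt Y ^ d := by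
        rw [show Y ^ d = (Real.sqrt Y ^ d) ^ 2 by
          rw [← pow_mul, mul_comm, pow_mul, Real.sq_sqrt hY0.le], Real.sqrt_sq (by positivity)]
      rwa [Real.sqrt_mul (mul_nonneg (sq_nonneg _) hpd.det_pos.le), Real.sqrt_mul (sq_nonneg _),
        Real.sqrt_sq_eq_abs, h3] at h2
    have h3 : Real.sqrt A.det ≤ mhi ^ ((d : ℝ) / 2) := by
      rw [← sqrt_pow_eq_rpow hmhi.le]
      exact Real.sqrt_le_sqrt (hA.det_le_pow hmlo.le)
    have h4 : 1 ≤ |(edgeMatrix v).det| * mhi ^ ((d : ℝ) / 2) * Real.sqrt Y ^ d :=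
      h1.trans (by gcongr)
    calc (d.factorial : ℝ) = d.factorial * 1 := (mul_one _).symm
      _ ≤ d.factorial * (|(edgeMatrix v).det| * mhi ^ ((d : ℝ) / 2) * Real.sqrt Y ^ d) := by gcongr
      _ = _ := by ring
  refine ⟨(Real.sqrt Y)⁻¹, inv_pos.2 hsY, le_ciInf fun l =>
    inv_sqrt_le_altitude hd hpd hdet hY0 l (hj l), hvol, ?_⟩
  have hκ := gradMult_pos d
  have hsd : 0 < Real.sqrt d := Real.sqrt_pos.2 (by positivity)
  have hfrob : gradMult d * h / Real.sqrt d * Y ≤ frobNorm (shapeMatrix ξ v A) := by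
    have h1 : h * (gradMult d * Y) ≤ (shapeMatrix ξ v A).trace := by
      rw [shapeMatrix, trace_jacobian hξ hgram]
      exact mul_le_mul_of_nonneg_left (gradMult_mul_le_sum hpd v j) hh
    have h2 : (shapeMatrix ξ v A).trace ≤ Real.sqrt d * frobNorm (shapeMatrix ξ v A) := by
      refine le_of_sq_le_sq ?_ (mul_nonneg hsd.le (frobNorm_nonneg _))
      rw [mul_pow, Real.sq_sqrt (by positivity)]
      exact trace_sq_le_frobNorm_sq _
    rw [div_mul_eq_mul_div, div_le_iff₀ hsd]
    calc gradMult d * h * Y = h * (gradMult d * Y) := by ring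
      _ ≤ _ := h1.trans (h2.trans (le_of_eq (mul_comm _ _)))
  set ρ := (Real.sqrt Y)⁻¹ with hρ
  have hρ0 : 0 < ρ := inv_pos.2 hsY
  have hYρ : Y = ρ ^ (-2 : ℝ) := by
    rw [hρ, Real.inv_rpow hsY.le, Real.rpow_neg hsY.le, inv_inv]
    rw [show (2 : ℝ) = ((2 : ℕ) : ℝ) by norm_num, Real.rpow_natCast, Real.sq_sqrt hY0.le]
  have hc : 0 ≤ gradMult d * h / Real.sqrt d := by positivity
  calc mlo ^ ((d : ℝ) / 2) * 2 ^ (1 - 2 * p) * (gradMult d * h / Real.sqrt d) ^ (2 * p) /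
        ((d.factorial : ℝ) * mhi ^ ((d : ℝ) / 2))
      = mlo ^ ((d : ℝ) / 2) * 2 ^ (1 - 2 * p) *
        (ρ ^ d / ((d.factorial : ℝ) * mhi ^ ((d : ℝ) / 2))) *
        (gradMult d * h / Real.sqrt d * Y) ^ (2 * p) * ρ ^ (4 * p - d) := by
        rw [Real.mul_rpow hc hY0.le, hYρ, ← Real.rpow_mul hρ0.le, ← Real.rpow_natCast ρ d]
        -- The volume scales like `ρ^d` and the shape term like `ρ^{-4p}`; the third factor
        -- compensates.
        have : ρ ^ (d : ℝ) * ρ ^ (-2 * (2 * p)) * ρ ^ (4 * p - d) = 1 := by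
          rw [← Real.rpow_add hρ0, ← Real.rpow_add hρ0]
          ring_nf
          simp
        calc _ = mlo ^ ((d : ℝ) / 2) * 2 ^ (1 - 2 * p) *
              (gradMult d * h / Real.sqrt d) ^ (2 * p) /
              ((d.factorial : ℝ) * mhi ^ ((d : ℝ) / 2)) *
              (ρ ^ (d : ℝ) * ρ ^ (-2 * (2 * p)) * ρ ^ (4 * p - d)) := by rw [this, mul_one]
          _ = _ := by ring
    _ ≤ mlo ^ ((d : ℝ) / 2) * 2 ^ (1 - 2 * p) * simplexVolume v *
        frobNorm (shapeMatrix ξ v A) ^ (2 * p) * ρ ^ (4 * p - d) := by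
        have := simplexVolume_nonneg v
        gcongr
    _ ≤ Q * ρ ^ (4 * p - d) := by gcongr

/-! ### Comparison of the constants -/

/-- After weakening the exponent of `d + 1` to `2p`, the claim becomes `64^p d! ≤ (d⁵ (d+1)²)^p`.
For `d ≥ 4`, `d! ≤ d^d ≤ d^{4p}` and `64 ≤ d (d+1)²`; for `d = 2, 3`, `d! ≤ (d!)^p` leaves a
numerical check. -/
lemma two_rpow_mul_factorial_le {d : ℕ} (hd : 2 ≤ d) {p : ℝ} (hp : 1 ≤ p)
    (hpd : (d : ℝ) < 4 * p) :
    2 ^ (6 * p) * (d.factorial : ℝ) ≤ (d : ℝ) ^ (5 * p) * ((d : ℝ) + 1) ^ (4 * p - 4 * p / d) := by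
  have hd0 : (0 : ℝ) < d := by positivity
  have hd2 : (2 : ℝ) ≤ d := by exact_mod_cast hd
  have h64 : (2 : ℝ) ^ (6 * p) = 64 ^ p := by
    rw [Real.rpow_mul two_pos.le]
    norm_num
  have hexp : ((d : ℝ) + 1) ^ (2 * p) ≤ ((d : ℝ) + 1) ^ (4 * p - 4 * p / d) := by
    refine Real.rpow_le_rpow_of_exponent_le (by linarith) ?_
    have : 4 * p / d ≤ 2 * p := by
      rw [div_le_iff₀ hd0]
      nlinarith
    linarith
  have hsq : ((d : ℝ) + 1) ^ (2 * p) = (((d : ℝ) + 1) ^ 2) ^ p := by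
    rw [Real.rpow_mul (by positivity)]
    norm_cast
  have h5 : (d : ℝ) ^ (5 * p) = ((d : ℝ) ^ 5) ^ p := by
    rw [Real.rpow_mul (by positivity)]
    norm_cast
  have key : 64 ^ p * (d.factorial : ℝ) ≤ ((d : ℝ) ^ 5) ^ p * (((d : ℝ) + 1) ^ 2) ^ p := by
    have hfac1 : (1 : ℝ) ≤ d.factorial := by
      exact_mod_cast Nat.succ_le_of_lt (Nat.factorial_pos d)
    rw [← Real.mul_rpow (by positivity) (by positivity)]
    by_cases h4 : 4 ≤ d
    · have h4' : (4 : ℝ) ≤ d := by exact_mod_cast h4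
      have hf : (d.factorial : ℝ) ≤ ((d : ℝ) ^ 4) ^ p := by
        calc (d.factorial : ℝ) ≤ (d : ℝ) ^ d := by exact_mod_cast Nat.factorial_le_pow d
          _ = (d : ℝ) ^ (d : ℝ) := (Real.rpow_natCast _ _).symm
          _ ≤ (d : ℝ) ^ (4 * p) := Real.rpow_le_rpow_of_exponent_le (by linarith) hpd.le
          _ = ((d : ℝ) ^ 4) ^ p := by
            rw [Real.rpow_mul (by positivity)]
            norm_cast
      calc 64 ^ p * (d.factorial : ℝ) ≤ 64 ^ p * ((d : ℝ) ^ 4) ^ p := by gcongr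
        _ = (64 * (d : ℝ) ^ 4) ^ p := (Real.mul_rpow (by positivity) (by positivity)).symm
        _ ≤ ((d : ℝ) ^ 5 * ((d : ℝ) + 1) ^ 2) ^ p := by
          refine Real.rpow_le_rpow (by positivity) ?_ (by linarith)
          have : (64 : ℝ) ≤ d * (d + 1) ^ 2 := by nlinarith
          calc 64 * (d : ℝ) ^ 4 ≤ (d * (d + 1) ^ 2) * (d : ℝ) ^ 4 := by gcongr
            _ = _ := by ring
    · calc 64 ^ p * (d.factorial : ℝ) ≤ 64 ^ p * (d.factorial : ℝ) ^ p := by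
            gcongr
            calc (d.factorial : ℝ) = (d.factorial : ℝ) ^ (1 : ℝ) := (Real.rpow_one _).symm
              _ ≤ _ := Real.rpow_le_rpow_of_exponent_le hfac1 hp
        _ = (64 * (d.factorial : ℝ)) ^ p := (Real.mul_rpow (by positivity) (by positivity)).symm
        _ ≤ ((d : ℝ) ^ 5 * ((d : ℝ) + 1) ^ 2) ^ p := by
          refine Real.rpow_le_rpow (by positivity) ?_ (by linarith)
          interval_cases d <;> norm_num [Nat.factorial]
  rw [h64, h5]
  refine key.trans ?_
  rw [← hsq]
  gcongr

lemma rpow_of_pow_mul_eq {d : ℕ} (hd : 1 ≤ d) {h : ℝ} (hh : 0 ≤ h)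
    (hpow : h ^ d * (d + 1) = (d.factorial : ℝ) ^ 2) (p : ℝ) :
    h ^ (2 * p) = (d.factorial : ℝ) ^ (4 * p / d) / ((d : ℝ) + 1) ^ (2 * p / d) := by
  have hd0 : (d : ℝ) ≠ 0 := by positivity
  have h1 : h ^ (2 * p) = (h ^ d) ^ (2 * p / d) := by
    rw [← Real.rpow_natCast, ← Real.rpow_mul hh]
    congr 1
    field_simp
  have h2 : h ^ d = (d.factorial : ℝ) ^ 2 / ((d : ℝ) + 1) := by
    rw [eq_div_iff (by positivity), hpow]
  rw [h1, h2, Real.div_rpow (by positivity) (by positivity), ← Real.rpow_natCast,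
    ← Real.rpow_mul (by positivity)]
  congr 2
  push_cast
  ring

/-- The stated constant on the left against the one from `element_lower_bound` on the right, common
factors removed. For `d ≥ 2` the power of `N` is simply bounded by one. For `d = 1` it is needed,
together with the factor two in `gradMult`: at `mhi = 1` the claim reads `2^{4p} N^{-4p} ≤ 1`, which
fails for `N = 1`. -/
lemma constant_comparison {d N : ℕ} (hd : 1 ≤ d) (hN : 1 ≤ N) (hdN : 2 ≤ d ∨ 2 ≤ N) {p : ℝ}
    (hp : 1 ≤ p) (hpd : (d : ℝ) < 4 * p) {mhi : ℝ} (hmhi : 1 ≤ mhi) :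
    2 ^ (6 * p) / (mhi ^ (2 * p) * (d : ℝ) ^ (6 * p) * ((d : ℝ) + 1) ^ (4 * p - 2 * p / d)) *
        (N : ℝ) ^ (-(4 * p / d)) ≤
      gradMult d ^ (2 * p) / ((d : ℝ) ^ p * ((d : ℝ) + 1) ^ (2 * p / d) * d.factorial) := by
  have hd0 : (0 : ℝ) < d := by positivity
  have hm : 1 ≤ mhi ^ (2 * p) := Real.one_le_rpow hmhi (by linarith)
  rcases hd.eq_or_lt with h1 | h1
  · subst h1
    have hN2 : (2 : ℝ) ≤ N := by
      exact_mod_cast hdN.resolve_left (by norm_num)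
    have hNp : (N : ℝ) ^ (-(4 * p)) ≤ 2 ^ (-(4 * p)) :=
      Real.rpow_le_rpow_of_nonpos two_pos hN2 (by linarith)
    simp only [Nat.cast_one, Real.one_rpow, mul_one, div_one, gradMult, if_true, one_mul,
      Nat.factorial_one]
    norm_num
    have e1 : (2 : ℝ) ^ (2 * p) / 2 ^ (2 * p) = 1 := div_self (by positivity)
    rw [e1]
    calc 2 ^ (6 * p) / (mhi ^ (2 * p) * 2 ^ (4 * p - 2 * p)) * (N : ℝ) ^ (-(4 * p))
        ≤ 2 ^ (6 * p) / (1 * 2 ^ (4 * p - 2 * p)) * 2 ^ (-(4 * p)) := by gcongr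
      _ = 1 := by
        rw [one_mul, ← Real.rpow_sub two_pos, ← Real.rpow_add two_pos]
        ring_nf
        simp
  · have h2 : 2 ≤ d := h1
    have key := two_rpow_mul_factorial_le h2 hp hpd
    have hNp : (N : ℝ) ^ (-(4 * p / d)) ≤ 1 :=
      Real.rpow_le_one_of_one_le_of_nonpos (by exact_mod_cast hN)
        (neg_nonpos.2 (by positivity))
    rw [gradMult, if_neg (by omega), Real.one_rpow]
    calc 2 ^ (6 * p) / (mhi ^ (2 * p) * (d : ℝ) ^ (6 * p) *
          ((d : ℝ) + 1) ^ (4 * p - 2 * p / d)) * (N : ℝ) ^ (-(4 * p / d))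
        ≤ 2 ^ (6 * p) / (1 * (d : ℝ) ^ (6 * p) * ((d : ℝ) + 1) ^ (4 * p - 2 * p / d)) * 1 := by
          gcongr
      _ ≤ _ := by
        rw [mul_one, one_mul, div_le_div_iff₀ (by positivity) (by positivity), one_mul]
        have e1 : (d : ℝ) ^ (6 * p) = (d : ℝ) ^ (5 * p) * (d : ℝ) ^ p := by
          rw [← Real.rpow_add hd0]
          ring_nf
        have e2 : ((d : ℝ) + 1) ^ (4 * p - 2 * p / d) =
            ((d : ℝ) + 1) ^ (4 * p - 4 * p / d) * ((d : ℝ) + 1) ^ (2 * p / d) := by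
          rw [← Real.rpow_add (by positivity)]
          ring_nf
        rw [e1, e2]
        calc 2 ^ (6 * p) * ((d : ℝ) ^ p * ((d : ℝ) + 1) ^ (2 * p / d) * d.factorial)
            = (2 ^ (6 * p) * d.factorial) * ((d : ℝ) ^ p * ((d : ℝ) + 1) ^ (2 * p / d)) := by ring
          _ ≤ ((d : ℝ) ^ (5 * p) * ((d : ℝ) + 1) ^ (4 * p - 4 * p / d)) *
              ((d : ℝ) ^ p * ((d : ℝ) + 1) ^ (2 * p / d)) := by gcongr
          _ = _ := by ring

lemma C1_mul_le {d N : ℕ} (hd : 1 ≤ d) (hN : 1 ≤ N) (hdN : 2 ≤ d ∨ 2 ≤ N) {p : ℝ}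
    (hp : 1 ≤ p) (hpd : (d : ℝ) < 4 * p) {mlo mhi : ℝ} (hmlo : 0 < mlo) (hmhi : 1 ≤ mhi)
    {h : ℝ} (hh : 0 ≤ h) (hpow : h ^ d * (d + 1) = (d.factorial : ℝ) ^ 2)
    {ρ β w I₀ : ℝ} (hρ : 0 < ρ) (hQ : 0 < β * w + I₀)
    (hc : mlo ^ ((d : ℝ) / 2) * 2 ^ (1 - 2 * p) * (gradMult d * h / Real.sqrt d) ^ (2 * p) /
        ((d.factorial : ℝ) * mhi ^ ((d : ℝ) / 2)) ≤ (β * w + I₀) * ρ ^ (4 * p - d)) :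
    C1 d p (alpha d p mlo mhi) β w I₀ * mhi ^ (-((d : ℝ) / (2 * (4 * p - d)))) *
      (N : ℝ) ^ (-(4 * p / (d * (4 * p - d)))) ≤ ρ := by
  have hd0 : (0 : ℝ) < d := by positivity
  have hN0 : (0 : ℝ) < N := by positivity
  have he : 0 < 4 * p - d := by linarith
  have hm0 : 0 < mhi := by linarith
  have hκ := gradMult_pos d
  set Q := β * w + I₀ with hQdef
  set e := 4 * p - d with hedef
  have hα : 0 < alpha d p mlo mhi := by unfold alpha; positivity
  have hC1 : 0 ≤ 2 ^ (6 * p) * (d.factorial : ℝ) ^ (4 * p / d) * alpha d p mlo mhi /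
      ((d : ℝ) ^ (4 * p) * ((d : ℝ) + 1) ^ (4 * p - 2 * p / d) * Q) := by positivity
  have hC1' : 0 ≤ C1 d p (alpha d p mlo mhi) β w I₀ := Real.rpow_nonneg hC1 _
  rw [← Real.rpow_le_rpow_iff (by positivity) hρ.le he,
    Real.mul_rpow (by positivity) (by positivity), Real.mul_rpow hC1' (by positivity),
    C1, ← hQdef, ← hedef, ← Real.rpow_mul hC1, one_div, inv_mul_cancel₀ he.ne', Real.rpow_one,
    ← Real.rpow_mul hm0.le, ← Real.rpow_mul hN0.le]
  have e1 : -((d : ℝ) / (2 * e)) * e = -((d : ℝ) / 2) := by field_simp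
  have e2 : -(4 * p / (d * e)) * e = -(4 * p / d) := by field_simp
  rw [e1, e2]
  have hshape : (gradMult d * h / Real.sqrt d) ^ (2 * p) =
      gradMult d ^ (2 * p) * ((d.factorial : ℝ) ^ (4 * p / d) / ((d : ℝ) + 1) ^ (2 * p / d)) /
        (d : ℝ) ^ p := by
    rw [Real.div_rpow (by positivity) (by positivity), Real.mul_rpow hκ.le hh,
      rpow_of_pow_mul_eq hd hh hpow, Real.sqrt_eq_rpow, ← Real.rpow_mul hd0.le]
    congr 2
    ring
  have hcomp := constant_comparison hd hN hdN hp hpd hmhi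
  have hfac : (0 : ℝ) < d.factorial := by positivity
  have hd6 : (d : ℝ) ^ (6 * p) = (d : ℝ) ^ (4 * p) * (d : ℝ) ^ (2 * p) := by
    rw [← Real.rpow_add hd0]
    ring_nf
  have hlhs : 2 ^ (6 * p) * (d.factorial : ℝ) ^ (4 * p / d) * alpha d p mlo mhi /
      ((d : ℝ) ^ (4 * p) * ((d : ℝ) + 1) ^ (4 * p - 2 * p / d) * Q) * mhi ^ (-((d : ℝ) / 2)) *
        (N : ℝ) ^ (-(4 * p / d)) =
      (mlo ^ ((d : ℝ) / 2) * 2 ^ (1 - 2 * p) * (d.factorial : ℝ) ^ (4 * p / d) /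
        (mhi ^ ((d : ℝ) / 2) * Q)) *
      (2 ^ (6 * p) / (mhi ^ (2 * p) * (d : ℝ) ^ (6 * p) * ((d : ℝ) + 1) ^ (4 * p - 2 * p / d)) *
        (N : ℝ) ^ (-(4 * p / d))) := by
    rw [alpha, hd6, Real.rpow_neg hm0.le]
    field_simp
  rw [hlhs]
  refine (mul_le_mul_of_nonneg_left hcomp (by positivity)).trans ?_
  rw [hshape, ← div_le_iff₀' hQ] at hc
  refine le_trans (le_of_eq ?_) hc
  field_simp

/-- The stated volume bound is the one that `element_lower_bound` gives when `ρ` is replaced by the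
stated altitude bound. -/
lemma C2_mul_eq {d N : ℕ} (hd : 1 ≤ d) {p : ℝ} {mhi : ℝ} (hmhi : 0 < mhi)
    (α β w I₀ : ℝ) :
    C2 d p α β w I₀ * mhi ^ (-((d : ℝ) ^ 2 / (2 * (4 * p - d))) - (d : ℝ) / 2) *
      (N : ℝ) ^ (-(4 * p / (4 * p - d))) =
    (C1 d p α β w I₀ * mhi ^ (-((d : ℝ) / (2 * (4 * p - d)))) *
      (N : ℝ) ^ (-(4 * p / (d * (4 * p - d))))) ^ d /
        ((d.factorial : ℝ) * mhi ^ ((d : ℝ) / 2)) := by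
  have hd0 : (d : ℝ) ≠ 0 := by positivity
  rw [C2, mul_pow, mul_pow, ← Real.rpow_natCast (mhi ^ _), ← Real.rpow_mul hmhi.le,
    ← Real.rpow_natCast ((N : ℝ) ^ _), ← Real.rpow_mul (Nat.cast_nonneg N),
    Real.rpow_sub hmhi]
  have e1 : -((d : ℝ) / (2 * (4 * p - d))) * d = -((d : ℝ) ^ 2 / (2 * (4 * p - d))) := by ring
  have e2 : -(4 * p / (d * (4 * p - d))) * d = -(4 * p / (4 * p - d)) := by
    rw [neg_mul, div_mul_eq_mul_div, mul_comm (4 * p), mul_div_mul_left _ _ hd0]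
  rw [e1, e2]
  have hfac : (d.factorial : ℝ) ≠ 0 := by positivity
  have := (Real.rpow_pos_of_pos hmhi ((d : ℝ) / 2)).ne'
  field_simp

/-! ### Nonsingular meshes -/

section Mesh

variable {d N Nv : ℕ} {Ω : Set (Pt d)} {conn : Connectivity d N Nv} {x : Config d Nv}

lemma IsPolyhedralDomain.volume_real_pos (hΩ : IsPolyhedralDomain Ω) : 0 < volume.real Ω := by
  rw [measureReal_def, ENNReal.toReal_pos_iff]
  exact ⟨hΩ.isOpen.measure_pos volume hΩ.isConnected.nonempty, hΩ.isBounded.measure_lt_top⟩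

lemma IsNonsingularMesh.sum_simplexVolume (h : IsNonsingularMesh Ω conn x)
    (hΩ : IsPolyhedralDomain Ω) : ∑ k, simplexVolume (elem conn x k) = volume.real Ω := by
  have h1 := congrArg (fun μ : Measure (Pt d) => (μ Set.univ).toReal) h.meshMeasure_eq
  simp only [meshMeasure_apply conn x MeasurableSet.univ, Set.univ_inter,
    Measure.restrict_apply_univ, measure_congr hΩ.closure_ae_eq] at h1
  rw [ENNReal.toReal_sum fun k _ => (isCompact_simplex _).measure_lt_top.ne] at h1
  exact h1

lemma IsNonsingularMesh.avgMetric_between (h : IsNonsingularMesh Ω conn x)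
    (hΩ : IsPolyhedralDomain Ω) {mlo mhi : ℝ} (hmlo : 0 ≤ mlo)
    {M : Pt d → Matrix (Fin d) (Fin d) ℝ} (hM : IsMetricTensor Ω mlo mhi M) (k : Fin N) :
    Between mlo mhi (avgMetric M (elem conn x k)) :=
  MovingMesh.avgMetric_between hΩ hmlo hM (h.nondegenerate k)
    (h.cover ▸ Set.subset_iUnion (fun l => simplex (elem conn x l)) k)

lemma IsNonsingularMesh.le_sigmaH (h : IsNonsingularMesh Ω conn x)
    (hΩ : IsPolyhedralDomain Ω) {mlo mhi : ℝ} (hmlo : 0 ≤ mlo)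
    {M : Pt d → Matrix (Fin d) (Fin d) ℝ} (hM : IsMetricTensor Ω mlo mhi M) :
    mlo ^ ((d : ℝ) / 2) * volume.real Ω ≤ sigmaH M conn x := by
  rw [← h.sum_simplexVolume hΩ, Finset.mul_sum, sigmaH]
  refine Finset.sum_le_sum fun k _ => ?_
  rw [mul_comm, ← sqrt_pow_eq_rpow hmlo]
  exact mul_le_mul_of_nonneg_left
    (Real.sqrt_le_sqrt ((h.avgMetric_between hΩ hmlo hM k).pow_le_det hmlo))
    (simplexVolume_nonneg _)

lemma IsNonsingularMesh.one_le_card (h : IsNonsingularMesh Ω conn x)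
    (hΩ : IsPolyhedralDomain Ω) : 1 ≤ N := by
  by_contra hN
  obtain rfl : N = 0 := by omega
  have h1 := h.cover
  rw [Set.iUnion_of_empty] at h1
  exact (hΩ.isConnected.nonempty.mono subset_closure).ne_empty h1.symm

end Mesh

lemma IsMetricTensor.upper_pos {d : ℕ} (hd : 1 ≤ d) {Ω : Set (Pt d)} (hΩ : Ω.Nonempty)
    {mlo mhi : ℝ} (hmlo : 0 < mlo) {M : Pt d → Matrix (Fin d) (Fin d) ℝ}
    (hM : IsMetricTensor Ω mlo mhi M) : 0 < mhi := by
  obtain ⟨y, hy⟩ := hΩ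
  have h1 := le_quad_of_posSemidef (hM.lower y hy) (Pi.single ⟨0, hd⟩ 1)
  have h2 := quad_le_of_posSemidef (hM.upper y hy) (Pi.single ⟨0, hd⟩ 1)
  have h3 : (Pi.single ⟨0, hd⟩ 1 : Fin d → ℝ) ⬝ᵥ Pi.single ⟨0, hd⟩ 1 = 1 := by simp
  rw [h3] at h1 h2
  linarith

lemma energy_nonneg {d N Nv : ℕ} (M : Pt d → Matrix (Fin d) (Fin d) ℝ) (ξ : Fin (d + 1) → Pt d)
    (p : ℝ) (conn : Connectivity d N Nv) (σ : ℝ) (x : Config d Nv) :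
    0 ≤ energy M ξ p conn σ x :=
  Finset.sum_nonneg fun _ _ => mul_nonneg
    (mul_nonneg (simplexVolume_nonneg _) (Real.sqrt_nonneg _))
    (Real.rpow_nonneg (frobNorm_nonneg _) _)

lemma beta_pos {d N : ℕ} (hd : 1 ≤ d) (hN : 1 ≤ N) (p : ℝ) {mlo σ : ℝ} (hmlo : 0 < mlo)
    (hσ : 0 < σ) : 0 < beta d N p mlo σ := by
  have : (0 : ℝ) < N := by positivity
  have : (0 : ℝ) < d := by positivity
  unfold beta
  positivity

/-- Since `γ` is a nonpositive power of `σ`, a lower bound for `σ` gives an upper bound for `β` that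
is uniform in time. -/
lemma beta_anti {d N : ℕ} (hN : 1 ≤ N) {p : ℝ} (hp : 0 ≤ p) {mlo σ σ' : ℝ} (hmlo : 0 < mlo)
    (hσ : 0 < σ) (h : σ ≤ σ') : beta d N p mlo σ' ≤ beta d N p mlo σ := by
  have hN0 : (0 : ℝ) < N := by positivity
  have h1 : (σ' / N) ^ (-(2 : ℝ) / d) ≤ (σ / N) ^ (-(2 : ℝ) / d) := by
    refine Real.rpow_le_rpow_of_nonpos (by positivity) (by gcongr) ?_
    exact div_nonpos_of_nonpos_of_nonneg (by norm_num) (by positivity)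
  have h2 : 0 ≤ (σ' / N) ^ (-(2 : ℝ) / d) := by
    have : 0 < σ' := by linarith
    positivity
  unfold beta
  gcongr

/-- A trajectory along which the volumes of the elements stay bounded away from zero, as long as
no element has degenerated, never degenerates. -/
lemma nondegenerate_of_lower_bound {d N Nv : ℕ} {conn : Connectivity d N Nv}
    {x : ℝ → Config d Nv} {t : ℝ} (hx : ContinuousOn x (Set.Icc 0 t))
    (h₀ : Nondegenerate conn (x 0)) {δ : ℝ} (hδ : 0 < δ)
    (h : ∀ s ∈ Set.Icc 0 t, (∀ r ∈ Set.Icc 0 s, Nondegenerate conn (x r)) →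
      ∀ k, δ ≤ simplexVolume (elem conn (x s) k)) :
    ∀ s ∈ Set.Icc 0 t, Nondegenerate conn (x s) := by
  by_contra! hcon
  obtain ⟨s₀, hs₀, hdeg⟩ := hcon
  have hcont : ∀ k, ContinuousOn (fun r => (hmat (elem conn (x r) k)).det) (Set.Icc 0 t) :=
    fun k => (continuous_det_hmat_elem conn k).comp_continuousOn hx
  have hiff : ∀ r, ¬ Nondegenerate conn (x r) ↔ ∏ k, (hmat (elem conn (x r) k)).det = 0 := by
    intro r
    rw [Finset.prod_eq_zero_iff, Nondegenerate]
    simp [affineIndependent_iff_det_hmat]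
  have hcompact : IsCompact {r ∈ Set.Icc 0 t | ∏ k, (hmat (elem conn (x r) k)).det = 0} := by
    refine isCompact_Icc.of_isClosed_subset ?_ fun r hr => hr.1
    exact (continuousOn_finsetProd _ fun k _ => hcont k).preimage_isClosed_of_isClosed isClosed_Icc
      isClosed_singleton
  -- The first degenerate time. The volume bound holds at all earlier times and passes to the limit,
  -- contradicting a zero volume.
  obtain ⟨s, ⟨hs, hs0⟩, hmin⟩ := hcompact.exists_isLeast ⟨s₀, hs₀, (hiff s₀).1 hdeg⟩
  have hbefore : ∀ r ∈ Set.Ico 0 s, Nondegenerate conn (x r) := by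
    intro r hr
    by_contra hr'
    exact absurd (hmin ⟨⟨hr.1, hr.2.le.trans hs.2⟩, (hiff r).1 hr'⟩) (not_le.2 hr.2)
  have hspos : 0 < s := by
    refine lt_of_le_of_ne hs.1 fun h0 => ?_
    rw [← h0] at hs0
    exact (hiff 0).2 hs0 h₀
  refine (hiff s).2 hs0 fun k => (affineIndependent_iff_det_hmat _).2 fun hk => ?_
  have hne : (nhdsWithin s (Set.Ico 0 s)).NeBot := by
    rw [← mem_closure_iff_nhdsWithin_neBot, closure_Ico hspos.ne]
    exact ⟨hs.1, le_rfl⟩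
  have hlim : Filter.Tendsto (fun r => simplexVolume (elem conn (x r) k))
      (nhdsWithin s (Set.Ico 0 s)) (nhds (simplexVolume (elem conn (x s) k))) := by
    simp only [simplexVolume_eq]
    have h1 : Filter.Tendsto (fun r => (hmat (elem conn (x r) k)).det)
        (nhdsWithin s (Set.Ico 0 s)) (nhds (hmat (elem conn (x s) k)).det) :=
      (hcont k s hs).mono_left (nhdsWithin_mono s fun r hr => ⟨hr.1, hr.2.le.trans hs.2⟩)
    exact h1.abs.div_const _
  have h2 : δ ≤ simplexVolume (elem conn (x s) k) := by
    refine ge_of_tendsto hlim ?_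
    filter_upwards [self_mem_nhdsWithin] with r hr
    exact h r ⟨hr.1, hr.2.le.trans hs.2⟩
      (fun q hq => hbefore q ⟨hq.1, lt_of_le_of_lt hq.2 hr.2⟩) k
  rw [simplexVolume_eq, hk, abs_zero, zero_div] at h2
  linarith

end

end MovingMesh

/-! ### The main theorem -/

open MovingMesh in
theorem corollary4p1
    {d N Nv : ℕ} (hd : 1 ≤ d)
    -- the domain, the metric tensor and the reference element
    (Ω : Set (Pt d)) (hΩ : IsPolyhedralDomain Ω)
    (mlo mhi : ℝ) (hmlo : 0 < mlo)
    (M : Pt d → Matrix (Fin d) (Fin d) ℝ) (hM : IsMetricTensor Ω mlo mhi M)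
    (ξ : Fin (d + 1) → Pt d) (hξ : IsReferenceElement ξ)
    (p : ℝ) (hp : 1 ≤ p) (hpd : (d : ℝ) < 4 * p)
    -- `σ_h` is the mesh quantity, or is frozen to a positive constant
    (conn : Connectivity d N Nv) (σ : Config d Nv → ℝ)
    (hσ : (∀ y, σ y = sigmaH M conn y) ∨ ∃ c : ℝ, 0 < c ∧ ∀ y, σ y = c)
    -- the mesh equation and its trajectory, from a nonsingular initial mesh
    (τ : ℝ) (hτ : 0 < τ) (P : Fin Nv → ℝ → ℝ) (hP : ∀ i t, 0 < P i t)
    (T : EReal) (x : ℝ → Config d Nv)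
    (h₀ : IsNonsingularMesh Ω conn (x 0))
    (V : Fin Nv → Submodule ℝ (Pt d)) (hV : ∀ i, V i ≤ slideSpace conn (x 0) i)
    (hx : IsTrajectory conn (fun y => energy M ξ p conn (σ y) y) V P τ T x) :
    ∀ t : ℝ, 0 ≤ t → (t : EReal) < T →
      IsNonsingularMesh Ω conn (x t) ∧
      mlo ^ ((d : ℝ) / 2) * MeasureTheory.volume.real Ω ≤ sigmaH M conn (x t) ∧
      (1 ≤ mhi → (2 ≤ d ∨ 2 ≤ N) → ∀ k : Fin N,
        C1 d p (alpha d p mlo mhi) (beta d N p mlo (σ (x t))) (MeasureTheory.volume.real Ω)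
            (energy M ξ p conn (σ (x 0)) (x 0)) *
          mhi ^ (-((d : ℝ) / (2 * (4 * p - d)))) * (N : ℝ) ^ (-(4 * p / (d * (4 * p - d))))
            ≤ minAltitude (avgMetric M (elem conn (x t) k)) (elem conn (x t) k) ∧
        C2 d p (alpha d p mlo mhi) (beta d N p mlo (σ (x t))) (MeasureTheory.volume.real Ω)
            (energy M ξ p conn (σ (x 0)) (x 0)) *
          mhi ^ (-((d : ℝ) ^ 2 / (2 * (4 * p - d))) - (d : ℝ) / 2) *
          (N : ℝ) ^ (-(4 * p / (4 * p - d)))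
            ≤ simplexVolume (elem conn (x t) k)) := by
  have hmhi := hM.upper_pos hd hΩ.isConnected.nonempty hmlo
  have hN := h₀.one_le_card hΩ
  have hvolΩ := hΩ.volume_real_pos
  have he : 0 < 4 * p - d := by linarith
  obtain ⟨h, hh, hpow, hgram⟩ := hξ.gram
  set I₀ := energy M ξ p conn (σ (x 0)) (x 0) with hI₀
  have hI₀nn : 0 ≤ I₀ := energy_nonneg _ _ _ _ _ _
  set w := MeasureTheory.volume.real Ω with hw
  -- A positive lower bound of `σ` over all nonsingular meshes, covering both choices of `σ`; the
  -- non-degeneration argument needs constants independent of time.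
  obtain ⟨σ₀, hσ₀, hσ₀le⟩ : ∃ σ₀ : ℝ, 0 < σ₀ ∧
      ∀ y, IsNonsingularMesh Ω conn y → σ₀ ≤ σ y := by
    rcases hσ with hσ | ⟨c, hc, hσ⟩
    · exact ⟨mlo ^ ((d : ℝ) / 2) * w, by positivity, fun y hy => by
        rw [hσ]; exact hy.le_sigmaH hΩ hmlo.le hM⟩
    · exact ⟨c, hc, fun y _ => (hσ y).ge⟩
  have hQ : ∀ y, IsNonsingularMesh Ω conn y → 0 < beta d N p mlo (σ y) * w + I₀ := fun y hy => by
    have := beta_pos hd hN p hmlo (hσ₀.trans_le (hσ₀le y hy))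
    positivity
  -- bounds at times up to which no element has degenerated
  have hbound : ∀ t : ℝ, 0 ≤ t → (t : EReal) < T →
      (∀ r ∈ Set.Icc 0 t, Nondegenerate conn (x r)) →
      IsNonsingularMesh Ω conn (x t) ∧ ∀ k, ∃ ρ : ℝ, 0 < ρ ∧
        ρ ≤ minAltitude (avgMetric M (elem conn (x t) k)) (elem conn (x t) k) ∧
        ρ ^ d / ((d.factorial : ℝ) * mhi ^ ((d : ℝ) / 2)) ≤ simplexVolume (elem conn (x t) k) ∧
        mlo ^ ((d : ℝ) / 2) * 2 ^ (1 - 2 * p) * (gradMult d * h / Real.sqrt d) ^ (2 * p) /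
          ((d.factorial : ℝ) * mhi ^ ((d : ℝ) / 2)) ≤
            (beta d N p mlo (σ (x t)) * w + I₀) * ρ ^ (4 * p - d) := by
    intro t ht htT hnd
    have hmesh := hx.isNonsingularMesh hd hΩ.isOpen h₀ hV ht htT hnd
    have hbetween := hmesh.avgMetric_between hΩ hmlo.le hM
    refine ⟨hmesh, fun k => ?_⟩
    refine element_lower_bound hd hmlo hmhi (hbetween k) hξ.det_ne_zero hh hgram
      (hmesh.nondegenerate k) hp ?_
    have h1 := coercivity hmlo ξ hp hbetween (σ (x t)) k
    rw [hmesh.sum_simplexVolume hΩ] at h1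
    have h2 := hx.energy_le hτ hP ht htT hnd
    exact h1.trans (by gcongr)
  have hh0 : 0 < h := by
    refine lt_of_le_of_ne hh fun h0 => ?_
    rw [← h0, zero_pow (by omega), zero_mul] at hpow
    have : (0 : ℝ) < (d.factorial : ℝ) ^ 2 := by positivity
    linarith
  have hnd : ∀ t : ℝ, 0 ≤ t → (t : EReal) < T →
      ∀ r ∈ Set.Icc 0 t, Nondegenerate conn (x r) := by
    intro t ht htT
    have hκ := gradMult_pos d
    have hd0 : (0 : ℝ) < d := by positivity
    -- Solving `c₀ ≤ Q₀ ρ^{4p-d}` for `ρ` gives a threshold `ρ₀` independent of time. It uses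
    -- neither `1 ≤ mhi` nor the exclusion of `d = N = 1`, which enter only through the explicit
    -- constants.
    set c₀ := mlo ^ ((d : ℝ) / 2) * 2 ^ (1 - 2 * p) * (gradMult d * h / Real.sqrt d) ^ (2 * p) /
      ((d.factorial : ℝ) * mhi ^ ((d : ℝ) / 2)) with hc₀
    have hc₀pos : 0 < c₀ := by positivity
    have hβ₀ := beta_pos hd hN p hmlo hσ₀
    set Q₀ := beta d N p mlo σ₀ * w + I₀ with hQ₀
    have hQ₀pos : 0 < Q₀ := by positivity
    set ρ₀ := (c₀ / Q₀) ^ (1 / (4 * p - d)) with hρ₀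
    have hρ₀pos : 0 < ρ₀ := by positivity
    refine nondegenerate_of_lower_bound (δ := ρ₀ ^ d / ((d.factorial : ℝ) * mhi ^ ((d : ℝ) / 2)))
      (hx.continuousOn.mono fun r hr => ⟨hr.1, lt_of_le_of_lt (EReal.coe_le_coe_iff.2 hr.2) htT⟩)
      h₀.nondegenerate (by positivity) ?_
    intro s hs hsnd k
    obtain ⟨hmesh, hρ⟩ := hbound s hs.1 (lt_of_le_of_lt (EReal.coe_le_coe_iff.2 hs.2) htT) hsnd
    obtain ⟨ρ, hρpos, -, hvol, hc⟩ := hρ k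
    have hβ := beta_anti (d := d) hN (by linarith : (0 : ℝ) ≤ p) hmlo hσ₀ (hσ₀le _ hmesh)
    have h1 : c₀ / Q₀ ≤ ρ ^ (4 * p - d) := by
      rw [div_le_iff₀' hQ₀pos]
      have hQle : beta d N p mlo (σ (x s)) * w + I₀ ≤ Q₀ := by rw [hQ₀]; gcongr
      exact hc.trans (mul_le_mul_of_nonneg_right hQle (by positivity))
    have h2 : ρ₀ ≤ ρ := by
      calc ρ₀ ≤ (ρ ^ (4 * p - d)) ^ (1 / (4 * p - d)) :=
            Real.rpow_le_rpow (by positivity) h1 (by positivity)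
        _ = ρ := by rw [← Real.rpow_mul hρpos.le, mul_one_div_cancel he.ne', Real.rpow_one]
    exact le_trans (by gcongr) hvol
  intro t ht htT
  obtain ⟨hmesh, hρ⟩ := hbound t ht htT (hnd t ht htT)
  refine ⟨hmesh, hmesh.le_sigmaH hΩ hmlo.le hM, fun hmhi1 hdN k => ?_⟩
  obtain ⟨ρ, hρpos, halt, hvol, hc⟩ := hρ k
  have h1 := C1_mul_le hd hN hdN hp hpd hmlo hmhi1 hh hpow hρpos (hQ _ hmesh) hc
  refine ⟨h1.trans halt, le_trans ?_ hvol⟩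
  rw [C2_mul_eq hd hmhi]
  have hC1 : 0 ≤ C1 d p (alpha d p mlo mhi) (beta d N p mlo (σ (x t))) w I₀ := by
    have := hQ _ hmesh
    refine Real.rpow_nonneg ?_ _
    unfold alpha
    positivity
  gcongr
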